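/- For $k\in\{1,2,\dots\}$ and a set $S$ of $n\ge 1$ keys from a universe $\mathcal U$, a minimal $k$-perfect hash function for $S$ is a map $F$ from $S$ to the buckets $\{1,\dots,\lceil n/k\rceil\}$ such that each bucket $i\le\lfloor n/k\rfloor$ receives exactly $k$ keys and, if $k\nmid n$, bucket $\lceil n/k\rceil$ receives between $1$ and $k-1$ keys. Assume simple uniform hashing: for every seed $s\in\mathbb N_0$ and every range size there is a fully random hash function on $\mathcal U$, all of them are independent, and they can be evaluated in constant time (for seeds of $O(1)$ words). The machine is a random access machine with words of $w=\Theta(\log(n+k))$ bits (precisely, $w$ is the binary length of $n+k$), on which an arithmetic, bitwise, comparison, memory or hashing instruction takes time polynomial in the number of $w$-bit words occupied by the numbers involved, hence time $O(1)$ on numbers of $O(w)$ bits. Keys are opaque: they can only be hashed. Then there are a construction program, a query program and a constant $C$ such that for all $k\ge 1$, all universes $\mathcal U$, all sets $S\subseteq\mathcal U$ of $n\ge1$ keys, and every order in which the keys of $S$ are presented, the following holds. Given $S$ and $k$, the construction program almost surely halts and produces a data structure consisting of $w$-bit words from which the query program, given only the data structure and a key $x\in S$ (and access to the hash functions), computes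 $F(x)$ for a minimal $k$-perfect hash function $F$ for $S$. Moreover, in expectation over the random hash functions, * for each $x\in S$ the query for $x$ takes time at most $C$; * the data structure occupies at most $C\cdot\frac nk\max(1,\log_2 k)$ bits (for $k\ge2$ this is $O(\frac nk\log k)$); * the construction takes time at most $C\cdot n$. -/

import Mathlib

open MeasureTheory ProbabilityTheory
open scoped ENNReal

/-! ## Minimal `k`-perfect hash functions -/

/-- `F` is a minimal `k`-perfect hash function for the key set `S`, `n = |S|`: it maps `S` to the
buckets `1, …, ⌈n/k⌉`, each bucket `i ≤ ⌊n/k⌋` receives exactly `k` keys and, if `k ∤ n`, the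
bucket `⌈n/k⌉` receives between `1` and `k - 1` keys. -/
structure IsMinimalKPerfect {U : Type*} (k : ℕ) (S : Finset U) (F : U → ℕ) : Prop where
  mem_range : ∀ x ∈ S, 1 ≤ F x ∧ F x ≤ ⌈(S.card : ℚ) / k⌉₊
  full : ∀ i, 1 ≤ i → i ≤ ⌊(S.card : ℚ) / k⌋₊ → (S.filter fun x => F x = i).card = k
  last : ¬ k ∣ S.card →
    1 ≤ (S.filter fun x => F x = ⌈(S.card : ℚ) / k⌉₊).card ∧
      (S.filter fun x => F x = ⌈(S.card : ℚ) / k⌉₊).card ≤ k - 1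

/-! ## Simple uniform hashing -/

/-- Simple uniform hashing: for every index (seed) `s` and every range `{0, …, m}` there is a
fully random function `H s m` from `U` to `{0, …, m}`; all values of all these functions are
independent and uniformly distributed. -/
structure SimpleUniformHashing {U Ω : Type*} [MeasurableSpace Ω] (μ : Measure Ω)
    (H : ℕ → (m : ℕ) → U → Ω → Fin (m + 1)) : Prop where
  measurable : ∀ s m x, Measurable (H s m x)
  uniform : ∀ s m x v, μ {ω | H s m x ω = v} = ((m : ℝ≥0∞) + 1)⁻¹
  indep : iIndepFun (fun i : ℕ × ℕ × U => H i.1 i.2.1 i.2.2) μ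

/-! ## The machine model: a random access machine with word size `w`

Registers and memory cells hold natural numbers. A number is charged by the number of `w`-bit
words that it occupies, so that instructions on numbers of `O(w)` bits take time `O(1)` and
instructions on longer numbers pay for multi-word arithmetic. Keys are opaque: the only thing that
can be done with a key is to evaluate a hash function on it. -/

namespace RAM

/-- Arithmetic, bitwise and comparison operations. -/
inductive BinOp
  | add | sub | mul | div | mod | land | lor | xor | shl | shr | lt | eq

/-- Values of the operations; `sub` is truncated at `0`, division by `0` gives `0`, comparisons
give `1` (true) or `0` (false). -/
def BinOp.apply : BinOp → ℕ → ℕ → ℕ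
  | .add, a, b => a + b
  | .sub, a, b => a - b
  | .mul, a, b => a * b
  | .div, a, b => a / b
  | .mod, a, b => a % b
  | .land, a, b => a &&& b
  | .lor, a, b => a ||| b
  | .xor, a, b => a ^^^ b
  | .shl, a, b => a <<< b
  | .shr, a, b => a >>> b
  | .lt, a, b => if a < b then 1 else 0
  | .eq, a, b => if a = b then 1 else 0

/-- Programs. All arguments but the literal `c` of `const` are names of registers. -/
inductive Prog
  /-- do nothing -/
  | skip
  /-- `r_dst := c` -/
  | const (dst c : ℕ)
  /-- `r_dst := o (r_a, r_b)` -/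
  | op (dst : ℕ) (o : BinOp) (a b : ℕ)
  /-- `r_dst := mem[r_a]` -/
  | load (dst a : ℕ)
  /-- `mem[r_a] := r_src` -/
  | store (a src : ℕ)
  /-- `r_dst :=` value at the `r_key`-th input key (counted from `0`) of the random hash function
  with seed `r_seed` and range `{0, …, r_range}` -/
  | hash (dst key seed range : ℕ)
  /-- first `p`, then `q` -/
  | seq (p q : Prog)
  /-- if `r_t ≠ 0` then `p` else `q` -/
  | ite (t : ℕ) (p q : Prog)
  /-- while `r_t ≠ 0` do `p` -/
  | loop (t : ℕ) (p : Prog)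

/-- Contents of the registers and of the memory. -/
@[ext] structure State where
  reg : ℕ → ℕ
  mem : ℕ → ℕ

/-- What a program runs on: the word size, the input keys and the hash functions. -/
structure Env (U : Type*) where
  w : ℕ
  keys : List U
  hash : ℕ → (m : ℕ) → U → Fin (m + 1)

/-- The state in which register `d` has been set to `v`. -/
def State.setReg (s : State) (d v : ℕ) : State := ⟨Function.update s.reg d v, s.mem⟩

/-- The state in which memory cell `a` has been set to `v`. -/
def State.setMem (s : State) (a v : ℕ) : State := ⟨s.reg, Function.update s.mem a v⟩

variable {U : Type*}

/-- Number of `w`-bit words charged for the number `v`. -/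
def Env.words (M : Env U) (v : ℕ) : ℕ := Nat.size v / M.w + 1

/-- Value of the hash function with seed `s` and range `{0, …, m}` at the `j`-th input key
(and `0` if there is no such key). -/
def Env.hashAt (M : Env U) (j s m : ℕ) : ℕ :=
  match M.keys[j]? with
  | some x => M.hash s m x
  | none => 0

/-- `Exec M p s s' t`: started in state `s`, the program `p` halts in state `s'` after time `t`. -/
inductive Exec (M : Env U) : Prog → State → State → ℕ → Prop
  | skip (s) : Exec M .skip s s 1
  | const (s d c) : Exec M (.const d c) s (s.setReg d c) (M.words c)
  | op (s d o a b) : Exec M (.op d o a b) s (s.setReg d (o.apply (s.reg a) (s.reg b)))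
      ((M.words (s.reg a) + M.words (s.reg b) + M.words (o.apply (s.reg a) (s.reg b))) ^ 2)
  | load (s d a) : Exec M (.load d a) s (s.setReg d (s.mem (s.reg a)))
      (M.words (s.reg a) + M.words (s.mem (s.reg a)))
  | store (s a r) : Exec M (.store a r) s (s.setMem (s.reg a) (s.reg r))
      (M.words (s.reg a) + M.words (s.reg r))
  | hash (s d j i m) :
      Exec M (.hash d j i m) s (s.setReg d (M.hashAt (s.reg j) (s.reg i) (s.reg m)))
        (M.words (s.reg j) + M.words (s.reg i) + M.words (s.reg m))
  | seq {p q s s₁ s₂ t₁ t₂} : Exec M p s s₁ t₁ → Exec M q s₁ s₂ t₂ →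
      Exec M (.seq p q) s s₂ (t₁ + t₂)
  | ite_true {p q s s' t r} : s.reg r ≠ 0 → Exec M p s s' t →
      Exec M (.ite r p q) s s' (M.words (s.reg r) + t)
  | ite_false {p q s s' t r} : s.reg r = 0 → Exec M q s s' t →
      Exec M (.ite r p q) s s' (M.words (s.reg r) + t)
  | loop_true {p s s₁ s₂ t₁ t₂ r} : s.reg r ≠ 0 → Exec M p s s₁ t₁ →
      Exec M (.loop r p) s₁ s₂ t₂ → Exec M (.loop r p) s s₂ (M.words (s.reg r) + t₁ + t₂)
  | loop_false {p s r} : s.reg r = 0 → Exec M (.loop r p) s s (M.words (s.reg r))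

/-- Executions are deterministic, so final state and running time are unique. -/
theorem Exec.unique {M : Env U} {p : Prog} {s s₁ s₂ : State} {t₁ t₂ : ℕ}
    (h₁ : Exec M p s s₁ t₁) (h₂ : Exec M p s s₂ t₂) : s₁ = s₂ ∧ t₁ = t₂ := by
  induction h₁ generalizing s₂ t₂ with
  | skip => cases h₂; exact ⟨rfl, rfl⟩
  | const => cases h₂; exact ⟨rfl, rfl⟩
  | op => cases h₂; exact ⟨rfl, rfl⟩
  | load => cases h₂; exact ⟨rfl, rfl⟩
  | store => cases h₂; exact ⟨rfl, rfl⟩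
  | hash => cases h₂; exact ⟨rfl, rfl⟩
  | seq _ _ ih₁ ih₂ =>
    cases h₂ with
    | seq a b =>
      obtain ⟨rfl, rfl⟩ := ih₁ a
      obtain ⟨rfl, rfl⟩ := ih₂ b
      exact ⟨rfl, rfl⟩
  | ite_true hr _ ih =>
    cases h₂ with
    | ite_true _ a => obtain ⟨rfl, rfl⟩ := ih a; exact ⟨rfl, rfl⟩
    | ite_false h0 _ => exact absurd h0 hr
  | ite_false hr _ ih =>
    cases h₂ with
    | ite_true h0 _ => exact absurd hr h0
    | ite_false _ a => obtain ⟨rfl, rfl⟩ := ih a; exact ⟨rfl, rfl⟩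
  | loop_true hr _ _ ih₁ ih₂ =>
    cases h₂ with
    | loop_true _ a b =>
      obtain ⟨rfl, rfl⟩ := ih₁ a
      obtain ⟨rfl, rfl⟩ := ih₂ b
      exact ⟨rfl, rfl⟩
    | loop_false h0 => exact absurd h0 hr
  | loop_false hr =>
    cases h₂ with
    | loop_true h0 _ _ => exact absurd hr h0
    | loop_false _ => exact ⟨rfl, rfl⟩

/-- Initial state of a construction: register `0` holds the number of keys, register `1` holds
`k`, everything else is `0`. -/
def buildInit (n k : ℕ) : State :=
  ⟨fun r => if r = 0 then n else if r = 1 then k else 0, fun _ => 0⟩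

/-- Initial state of a query. A construction leaves the number `L` of memory cells of its data
structure in register `0` and the data structure in the cells `0, …, L - 1`; a query finds exactly
these cells, everything else is `0`. -/
def queryInit (d : State) : State :=
  ⟨fun _ => 0, fun a => if a < d.reg 0 then d.mem a else 0⟩

/-- The environment of a construction for the listed keys. The word size is the binary length of
`n + k`, where `n` is the number of keys. -/
def buildEnv (k : ℕ) (keys : List U) (hash : ℕ → (m : ℕ) → U → Fin (m + 1)) : Env U :=
  ⟨Nat.size (keys.length + k), keys, hash⟩

/-- The environment of a query for the key `x` to a data structure for `n` keys: the same word
size, and `x` as the only key. -/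
def queryEnv (n k : ℕ) (x : U) (hash : ℕ → (m : ℕ) → U → Fin (m + 1)) : Env U :=
  ⟨Nat.size (n + k), [x], hash⟩

/-- The construction halts, its data structure consists of proper words, and the queries for the
keys halt with the values (in register `0`) of a minimal `k`-perfect hash function. -/
def Correct (build query : Prog) (k : ℕ) (S : Finset U) (keys : List U)
    (hash : ℕ → (m : ℕ) → U → Fin (m + 1)) : Prop :=
  ∃ (d : State) (t : ℕ), Exec (buildEnv k keys hash) build (buildInit keys.length k) d t ∧
    (∀ a < d.reg 0, d.mem a < 2 ^ Nat.size (keys.length + k)) ∧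
    ∃ F : U → ℕ, IsMinimalKPerfect k S F ∧
      ∀ x ∈ S, ∃ (e : State) (t' : ℕ),
        Exec (queryEnv keys.length k x hash) query (queryInit d) e t' ∧ e.reg 0 = F x

/-- Running time of the construction (`∞` if it does not halt). -/
noncomputable def buildTime (build : Prog) (k : ℕ) (keys : List U)
    (hash : ℕ → (m : ℕ) → U → Fin (m + 1)) : ℝ≥0∞ :=
  ⨅ (d : State) (t : ℕ) (_ : Exec (buildEnv k keys hash) build (buildInit keys.length k) d t),
    (t : ℝ≥0∞)

/-- Size in bits of the constructed data structure: number of words times word size (`∞` if the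
construction does not halt). -/
noncomputable def spaceBits (build : Prog) (k : ℕ) (keys : List U)
    (hash : ℕ → (m : ℕ) → U → Fin (m + 1)) : ℝ≥0∞ :=
  ⨅ (d : State) (t : ℕ) (_ : Exec (buildEnv k keys hash) build (buildInit keys.length k) d t),
    ((d.reg 0 * Nat.size (keys.length + k) : ℕ) : ℝ≥0∞)

/-- Running time of the query for `x` to the constructed data structure (`∞` if the construction
or the query does not halt). -/
noncomputable def queryTime (build query : Prog) (k : ℕ) (keys : List U) (x : U)
    (hash : ℕ → (m : ℕ) → U → Fin (m + 1)) : ℝ≥0∞ :=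
  ⨅ (d : State) (t : ℕ) (_ : Exec (buildEnv k keys hash) build (buildInit keys.length k) d t)
    (e : State) (t' : ℕ)
    (_ : Exec (queryEnv keys.length k x hash) query (queryInit d) e t'), (t' : ℝ≥0∞)

end RAM

/-! The construction works by rounds with bumping. As long as N ≥ k keys are left, round l hashes
them with seed l into ⌊N/(8k)⌋ + 1 blocks of 2k cells. If some initial segment of a block contains
exactly k keys, the longest such segment yields a bucket, and its length is a threshold of at most
2k, that is O(log k) bits. All other keys are bumped to the next round. Fewer than k remaining keys
form the last bucket. Buckets are numbered by round and then by block. Since each round removes a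
multiple of k keys, exactly n / k full buckets and n % k leftover keys result (`Rounds.card_full`,
`Rounds.card_last`).

The core is that a given key gets a bucket with constant probability in every round that takes place
(`Count.prob_le_card_taken`). A block receives at least k keys with probability at least 1/2, by an
exponential moment bound. The prefix count may however jump over the value k. Let `cross` weigh the
placements in which the k-th key of a block lies in cell t, and `hit` those in which moreover
exactly k keys lie in the first t + 1 cells. Up to a constant factor, Σ `cross` is at most Σ `hit`
(`Count.sum_cross_le`): for small t the other keys avoid one more cell at constant cost, and for
large t the weight of cell t is comparable to that of cell t - 1. Summing `hit` over the blocks and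
over the k-sets containing the key gives the probability. Fresh seeds make the rounds independent,
so a key takes part in round l with probability at most `stay` ^ l (`Rounds.measure_mem_active_le`).

Space: with d the bit length of 2k and w the word size, g = ⌊w/d⌋ thresholds fit into a word. A
group of g blocks gets three words: its first bucket number, one flag per block telling whether
there is a bucket, and the thresholds. A table of digit sums for all g-bit numbers ranks the flags
in constant time; it has O(√(n/k)) entries. The thresholds take O((n/k) log k) expected bits. Each
round that happens costs O(w) further bits; it happens with probability at most min(1, (n/k) `stay`
^ l) ≤ √(n/k) √`stay` ^ l, and w √(n/k) = O((n/k) max(1, log k)) (`lintegral_space_le`).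

Time: round l is linear in the number of keys left, and a query spends O(1) instructions on each
round that its key goes through. Addresses and seeds grow with l, so an instruction of round l may
cost O((l + 1)²); this is absorbed by the convergent series Σ (l + 2)² `stay` ^ l.

The programs are written in a small structured language whose compilation is verified once
(`Blk.run`, `RunT.whl_count`); `round_run` and `step_run` then connect one round of the programs
with its combinatorial description. -/

/-! ### A structured language and its verified compilation -/

namespace RAM

/-- Expressions over the registers and the memory. -/
inductive Ex
  | v (r : ℕ)
  | c (n : ℕ)
  | bin (o : BinOp) (a b : Ex)
  | ld (a : Ex)

namespace Ex

instance : Add Ex := ⟨.bin .add⟩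
instance : Sub Ex := ⟨.bin .sub⟩
instance : Mul Ex := ⟨.bin .mul⟩
instance : Div Ex := ⟨.bin .div⟩
instance : Mod Ex := ⟨.bin .mod⟩

/-- Value of an expression. -/
def eval (s : State) : Ex → ℕ
  | v r => s.reg r
  | c n => n
  | bin o a b => o.apply (a.eval s) (b.eval s)
  | ld a => s.mem (a.eval s)

/-- Only registers below `20` occur and all intermediate values are at most `V`. -/
def ok (V : ℕ) (s : State) : Ex → Prop
  | v r => r < 20 ∧ s.reg r ≤ V
  | c n => n ≤ V
  | bin o a b => a.ok V s ∧ b.ok V s ∧ o.apply (a.eval s) (b.eval s) ≤ V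
  | ld a => a.ok V s ∧ s.mem (a.eval s) ≤ V

/-- Code that evaluates an expression into register `d`, using registers from `d` on. -/
def comp : Ex → ℕ → Prog
  -- The machine has no move instruction; `x ||| x = x` copies a register.
  | v r, d => .op d .lor r r
  | c n, d => .const d n
  | bin o a b, d => .seq (a.comp d) (.seq (b.comp (d + 1)) (.op d o d (d + 1)))
  | ld a, d => .seq (a.comp d) (.load d d)

/-- Number of instructions of the code of an expression. -/
def cost : Ex → ℕ
  | v _ => 1
  | c _ => 1
  | bin _ a b => a.cost + b.cost + 1
  | ld a => a.cost + 1

section simps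
variable (V : ℕ) (s : State) (a b : Ex) (n : ℕ)
@[simp] theorem eval_add : (a + b).eval s = a.eval s + b.eval s := rfl
@[simp] theorem eval_sub : (a - b).eval s = a.eval s - b.eval s := rfl
@[simp] theorem eval_mul : (a * b).eval s = a.eval s * b.eval s := rfl
@[simp] theorem eval_div : (a / b).eval s = a.eval s / b.eval s := rfl
@[simp] theorem eval_mod : (a % b).eval s = a.eval s % b.eval s := rfl
@[simp] theorem eval_c : (c n).eval s = n := rfl
@[simp] theorem eval_v : (v n).eval s = s.reg n := rfl
@[simp] theorem eval_ld : (ld a).eval s = s.mem (a.eval s) := rfl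
@[simp] theorem eval_lt : (bin .lt a b).eval s = if a.eval s < b.eval s then 1 else 0 := rfl
@[simp] theorem eval_eq : (bin .eq a b).eval s = if a.eval s = b.eval s then 1 else 0 := rfl
@[simp] theorem eval_shl : (bin .shl a b).eval s = a.eval s * 2 ^ b.eval s :=
  Nat.shiftLeft_eq _ _
@[simp] theorem eval_shr : (bin .shr a b).eval s = a.eval s / 2 ^ b.eval s :=
  Nat.shiftRight_eq_div_pow _ _
@[simp] theorem ok_add : (a + b).ok V s ↔ a.ok V s ∧ b.ok V s ∧ a.eval s + b.eval s ≤ V := Iff.rfl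
theorem ok_sub' : (a - b).ok V s ↔ a.ok V s ∧ b.ok V s ∧ a.eval s - b.eval s ≤ V := Iff.rfl
@[simp] theorem ok_mul : (a * b).ok V s ↔ a.ok V s ∧ b.ok V s ∧ a.eval s * b.eval s ≤ V := Iff.rfl
theorem ok_div' : (a / b).ok V s ↔ a.ok V s ∧ b.ok V s ∧ a.eval s / b.eval s ≤ V := Iff.rfl
theorem ok_mod' : (a % b).ok V s ↔ a.ok V s ∧ b.ok V s ∧ a.eval s % b.eval s ≤ V := Iff.rfl
@[simp] theorem ok_c : (c n).ok V s ↔ n ≤ V := Iff.rfl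
@[simp] theorem ok_v : (v n).ok V s ↔ n < 20 ∧ s.reg n ≤ V := Iff.rfl
@[simp] theorem ok_ld : (ld a).ok V s ↔ a.ok V s ∧ s.mem (a.eval s) ≤ V := Iff.rfl
@[simp] theorem ok_lt : (bin .lt a b).ok V s ↔
    a.ok V s ∧ b.ok V s ∧ (if a.eval s < b.eval s then 1 else 0) ≤ V := Iff.rfl
@[simp] theorem ok_eq : (bin .eq a b).ok V s ↔
    a.ok V s ∧ b.ok V s ∧ (if a.eval s = b.eval s then 1 else 0) ≤ V := Iff.rfl
@[simp] theorem ok_shl : (bin .shl a b).ok V s ↔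
    a.ok V s ∧ b.ok V s ∧ a.eval s * 2 ^ b.eval s ≤ V := by
  rw [← Nat.shiftLeft_eq]; exact Iff.rfl
theorem ok_shr' : (bin .shr a b).ok V s ↔
    a.ok V s ∧ b.ok V s ∧ a.eval s / 2 ^ b.eval s ≤ V := by
  rw [← Nat.shiftRight_eq_div_pow]; exact Iff.rfl

theorem eval_le_of_ok {V : ℕ} {s : State} : ∀ {e : Ex}, e.ok V s → e.eval s ≤ V
  | v _, h => h.2
  | c _, h => h
  | bin _ _ _, h => h.2.2
  | ld _, h => h.2

-- The result never exceeds the first operand, so no bound on it is required; the same holds for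
-- quotients, remainders and right shifts.
@[simp] theorem ok_sub : (a - b).ok V s ↔ a.ok V s ∧ b.ok V s := by
  rw [ok_sub']
  exact ⟨fun h => ⟨h.1, h.2.1⟩, fun h => ⟨h.1, h.2, (Nat.sub_le _ _).trans (eval_le_of_ok h.1)⟩⟩
@[simp] theorem ok_div : (a / b).ok V s ↔ a.ok V s ∧ b.ok V s := by
  rw [ok_div']
  exact ⟨fun h => ⟨h.1, h.2.1⟩, fun h => ⟨h.1, h.2, (Nat.div_le_self _ _).trans (eval_le_of_ok h.1)⟩⟩
@[simp] theorem ok_mod : (a % b).ok V s ↔ a.ok V s ∧ b.ok V s := by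
  rw [ok_mod']
  exact ⟨fun h => ⟨h.1, h.2.1⟩, fun h => ⟨h.1, h.2, (Nat.mod_le _ _).trans (eval_le_of_ok h.1)⟩⟩
@[simp] theorem ok_shr : (bin .shr a b).ok V s ↔ a.ok V s ∧ b.ok V s := by
  rw [ok_shr']
  exact ⟨fun h => ⟨h.1, h.2.1⟩, fun h => ⟨h.1, h.2, (Nat.div_le_self _ _).trans (eval_le_of_ok h.1)⟩⟩
end simps

end Ex

/-- Loop-free statements. -/
inductive Blk
  | nop
  | set (r : ℕ) (e : Ex)
  | put (a e : Ex)
  | hsh (r : ℕ) (key seed range : Ex)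
  | sq (p q : Blk)
  | cond (e : Ex) (p q : Blk)

namespace Blk

/-- Effect of a statement. -/
def exec (h : ℕ → ℕ → ℕ → ℕ) : Blk → State → State
  | nop, s => s
  | set r e, s => s.setReg r (e.eval s)
  | put a e, s => s.setMem (a.eval s) (e.eval s)
  | hsh r j i m, s => s.setReg r (h (j.eval s) (i.eval s) (m.eval s))
  | sq p q, s => q.exec h (p.exec h s)
  | cond e p q, s => if e.eval s = 0 then q.exec h s else p.exec h s

/-- The statement uses only registers below `20` and only values up to `V`. -/
def ok (h : ℕ → ℕ → ℕ → ℕ) (V : ℕ) : Blk → State → Prop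
  | nop, _ => True
  | set r e, s => r < 20 ∧ e.ok V s
  | put a e, s => a.ok V s ∧ e.ok V s
  | hsh r j i m, s => r < 20 ∧ j.ok V s ∧ i.ok V s ∧ m.ok V s
  | sq p q, s => p.ok h V s ∧ q.ok h V (p.exec h s)
  | cond e p q, s => e.ok V s ∧ (e.eval s = 0 → q.ok h V s) ∧ (e.eval s ≠ 0 → p.ok h V s)

/-- Code of a statement. -/
def comp : Blk → Prog
  | nop => .skip
  | set r e => .seq (e.comp 20) (.op r .lor 20 20)
  | put a e => .seq (a.comp 20) (.seq (e.comp 21) (.store 20 21))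
  | hsh r j i m => .seq (j.comp 20) (.seq (i.comp 21) (.seq (m.comp 22) (.hash r 20 21 22)))
  | sq p q => .seq p.comp q.comp
  | cond e p q => .seq (e.comp 20) (.ite 20 p.comp q.comp)

/-- Bound for the number of executed instructions. -/
def cost : Blk → ℕ
  | nop => 1
  | set _ e => e.cost + 1
  | put a e => a.cost + e.cost + 1
  | hsh _ j i m => j.cost + i.cost + m.cost + 1
  | sq p q => p.cost + q.cost
  | cond e p q => e.cost + 1 + p.cost + q.cost

end Blk

/-- Code of a loop that runs `p` as long as `e` is nonzero. -/
def whl (e : Ex) (p : Prog) : Prog := .seq (e.comp 20) (.loop 20 (.seq p (e.comp 20)))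

/-- Code of a conditional. -/
def cnd (e : Ex) (p q : Prog) : Prog := .seq (e.comp 20) (.ite 20 p q)

/-- The two states agree on the memory and on the registers below `20`. -/
def Agree (s s' : State) : Prop := (∀ r < 20, s'.reg r = s.reg r) ∧ s'.mem = s.mem

theorem Agree.refl (s : State) : Agree s s := ⟨fun _ _ => rfl, rfl⟩

variable {U : Type*}

/-- Time of an instruction on numbers up to `V`. -/
def unit (M : Env U) (V : ℕ) : ℕ := (3 * M.words V) ^ 2

/-- The hash values of an environment. -/
def Env.hv (M : Env U) : ℕ → ℕ → ℕ → ℕ := M.hashAt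

theorem words_mono (M : Env U) {a b : ℕ} (h : a ≤ b) : M.words a ≤ M.words b :=
  Nat.add_le_add_right (Nat.div_le_div_right (Nat.size_le_size h)) 1

theorem words_pos (M : Env U) (a : ℕ) : 1 ≤ M.words a := Nat.le_add_left _ _

theorem three_words_le_unit (M : Env U) (V : ℕ) : 3 * M.words V ≤ unit M V := by
  unfold unit; nlinarith [words_pos M V]

/-- Values do not depend on the scratch registers, because `ok` admits registers below 20 only. -/
theorem Ex.eval_congr {s s' : State} {V : ℕ} (h : Agree s s') :
    ∀ {e : Ex}, e.ok V s → e.eval s' = e.eval s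
  | v r, hk => h.1 r hk.1
  | c _, _ => rfl
  | bin o a b, hk => by simp only [eval]; rw [eval_congr h hk.1, eval_congr h hk.2.1]
  | ld a, hk => by simp only [eval]; rw [eval_congr h hk.1, h.2]

/-- Scratch registers are used as a stack: the second operand is computed from `d + 1` on and leaves
the first one in `d` intact. The state `s₁` may differ from `s` in scratch registers, which makes
the statement composable. -/
theorem Ex.exec_comp (M : Env U) (V : ℕ) {s : State} :
    ∀ (e : Ex) (d : ℕ) (s₁ : State), 20 ≤ d → Agree s s₁ → e.ok V s →
    ∃ s' t, Exec M (e.comp d) s₁ s' t ∧ (∀ r < d, s'.reg r = s₁.reg r) ∧ s'.mem = s₁.mem ∧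
      s'.reg d = e.eval s ∧ t ≤ e.cost * unit M V
  | v r, d, s₁, hd, h, hk => by
    have hr : s₁.reg r = s.reg r := h.1 r hk.1
    have h1 : M.words (s.reg r) ≤ M.words V := words_mono M hk.2
    refine ⟨_, _, Exec.op _ _ _ _ _, ?_, rfl, ?_, ?_⟩
    · intro r hr; simp [State.setReg, Function.update, hr.ne]
    · simp [State.setReg, BinOp.apply, eval, hr]
    · simp only [BinOp.apply, Nat.or_self, hr, cost, one_mul, unit]
      gcongr; omega
  | c n, d, s₁, hd, h, hk => by
    refine ⟨_, _, Exec.const _ _ _, ?_, rfl, ?_, ?_⟩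
    · intro r hr; simp [State.setReg, Function.update, hr.ne]
    · simp [State.setReg, eval]
    · have := words_mono M hk
      have := three_words_le_unit M V
      simp only [cost]; omega
  | bin o a b, d, s₁, hd, h, hk => by
    obtain ⟨s₂, t₂, e₂, f₂, m₂, v₂, c₂⟩ := exec_comp M V a d s₁ hd h hk.1
    have h₂ : Agree s s₂ := ⟨fun r hr => (f₂ r (by omega)).trans (h.1 r hr), m₂.trans h.2⟩
    obtain ⟨s₃, t₃, e₃, f₃, m₃, v₃, c₃⟩ := exec_comp M V b (d + 1) s₂ (by omega) h₂ hk.2.1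
    have hv : s₃.reg d = a.eval s := (f₃ d (by omega)).trans v₂
    refine ⟨_, _, Exec.seq e₂ (Exec.seq e₃ (Exec.op _ _ _ _ _)), ?_, ?_, ?_, ?_⟩
    · intro r hr
      simp only [State.setReg, Function.update, hr.ne, ↓reduceDIte]
      rw [f₃ r (by omega), f₂ r hr]
    · simp [State.setReg, m₃, m₂]
    · simp [State.setReg, hv, v₃, eval]
    · rw [hv, v₃]
      have h1 := words_mono M (eval_le_of_ok hk.1)
      have h2 := words_mono M (eval_le_of_ok hk.2.1)
      have h3 := words_mono M hk.2.2
      have : (M.words (a.eval s) + M.words (b.eval s) +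
          M.words (o.apply (a.eval s) (b.eval s))) ^ 2 ≤ unit M V := by
        unfold unit; gcongr; omega
      simp only [cost]; nlinarith
  | ld a, d, s₁, hd, h, hk => by
    obtain ⟨s₂, t₂, e₂, f₂, m₂, v₂, c₂⟩ := exec_comp M V a d s₁ hd h hk.1
    refine ⟨_, _, Exec.seq e₂ (Exec.load _ _ _), ?_, ?_, ?_, ?_⟩
    · intro r hr
      simp only [State.setReg, Function.update, hr.ne, ↓reduceDIte]
      exact f₂ r hr
    · simp [State.setReg, m₂]
    · simp [State.setReg, v₂, m₂, h.2, eval]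
    · rw [v₂, m₂, h.2]
      have h1 := words_mono M (eval_le_of_ok hk.1)
      have h2 := words_mono M hk.2
      have := three_words_le_unit M V
      simp only [cost]; nlinarith

/-- Started in a state that agrees with `s`, the program `p` halts within time `t` in a state that
agrees with `s'`. -/
def RunT (M : Env U) (p : Prog) (s s' : State) (t : ℕ) : Prop :=
  ∀ s₁, Agree s s₁ → ∃ s₂ t', Exec M p s₁ s₂ t' ∧ Agree s' s₂ ∧ t' ≤ t

theorem RunT.mono {M : Env U} {p : Prog} {s s' : State} {t t' : ℕ} (h : RunT M p s s' t)
    (ht : t ≤ t') : RunT M p s s' t' := fun s₁ h₁ => by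
  obtain ⟨s₂, u, a, b, c⟩ := h s₁ h₁
  exact ⟨s₂, u, a, b, c.trans ht⟩

theorem RunT.seq {M : Env U} {p q : Prog} {s s' s'' : State} {t t' : ℕ} (h : RunT M p s s' t)
    (h' : RunT M q s' s'' t') : RunT M (.seq p q) s s'' (t + t') := fun s₁ h₁ => by
  obtain ⟨s₂, u, a, b, c⟩ := h s₁ h₁
  obtain ⟨s₃, u', a', b', c'⟩ := h' s₂ b
  exact ⟨s₃, _, .seq a a', b', Nat.add_le_add c c'⟩

theorem Agree.setReg {s s₁ : State} (h : Agree s s₁) (r x : ℕ) :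
    Agree (s.setReg r x) (s₁.setReg r x) := by
  refine ⟨fun q hq => ?_, h.2⟩
  by_cases hqr : q = r
  · subst hqr; simp [State.setReg]
  · simp [State.setReg, Function.update, hqr, h.1 q hq]

theorem Agree.of_eq {s s₁ s₂ : State} (h : Agree s s₁) (hr : ∀ r < 20, s₂.reg r = s₁.reg r)
    (hm : s₂.mem = s₁.mem) : Agree s s₂ :=
  ⟨fun r hr' => (hr r hr').trans (h.1 r hr'), hm.trans h.2⟩

/-- Reduces loop-free code to the function `Blk.exec`, which can be simplified, and to the side
condition that all numbers stay below `V`, which bounds the price of an instruction. -/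
theorem Blk.run (M : Env U) (V : ℕ) : ∀ (b : Blk) (s : State), b.ok M.hv V s →
    RunT M b.comp s (b.exec M.hv s) (b.cost * unit M V)
  | nop, s, _ => fun s₁ h₁ => ⟨s₁, 1, .skip _, h₁, by
      have := three_words_le_unit M V
      have := words_pos M V
      simp only [cost]; omega⟩
  | set r e, s, hk => fun s₁ h₁ => by
    obtain ⟨s₂, t₂, e₂, f₂, m₂, v₂, c₂⟩ := Ex.exec_comp M V e 20 s₁ le_rfl h₁ hk.2
    have hw := words_mono M (Ex.eval_le_of_ok hk.2)
    have ha := (h₁.of_eq f₂ m₂).setReg r (e.eval s)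
    refine ⟨_, _, Exec.seq e₂ (Exec.op _ _ _ _ _), ?_, ?_⟩
    · simpa [BinOp.apply, v₂, exec] using ha
    · simp only [BinOp.apply, Nat.or_self, v₂]
      have : (M.words (e.eval s) + M.words (e.eval s) + M.words (e.eval s)) ^ 2 ≤ unit M V := by
        unfold unit; gcongr; omega
      simp only [cost]; nlinarith
  | put a e, s, hk => fun s₁ h₁ => by
    obtain ⟨s₂, t₂, e₂, f₂, m₂, v₂, c₂⟩ := Ex.exec_comp M V a 20 s₁ le_rfl h₁ hk.1
    have h₂ := h₁.of_eq f₂ m₂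
    obtain ⟨s₃, t₃, e₃, f₃, m₃, v₃, c₃⟩ := Ex.exec_comp M V e 21 s₂ (by omega) h₂ hk.2
    have h₃ := h₂.of_eq (fun r hr => f₃ r (by omega)) m₃
    have hv : s₃.reg 20 = a.eval s := (f₃ 20 (by omega)).trans v₂
    refine ⟨_, _, Exec.seq e₂ (Exec.seq e₃ (Exec.store _ _ _)), ?_, ?_⟩
    · rw [hv, v₃]
      exact ⟨h₃.1, by simp [exec, State.setMem, h₃.2]⟩
    · rw [hv, v₃]
      have h1 := words_mono M (Ex.eval_le_of_ok hk.1)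
      have h2 := words_mono M (Ex.eval_le_of_ok hk.2)
      have := three_words_le_unit M V
      simp only [cost]; nlinarith
  | hsh r j i m, s, hk => fun s₁ h₁ => by
    obtain ⟨s₂, t₂, e₂, f₂, m₂, v₂, c₂⟩ := Ex.exec_comp M V j 20 s₁ le_rfl h₁ hk.2.1
    have h₂ := h₁.of_eq f₂ m₂
    obtain ⟨s₃, t₃, e₃, f₃, m₃, v₃, c₃⟩ := Ex.exec_comp M V i 21 s₂ (by omega) h₂ hk.2.2.1
    have h₃ := h₂.of_eq (fun r hr => f₃ r (by omega)) m₃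
    obtain ⟨s₄, t₄, e₄, f₄, m₄, v₄, c₄⟩ := Ex.exec_comp M V m 22 s₃ (by omega) h₃ hk.2.2.2
    have h₄ := h₃.of_eq (fun r hr => f₄ r (by omega)) m₄
    have hv : s₄.reg 20 = j.eval s :=
      (f₄ 20 (by omega)).trans ((f₃ 20 (by omega)).trans v₂)
    have hv' : s₄.reg 21 = i.eval s := (f₄ 21 (by omega)).trans v₃
    refine ⟨_, _, Exec.seq e₂ (Exec.seq e₃ (Exec.seq e₄ (Exec.hash _ _ _ _ _))), ?_, ?_⟩
    · rw [hv, hv', v₄]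
      exact h₄.setReg _ _
    · rw [hv, hv', v₄]
      have h1 := words_mono M (Ex.eval_le_of_ok hk.2.1)
      have h2 := words_mono M (Ex.eval_le_of_ok hk.2.2.1)
      have h3 := words_mono M (Ex.eval_le_of_ok hk.2.2.2)
      have := three_words_le_unit M V
      simp only [cost]; nlinarith
  | sq p q, s, hk => by
    have := (Blk.run M V p s hk.1).seq (Blk.run M V q _ hk.2)
    simp only [cost, add_mul]
    exact this
  | cond e p q, s, hk => fun s₁ h₁ => by
    obtain ⟨s₂, t₂, e₂, f₂, m₂, v₂, c₂⟩ := Ex.exec_comp M V e 20 s₁ le_rfl h₁ hk.1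
    have h₂ := h₁.of_eq f₂ m₂
    have h1 := words_mono M (Ex.eval_le_of_ok hk.1)
    have := three_words_le_unit M V
    by_cases h0 : e.eval s = 0
    · obtain ⟨s₃, u, a, b, c⟩ := Blk.run M V q s (hk.2.1 h0) s₂ h₂
      refine ⟨s₃, _, Exec.seq e₂ (Exec.ite_false (v₂.trans h0) a), by simpa [exec, h0] using b, ?_⟩
      rw [v₂]; simp only [cost]; nlinarith
    · obtain ⟨s₃, u, a, b, c⟩ := Blk.run M V p s (hk.2.2 h0) s₂ h₂
      refine ⟨s₃, _, Exec.seq e₂ (Exec.ite_true (by rwa [v₂]) a), by simpa [exec, h0] using b, ?_⟩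
      rw [v₂]; simp only [cost]; nlinarith

theorem RunT.cnd_true {M : Env U} {V : ℕ} {e : Ex} {p q : Prog} {s s' : State} {t : ℕ}
    (hk : e.ok V s) (he : e.eval s ≠ 0) (h : RunT M p s s' t) :
    RunT M (cnd e p q) s s' ((e.cost + 1) * unit M V + t) := fun s₁ h₁ => by
  obtain ⟨s₂, t₂, e₂, f₂, m₂, v₂, c₂⟩ := Ex.exec_comp M V e 20 s₁ le_rfl h₁ hk
  obtain ⟨s₃, u, a, b, c⟩ := h s₂ (h₁.of_eq f₂ m₂)
  have h1 := words_mono M (Ex.eval_le_of_ok hk)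
  have := three_words_le_unit M V
  refine ⟨s₃, _, Exec.seq e₂ (Exec.ite_true (by rwa [v₂]) a), b, ?_⟩
  rw [v₂]; nlinarith

theorem RunT.cnd_false {M : Env U} {V : ℕ} {e : Ex} {p q : Prog} {s s' : State} {t : ℕ}
    (hk : e.ok V s) (he : e.eval s = 0) (h : RunT M q s s' t) :
    RunT M (cnd e p q) s s' ((e.cost + 1) * unit M V + t) := fun s₁ h₁ => by
  obtain ⟨s₂, t₂, e₂, f₂, m₂, v₂, c₂⟩ := Ex.exec_comp M V e 20 s₁ le_rfl h₁ hk
  obtain ⟨s₃, u, a, b, c⟩ := h s₂ (h₁.of_eq f₂ m₂)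
  have h1 := words_mono M (Ex.eval_le_of_ok hk)
  have := three_words_le_unit M V
  refine ⟨s₃, _, Exec.seq e₂ (Exec.ite_false (by rwa [v₂]) a), b, ?_⟩
  rw [v₂]; nlinarith

theorem RunT.whl_false {M : Env U} {V : ℕ} {e : Ex} {p : Prog} {s : State}
    (hk : e.ok V s) (he : e.eval s = 0) :
    RunT M (whl e p) s s ((e.cost + 1) * unit M V) := fun s₁ h₁ => by
  obtain ⟨s₂, t₂, e₂, f₂, m₂, v₂, c₂⟩ := Ex.exec_comp M V e 20 s₁ le_rfl h₁ hk
  have h1 := words_mono M (Ex.eval_le_of_ok hk)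
  have := three_words_le_unit M V
  refine ⟨s₂, _, Exec.seq e₂ (Exec.loop_false (by rwa [v₂])), h₁.of_eq f₂ m₂, ?_⟩
  rw [v₂]; nlinarith

theorem RunT.whl_true {M : Env U} {V : ℕ} {e : Ex} {p : Prog} {s s' s'' : State} {t t' : ℕ}
    (hk : e.ok V s) (he : e.eval s ≠ 0) (h : RunT M p s s' t) (h' : RunT M (whl e p) s' s'' t') :
    RunT M (whl e p) s s'' ((e.cost + 1) * unit M V + t + t') := fun s₁ h₁ => by
  obtain ⟨s₂, t₂, e₂, f₂, m₂, v₂, c₂⟩ := Ex.exec_comp M V e 20 s₁ le_rfl h₁ hk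
  obtain ⟨s₃, u, a, b, c⟩ := h s₂ (h₁.of_eq f₂ m₂)
  obtain ⟨s₄, u', a', b', c'⟩ := h' s₃ b
  have h1 := words_mono M (Ex.eval_le_of_ok hk)
  have := three_words_le_unit M V
  unfold whl at a'
  -- Compiled loops evaluate the test once in front and again at the end of each body. The leading
  -- evaluation of the remaining loop is split off and serves as the end of the current body.
  cases a' with
  | seq a₁ a₂ =>
    refine ⟨s₄, _, Exec.seq e₂ (Exec.loop_true (by rwa [v₂]) (Exec.seq a a₁) a₂), b', ?_⟩
    rw [v₂]; nlinarith

/-- A loop whose `i`-th round leads from `Inv i` to `Inv (i + 1)`. -/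
theorem RunT.whl_count {M : Env U} {V : ℕ} {e : Ex} {b : Blk} (n : ℕ) (Inv : ℕ → State → Prop)
    (step : ∀ i < n, ∀ s, Inv i s → e.ok V s ∧ e.eval s ≠ 0 ∧ b.ok M.hv V s ∧
      Inv (i + 1) (b.exec M.hv s))
    (finish : ∀ s, Inv n s → e.ok V s ∧ e.eval s = 0) (s : State) (h : Inv 0 s) :
    ∃ s', RunT M (whl e b.comp) s s' ((n + 1) * ((e.cost + 1 + b.cost) * unit M V)) ∧ Inv n s' := by
  suffices H : ∀ m i, i + m = n → ∀ s, Inv i s → ∃ s', RunT M (whl e b.comp) s s'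
      ((m + 1) * ((e.cost + 1 + b.cost) * unit M V)) ∧ Inv n s' from H n 0 (by omega) s h
  intro m
  induction m with
  | zero =>
    rintro i rfl s hs
    obtain ⟨h1, h2⟩ := finish s hs
    refine ⟨s, (RunT.whl_false h1 h2).mono ?_, hs⟩
    nlinarith [Nat.zero_le (b.cost * unit M V)]
  | succ m ih =>
    intro i hi s hs
    obtain ⟨h1, h2, h3, h4⟩ := step i (by omega) s hs
    obtain ⟨s', r, hs'⟩ := ih (i + 1) (by omega) _ h4
    refine ⟨s', (RunT.whl_true h1 h2 (Blk.run M V b s h3) r).mono ?_, hs'⟩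
    nlinarith

end RAM


/-! ## One round: filling buckets from blocks of `2k` cells -/

namespace Fill

/-- Number of blocks of `2k` cells that are used for `N` keys. -/
def blocks (k N : ℕ) : ℕ := N / (8 * k) + 1

/-- Number of keys in the first `t` cells of block `u`. -/
def pre (k : ℕ) (c : ℕ → ℕ) (A : Finset ℕ) (u t : ℕ) : ℕ :=
  (A.filter fun j => 2 * k * u ≤ c j ∧ c j < 2 * k * u + t).card

/-- The largest `t` such that exactly `k` keys lie in the first `t` cells of block `u`
(`0` if there is none). -/
def thr (k : ℕ) (c : ℕ → ℕ) (A : Finset ℕ) (u : ℕ) : ℕ :=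
  Nat.findGreatest (fun t => pre k c A u t = k) (2 * k)

/-- The keys that are not put into a bucket. -/
def bump (k : ℕ) (c : ℕ → ℕ) (A : Finset ℕ) : Finset ℕ :=
  A.filter fun j => thr k c A (c j / (2 * k)) ≤ c j % (2 * k)

/-- The number of blocks before block `u` that yield a bucket. -/
def fulls (k : ℕ) (c : ℕ → ℕ) (A : Finset ℕ) (u : ℕ) : ℕ :=
  ((Finset.range u).filter fun v => thr k c A v ≠ 0).card

variable {k : ℕ} {c : ℕ → ℕ} {A : Finset ℕ}

theorem thr_le (k : ℕ) (c : ℕ → ℕ) (A : Finset ℕ) (u : ℕ) : thr k c A u ≤ 2 * k :=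
  Nat.findGreatest_le _

theorem pre_thr {u : ℕ} (h : thr k c A u ≠ 0) : pre k c A u (thr k c A u) = k :=
  Nat.findGreatest_of_ne_zero (P := fun t => pre k c A u t = k) rfl h

theorem block_iff (hk : 1 ≤ k) {x u t : ℕ} (ht : t ≤ 2 * k) :
    (2 * k * u ≤ x ∧ x < 2 * k * u + t) ↔ (x / (2 * k) = u ∧ x % (2 * k) < t) := by
  have h := Nat.div_add_mod x (2 * k)
  have hm : x % (2 * k) < 2 * k := Nat.mod_lt _ (by omega)
  constructor
  · rintro ⟨h1, h2⟩
    have hu : x / (2 * k) = u := by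
      apply Nat.div_eq_of_lt_le
      · rw [mul_comm]; exact h1
      · rw [mul_comm, mul_add]; omega
    subst hu
    exact ⟨rfl, by omega⟩
  · rintro ⟨rfl, h2⟩
    omega

theorem card_bucket (hk : 1 ≤ k) {u : ℕ} (h : thr k c A u ≠ 0) :
    (A.filter fun j => c j / (2 * k) = u ∧ c j % (2 * k) < thr k c A u).card = k := by
  have := pre_thr h
  unfold pre at this
  simpa only [block_iff hk (thr_le k c A u)] using this

theorem fulls_succ (u : ℕ) :
    fulls k c A (u + 1) = fulls k c A u + if thr k c A u ≠ 0 then 1 else 0 := by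
  unfold fulls
  rw [Finset.range_add_one, Finset.filter_insert]
  split_ifs
  · rw [Finset.card_insert_of_notMem (by simp)]
  · rfl

theorem fulls_mono : Monotone (fulls k c A) :=
  monotone_nat_of_le_succ fun u => by rw [fulls_succ]; omega

theorem fulls_lt {u v : ℕ} (hu : thr k c A u ≠ 0) (h : u < v) : fulls k c A u < fulls k c A v := by
  have := fulls_mono (k := k) (c := c) (A := A) (show u + 1 ≤ v from h)
  rw [fulls_succ, if_pos hu] at this
  omega

/-- `fulls` grows by at most one per block, so it takes every value below its last one just before a
block that increases it. -/
theorem exists_fulls_eq {m i : ℕ} (h : i < fulls k c A m) :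
    ∃ u < m, thr k c A u ≠ 0 ∧ fulls k c A u = i := by
  induction m with
  | zero => simp [fulls] at h
  | succ m ih =>
    by_cases h' : i < fulls k c A m
    · obtain ⟨u, hu, h1⟩ := ih h'
      exact ⟨u, by omega, h1⟩
    · rw [fulls_succ] at h
      split_ifs at h with ht
      · exact ⟨m, by omega, ht, by omega⟩
      · omega

/-- The keys that are not bumped are fibred over the blocks with nonzero threshold, with k keys in
each fibre. -/
theorem card_bump_add (hk : 1 ≤ k) {m : ℕ} (hc : ∀ j ∈ A, c j < 2 * k * m) :
    (bump k c A).card + k * fulls k c A m = A.card := by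
  have h := Finset.card_filter_add_card_filter_not (s := A)
    (fun j => thr k c A (c j / (2 * k)) ≤ c j % (2 * k))
  have h2 : (A.filter fun j => ¬ thr k c A (c j / (2 * k)) ≤ c j % (2 * k)).card
      = k * fulls k c A m := by
    rw [Finset.card_eq_sum_card_fiberwise (f := fun j => c j / (2 * k))
      (t := (Finset.range m).filter fun v => thr k c A v ≠ 0)]
    · rw [Finset.sum_const_nat (m := k), mul_comm]; rfl
      intro u hu
      refine Eq.trans ?_ (card_bucket hk (Finset.mem_filter.1 hu).2)
      rw [Finset.filter_filter]
      congr 1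
      ext j
      simp only [Finset.mem_filter]
      constructor
      · rintro ⟨a, b, rfl⟩; exact ⟨a, rfl, by omega⟩
      · rintro ⟨a, rfl, b⟩; exact ⟨a, by omega, rfl⟩
    · intro j hj
      simp only [Finset.coe_filter, Set.mem_ofPred_eq, Finset.mem_range] at hj ⊢
      exact ⟨Nat.div_lt_of_lt_mul (hc j hj.1), by omega⟩
  rw [h2] at h
  exact h

end Fill

/-! ## All rounds -/

namespace Rounds

open Fill

/-- Cells of the keys in round `l`, when the keys in `A` are left. -/
def cell (k : ℕ) (h : ℕ → ℕ → ℕ → ℕ) (l : ℕ) (A : Finset ℕ) (j : ℕ) : ℕ :=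
  h j l (2 * k * blocks k A.card - 1)

/-- The keys that are left after `l` rounds. -/
def alive (k : ℕ) (h : ℕ → ℕ → ℕ → ℕ) (n : ℕ) : ℕ → Finset ℕ
  | 0 => Finset.range n
  | l + 1 => if (alive k h n l).card < k then alive k h n l else
      bump k (cell k h l (alive k h n l)) (alive k h n l)

/-- Cells of the keys in round `l`. -/
abbrev pos (k : ℕ) (h : ℕ → ℕ → ℕ → ℕ) (n l : ℕ) : ℕ → ℕ := cell k h l (alive k h n l)

/-- The number of buckets filled before round `l`. -/
def base (k : ℕ) (h : ℕ → ℕ → ℕ → ℕ) (n : ℕ) : ℕ → ℕ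
  | 0 => 0
  | l + 1 => base k h n l + if (alive k h n l).card < k then 0 else
      fulls k (pos k h n l) (alive k h n l) (blocks k (alive k h n l).card)

/-- The bucket given to key `j` if it is put into a bucket in round `l`. -/
def lab (k : ℕ) (h : ℕ → ℕ → ℕ → ℕ) (n l j : ℕ) : ℕ :=
  1 + base k h n l + fulls k (pos k h n l) (alive k h n l) (pos k h n l j / (2 * k))

open Classical in
/-- The resulting bucket of a key. -/
noncomputable def bucket (k : ℕ) (h : ℕ → ℕ → ℕ → ℕ) (n j : ℕ) : ℕ :=
  if H : ∃ l, j ∈ alive k h n l ∧ j ∉ alive k h n (l + 1) then lab k h n (Nat.find H) j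
  else n / k + 1

variable {k n : ℕ} {h : ℕ → ℕ → ℕ → ℕ}

theorem alive_anti : Antitone (alive k h n) := antitone_nat_of_succ_le fun l => by
  rw [alive]
  split_ifs
  · exact le_rfl
  · exact Finset.filter_subset _ _

theorem cell_lt (hk : 1 ≤ k) (hb : ∀ j s m, h j s m ≤ m) (l : ℕ) (A : Finset ℕ) (j : ℕ) :
    cell k h l A j < 2 * k * blocks k A.card := by
  have := hb j l (2 * k * blocks k A.card - 1)
  have h2 : 0 < 2 * k * blocks k A.card := by unfold blocks; positivity
  unfold cell; omega

/-- Conservation of keys: each filled bucket has removed exactly k of them. This determines the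
final number of buckets. -/
theorem card_alive_add (hk : 1 ≤ k) (hb : ∀ j s m, h j s m ≤ m) (l : ℕ) :
    (alive k h n l).card + k * base k h n l = n := by
  induction l with
  | zero => simp [alive, base]
  | succ l ih =>
    simp only [alive, base]
    split_ifs with hc
    · exact ih
    · have := card_bump_add (k := k) (c := pos k h n l) (A := alive k h n l) hk
        (m := blocks k (alive k h n l).card) (fun j _ => cell_lt hk hb _ _ _)
      change (bump k (pos k h n l) (alive k h n l)).card + _ = n
      rw [mul_add]; omega

theorem alive_eq_of_card_lt {l m : ℕ} (hl : (alive k h n l).card < k) (hm : l ≤ m) :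
    alive k h n m = alive k h n l := by
  induction m, hm using Nat.le_induction with
  | base => rfl
  | succ m hm ih => rw [alive, ih, if_pos hl]

theorem base_mono : Monotone (base k h n) := monotone_nat_of_le_succ fun l => by
  rw [base]; omega

/-- What it means that a key is put into a bucket in round `l`. -/
theorem taken_iff {l j : ℕ} : (j ∈ alive k h n l ∧ j ∉ alive k h n (l + 1)) ↔
    k ≤ (alive k h n l).card ∧ j ∈ alive k h n l ∧ pos k h n l j % (2 * k) <
      thr k (pos k h n l) (alive k h n l) (pos k h n l j / (2 * k)) := by
  rw [alive]
  split_ifs with hc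
  · exact ⟨fun h => absurd h.1 h.2, fun h => absurd hc (by omega)⟩
  · simp only [bump, Finset.mem_filter, not_and, not_le]
    exact ⟨fun h => ⟨by omega, h.1, h.2 h.1⟩, fun h => ⟨h.2.1, fun _ => h.2.2⟩⟩

/-- The sets of remaining keys decrease, so a key leaves in one round only. -/
theorem bucket_of_taken {l j : ℕ} (hl : j ∈ alive k h n l ∧ j ∉ alive k h n (l + 1)) :
    bucket k h n j = lab k h n l j := by
  classical
  have H : ∃ l, j ∈ alive k h n l ∧ j ∉ alive k h n (l + 1) := ⟨l, hl⟩
  have hf : Nat.find H = l := by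
    have h1 := Nat.find_spec H
    have h2 := Nat.find_min' H hl
    by_contra hne
    exact h1.2 (alive_anti (show Nat.find H + 1 ≤ l by omega) hl.1)
  rw [bucket, dif_pos H, hf]

theorem bucket_of_alive {T j : ℕ} (hT : (alive k h n T).card < k) (hj : j ∈ alive k h n T) :
    bucket k h n j = n / k + 1 := by
  rw [bucket, dif_neg]
  rintro ⟨l, h1, h2⟩
  rcases le_total T l with hl | hl
  · rw [alive_eq_of_card_lt hT (show T ≤ l + 1 by omega)] at h2
    exact h2 hj
  · have hne : l ≠ T := by
      rintro rfl
      rw [alive_eq_of_card_lt hT (Nat.le_succ _)] at h2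
      exact h2 hj
    exact h2 (alive_anti (show l + 1 ≤ T by omega) hj)

theorem exists_taken {T j : ℕ} (hj : j ∈ Finset.range n) (hT : j ∉ alive k h n T) :
    ∃ l < T, j ∈ alive k h n l ∧ j ∉ alive k h n (l + 1) := by
  induction T with
  | zero => exact absurd hj hT
  | succ T ih =>
    by_cases h' : j ∈ alive k h n T
    · exact ⟨T, by omega, h', hT⟩
    · obtain ⟨l, h1, h2⟩ := ih h'
      exact ⟨l, by omega, h2⟩

/-- Uniqueness of division with remainder, applied to `card_alive_add`. -/
theorem base_eq {T : ℕ} (hk : 1 ≤ k) (hb : ∀ j s m, h j s m ≤ m)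
    (hT : (alive k h n T).card < k) : base k h n T = n / k ∧ (alive k h n T).card = n % k := by
  have h1 := card_alive_add (n := n) hk hb T
  have h2 := Nat.add_mul_div_left (alive k h n T).card (base k h n T) (show 0 < k by omega)
  have h3 := Nat.add_mul_mod_self_left (alive k h n T).card k (base k h n T)
  rw [h1, Nat.div_eq_of_lt hT, zero_add] at h2
  rw [h1, Nat.mod_eq_of_lt hT] at h3
  exact ⟨h2.symm, h3.symm⟩

/-- Different rounds use disjoint intervals of labels, so that a label determines its round. -/
theorem lab_bounds {l j : ℕ} (hk : 1 ≤ k) (hb : ∀ j s m, h j s m ≤ m)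
    (hl : j ∈ alive k h n l ∧ j ∉ alive k h n (l + 1)) :
    base k h n l < lab k h n l j ∧ lab k h n l j ≤ base k h n (l + 1) := by
  obtain ⟨h1, h2, h3⟩ := taken_iff.1 hl
  have := fulls_lt (k := k) (c := pos k h n l) (A := alive k h n l)
    (u := pos k h n l j / (2 * k)) (v := blocks k (alive k h n l).card) (by omega)
    (Nat.div_lt_of_lt_mul (cell_lt hk hb _ _ _))
  rw [base, if_neg (by omega), lab]
  omega

theorem bucket_le {T j : ℕ} (hk : 1 ≤ k) (hb : ∀ j s m, h j s m ≤ m)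
    (hT : (alive k h n T).card < k) (hj : j ∈ Finset.range n) :
    1 ≤ bucket k h n j ∧ (j ∉ alive k h n T → bucket k h n j ≤ n / k) ∧
      (j ∈ alive k h n T → bucket k h n j = n / k + 1) := by
  by_cases hjT : j ∈ alive k h n T
  · have := bucket_of_alive hT hjT
    exact ⟨this ▸ Nat.le_add_left _ _, fun h3 => absurd hjT h3, fun _ => this⟩
  · obtain ⟨l, hl, ht⟩ := exists_taken hj hjT
    have h1 := lab_bounds hk hb ht
    have h2 := base_mono (k := k) (h := h) (n := n) (show l + 1 ≤ T by omega)
    rw [(base_eq hk hb hT).1] at h2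
    rw [bucket_of_taken ht]
    exact ⟨by omega, fun _ => by omega, fun h' => absurd h' hjT⟩

theorem card_last {T : ℕ} (hk : 1 ≤ k) (hb : ∀ j s m, h j s m ≤ m)
    (hT : (alive k h n T).card < k) :
    ((Finset.range n).filter fun j => bucket k h n j = n / k + 1).card = n % k := by
  rw [← (base_eq hk hb hT).2]
  congr 1
  ext j
  simp only [Finset.mem_filter]
  constructor
  · rintro ⟨h1, h2⟩
    by_contra h3
    have := (bucket_le hk hb hT h1).2.1 h3
    omega
  · intro h1
    exact ⟨alive_anti (Nat.zero_le T) h1, bucket_of_alive hT h1⟩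

/-- The label determines the round by `lab_bounds`, and within the round the block, because `fulls`
is injective on the blocks that yield a bucket. Hence the bucket is the set counted by
`card_bucket`. -/
theorem card_full {T i : ℕ} (hk : 1 ≤ k) (hb : ∀ j s m, h j s m ≤ m)
    (hT : (alive k h n T).card < k) (hi : 1 ≤ i) (hi' : i ≤ n / k) :
    ((Finset.range n).filter fun j => bucket k h n j = i).card = k := by
  obtain ⟨l, hl1, hl2⟩ : ∃ l, base k h n l < i ∧ i ≤ base k h n (l + 1) := by
    have hex : ∃ l, i ≤ base k h n l := ⟨T, by rw [(base_eq hk hb hT).1]; exact hi'⟩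
    classical
    have h1 := Nat.find_spec hex
    have h0 : Nat.find hex ≠ 0 := by
      intro h0
      rw [h0] at h1
      simp only [base] at h1
      omega
    obtain ⟨l, hl⟩ := Nat.exists_eq_succ_of_ne_zero h0
    have h2 := Nat.find_min hex (m := l) (by omega)
    rw [hl] at h1
    exact ⟨l, by omega, h1⟩
  have hact : ¬ (alive k h n l).card < k := by
    intro hc
    rw [base, if_pos hc] at hl2
    omega
  rw [base, if_neg hact] at hl2
  obtain ⟨u, hu, ht, hf⟩ := exists_fulls_eq (i := i - 1 - base k h n l)
    (k := k) (c := pos k h n l) (A := alive k h n l) (m := blocks k (alive k h n l).card) (by omega)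
  refine Eq.trans ?_ (card_bucket (c := pos k h n l) (A := alive k h n l) hk ht)
  congr 1
  ext j
  simp only [Finset.mem_filter]
  constructor
  · rintro ⟨hj, hji⟩
    have hjT : j ∉ alive k h n T := by
      intro h'
      have := (bucket_le hk hb hT hj).2.2 h'
      omega
    obtain ⟨l', hl', htk⟩ := exists_taken hj hjT
    rw [bucket_of_taken htk] at hji
    have hbd := lab_bounds hk hb htk
    have hll : l' = l := by
      rcases lt_trichotomy l' l with hlt | heq | hlt
      · have := base_mono (k := k) (h := h) (n := n) (show l' + 1 ≤ l by omega)
        omega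
      · exact heq
      · have := base_mono (k := k) (h := h) (n := n) (show l + 1 ≤ l' by omega)
        rw [base, if_neg hact] at this
        omega
    subst hll
    obtain ⟨_, h2, h3⟩ := taken_iff.1 htk
    have hlab : fulls k (pos k h n l') (alive k h n l') (pos k h n l' j / (2 * k))
        = fulls k (pos k h n l') (alive k h n l') u := by
      rw [hf]; unfold lab at hji; omega
    have hu' : pos k h n l' j / (2 * k) = u := by
      rcases lt_trichotomy (pos k h n l' j / (2 * k)) u with hlt | heq | hlt
      · have := fulls_lt (k := k) (c := pos k h n l') (A := alive k h n l')
          (u := pos k h n l' j / (2 * k)) (v := u) (by omega) hlt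
        omega
      · exact heq
      · have := fulls_lt (k := k) (c := pos k h n l') (A := alive k h n l') ht hlt
        omega
    exact ⟨h2, hu', by rw [← hu']; exact h3⟩
  · rintro ⟨h1, h2, h3⟩
    have htk := taken_iff.2 ⟨by omega, h1, by rw [h2]; exact h3⟩
    refine ⟨alive_anti (Nat.zero_le l) h1, ?_⟩
    rw [bucket_of_taken htk, lab, h2, hf]
    omega

end Rounds


/-! ## Counting: a key is put into a bucket with constant probability -/

namespace Count

/-- The difference of the powers is a sum of k products of k - 1 factors, each factor lying between
`x` and `x + 1`; `le_sub_pow` bounds the same sum from below. -/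
theorem sub_pow_le (x : ℝ) (hx : 0 ≤ x) (k : ℕ) : (x + 1) ^ k - x ^ k ≤ k * (x + 1) ^ (k - 1) := by
  have h := geom_sum₂_mul (x + 1) x k
  rw [add_sub_cancel_left, mul_one] at h
  rw [← h, ← nsmul_eq_mul]
  conv_rhs => rw [← Finset.card_range k]
  refine Finset.sum_le_card_nsmul _ _ _ fun i hi => ?_
  have : i + (k - 1 - i) = k - 1 := by have := Finset.mem_range.1 hi; omega
  calc (x + 1) ^ i * x ^ (k - 1 - i) ≤ (x + 1) ^ i * (x + 1) ^ (k - 1 - i) := by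
        gcongr; linarith
    _ = _ := by rw [← pow_add, this, Finset.card_range]

theorem le_sub_pow (x : ℝ) (hx : 0 ≤ x) (k : ℕ) : k * x ^ (k - 1) ≤ (x + 1) ^ k - x ^ k := by
  have h := geom_sum₂_mul (x + 1) x k
  rw [add_sub_cancel_left, mul_one] at h
  rw [← h, ← nsmul_eq_mul]
  conv_lhs => rw [← Finset.card_range k]
  refine Finset.card_nsmul_le_sum _ _ _ fun i hi => ?_
  have : i + (k - 1 - i) = k - 1 := by have := Finset.mem_range.1 hi; omega
  calc x ^ ((Finset.range k).card - 1) = x ^ i * x ^ (k - 1 - i) := by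
        rw [← pow_add, this, Finset.card_range]
    _ ≤ _ := by gcongr; linarith

theorem one_add_inv_pow_le (a : ℝ) (ha : 0 < a) (j : ℕ) (c : ℝ) (hj : j ≤ c * a) :
    (a + 1) ^ j ≤ Real.exp c * a ^ j := by
  have h1 : (a + 1) = a * (1 / a + 1) := by field_simp; ring
  rw [h1, mul_pow, mul_comm]
  gcongr
  calc (1 / a + 1) ^ j ≤ (Real.exp (1 / a)) ^ j := by
        gcongr; exact Real.add_one_le_exp _
    _ = Real.exp (j * (1 / a)) := by rw [← Real.exp_nat_mul]
    _ ≤ _ := by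
        apply Real.exp_le_exp.2
        rw [mul_one_div, div_le_iff₀ ha]; exact hj

/-- Number of ways in which `k` keys can hit the first `t + 1` cells, with one in cell `t`, while
the `j` others avoid the first `t + 1` of the `M` cells. -/
noncomputable def hit (k j M : ℕ) (t : ℕ) : ℝ :=
  (((t : ℝ) + 1) ^ k - (t : ℝ) ^ k) * ((M : ℝ) - (t + 1)) ^ j

/-- The same with the `j` others avoiding the first `t` cells. -/
noncomputable def cross (k j M : ℕ) (t : ℕ) : ℝ :=
  (((t : ℝ) + 1) ^ k - (t : ℝ) ^ k) * ((M : ℝ) - t) ^ j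

theorem hit_nonneg {k j M t : ℕ} (ht : t + 1 ≤ M) : 0 ≤ hit k j M t := by
  have h1 : ((t : ℝ) + 1) ≤ M := by exact_mod_cast ht
  refine mul_nonneg (sub_nonneg.2 (by gcongr; linarith)) (pow_nonneg (by linarith) _)

/-- Skipping the count k is not much likelier than meeting it. For t < k, `cross` and `hit` at t
differ only in one cell that the j others avoid. For t ≥ k, `cross` at t is compared with `hit` at t
- 1: the others avoid the same cells, and the first factors have bounded ratio. The second way fails
for small t, where that ratio is unbounded in k. -/
theorem sum_cross_le {k j m : ℕ} (hk : 1 ≤ k) (hm : 1 ≤ m) (hj : j ≤ 8 * k * m) :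
    ∑ t ∈ Finset.range (2 * k), cross k j (2 * k * m) t ≤
      (Real.exp 8 + Real.exp 2) * ∑ t ∈ Finset.range (2 * k), hit k j (2 * k * m) t := by
  have hkm : k ≤ k * m := Nat.le_mul_of_pos_right _ hm
  have hk' : (1 : ℝ) ≤ k := by exact_mod_cast hk
  have hkmR : (k : ℝ) ≤ k * m := by exact_mod_cast hkm
  have hMR : ((2 * k * m : ℕ) : ℝ) = 2 * (k * m) := by push_cast; ring
  have hjR : (j : ℝ) ≤ 8 * (k * m) := by
    have : (j : ℝ) ≤ ((8 * k * m : ℕ) : ℝ) := by exact_mod_cast hj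
    push_cast at this; linarith
  have hnn : ∀ t < 2 * k, 0 ≤ hit k j (2 * k * m) t := fun t ht => hit_nonneg (by
    have : 2 * k * m = 2 * (k * m) := by ring
    omega)
  have key : ∀ t ∈ Finset.range (2 * k), cross k j (2 * k * m) t ≤
      Real.exp 8 * hit k j (2 * k * m) t +
        Real.exp 2 * (if t = 0 then 0 else hit k j (2 * k * m) (t - 1)) := by
    intro t ht
    rw [Finset.mem_range] at ht
    have hprev : 0 ≤ Real.exp 2 * (if t = 0 then 0 else hit k j (2 * k * m) (t - 1)) := by
      split_ifs
      · simp
      · exact mul_nonneg (Real.exp_pos _).le (hnn _ (by omega))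
    have ht0 : (0 : ℝ) ≤ t := Nat.cast_nonneg t
    by_cases htk : t < k
    · have h1 : (t : ℝ) + 1 ≤ k := by exact_mod_cast htk
      have ha : (0 : ℝ) < ((2 * k * m : ℕ) : ℝ) - (t + 1) := by rw [hMR]; linarith
      -- Here M - (t + 1) ≥ 2km - k ≥ km and j ≤ 8km, whence the exponent 8.
      have := one_add_inv_pow_le _ ha j 8 (by rw [hMR]; linarith)
      rw [show ((2 * k * m : ℕ) : ℝ) - (t + 1) + 1 = ((2 * k * m : ℕ) : ℝ) - t by ring] at this
      have hA : (0 : ℝ) ≤ ((t : ℝ) + 1) ^ k - (t : ℝ) ^ k :=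
        sub_nonneg.2 (by gcongr; linarith)
      have h2 : cross k j (2 * k * m) t ≤ Real.exp 8 * hit k j (2 * k * m) t := by
        unfold cross hit
        calc _ ≤ (((t : ℝ) + 1) ^ k - (t : ℝ) ^ k) * (Real.exp 8 *
              (((2 * k * m : ℕ) : ℝ) - (t + 1)) ^ j) := by gcongr
          _ = _ := by ring
      linarith
    · push Not at htk
      obtain ⟨s, rfl⟩ : ∃ s, t = s + 1 := ⟨t - 1, by omega⟩
      have h0 := mul_nonneg (Real.exp_pos 8).le (hnn (s + 1) (by omega))
      rw [if_neg (by omega), Nat.add_sub_cancel]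
      suffices h : cross k j (2 * k * m) (s + 1) ≤ Real.exp 2 * hit k j (2 * k * m) s by linarith
      have hs0 : (0 : ℝ) ≤ s := Nat.cast_nonneg s
      have hA : (((s + 1 : ℕ) : ℝ) + 1) ^ k - ((s + 1 : ℕ) : ℝ) ^ k ≤
          Real.exp 2 * (((s : ℝ) + 1) ^ k - (s : ℝ) ^ k) := by
        have h1 := sub_pow_le ((s + 1 : ℕ) : ℝ) (Nat.cast_nonneg _) k
        have h2 := le_sub_pow (s : ℝ) hs0 k
        have h3 : (((s + 1 : ℕ) : ℝ) + 1) ^ (k - 1) ≤ Real.exp 2 * (s : ℝ) ^ (k - 1) := by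
          rcases Nat.eq_zero_or_pos (k - 1) with hk1 | hk1
          · rw [hk1]; simp
          · have hs : (0 : ℝ) < s := by
              have : 0 < s := by omega
              exact_mod_cast this
            have hks : ((k - 1 : ℕ) : ℝ) ≤ s := by
              have : k - 1 ≤ s := by omega
              exact_mod_cast this
            -- The ratio to be bounded is ((s + 2) / s) ^ (k - 1), with s = t - 1 ≥ k - 1; halving
            -- numerator and denominator brings it into the form of the lemma.
            have h4 := one_add_inv_pow_le ((s : ℝ) / 2) (by positivity) (k - 1) 2 (by linarith)
            have h5 : (((s + 1 : ℕ) : ℝ) + 1) = 2 * ((s : ℝ) / 2 + 1) := by push_cast; ring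
            have h6 : (s : ℝ) = 2 * (s / 2) := by ring
            rw [h5, mul_pow]
            conv_rhs => rw [h6, mul_pow]
            calc _ ≤ 2 ^ (k - 1) * (Real.exp 2 * ((s : ℝ) / 2) ^ (k - 1)) := by gcongr
              _ = _ := by ring
        calc _ ≤ k * (Real.exp 2 * (s : ℝ) ^ (k - 1)) := h1.trans (by gcongr)
          _ = Real.exp 2 * (k * (s : ℝ) ^ (k - 1)) := by ring
          _ ≤ _ := by gcongr
      unfold cross hit
      rw [← mul_assoc]
      have hsk : (s : ℝ) + 1 ≤ 2 * k := by
        have : s + 1 ≤ 2 * k := by omega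
        exact_mod_cast this
      have hc : ((s + 1 : ℕ) : ℝ) = s + 1 := by push_cast; ring
      rw [hc] at hA ⊢
      refine mul_le_mul_of_nonneg_right hA (pow_nonneg ?_ _)
      rw [hMR]; linarith
  refine (Finset.sum_le_sum key).trans ?_
  rw [Finset.sum_add_distrib, ← Finset.mul_sum, ← Finset.mul_sum, add_mul]
  refine add_le_add le_rfl (mul_le_mul_of_nonneg_left ?_ (Real.exp_pos _).le)
  -- The shifted sum lacks only the last term of Σ `hit`, which is nonnegative.
  obtain ⟨r, hr⟩ : ∃ r, 2 * k = r + 1 := ⟨2 * k - 1, by omega⟩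
  have hlast : 0 ≤ hit k j (2 * k * m) r := hnn r (by omega)
  rw [hr, Finset.sum_range_succ', Finset.sum_range_succ]
  rw [hr] at hlast
  simpa using hlast

/-! ### Counting placements by the k-set in an initial segment -/

variable {ι : Type*} [Fintype ι] [DecidableEq ι]

/-- The first `t` cells of block `u`. -/
def first (k M u t : ℕ) : Finset (Fin M) :=
  Finset.univ.filter fun c => 2 * k * u ≤ c.val ∧ c.val < 2 * k * u + t

theorem mem_first {k M u t : ℕ} {c : Fin M} :
    c ∈ first k M u t ↔ 2 * k * u ≤ c.val ∧ c.val < 2 * k * u + t := by simp [first]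

theorem first_mono {k M u s t : ℕ} (h : s ≤ t) : first k M u s ⊆ first k M u t := fun c hc => by
  rw [mem_first] at hc ⊢; omega

theorem card_first {k M u t : ℕ} (h : 2 * k * u + t ≤ M) : (first k M u t).card = t := by
  have : (first k M u t).map Fin.valEmbedding = Finset.Ico (2 * k * u) (2 * k * u + t) := by
    ext x
    simp only [Finset.mem_map, mem_first, Fin.valEmbedding_apply, Finset.mem_Ico]
    exact ⟨fun ⟨c, hc, e⟩ => e ▸ hc, fun hx => ⟨⟨x, by omega⟩, hx, rfl⟩⟩
  rw [← Finset.card_map Fin.valEmbedding, this, Nat.card_Ico]; omega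

/-- The functions that map `K` to `P` and the complement of `K` to `Q`. -/
def split {M : ℕ} (K : Finset ι) (P Q : Finset (Fin M)) : Finset (ι → Fin M) :=
  Fintype.piFinset fun i => if i ∈ K then P else Q

theorem mem_split {M : ℕ} {K : Finset ι} {P Q : Finset (Fin M)} {f : ι → Fin M} :
    f ∈ split K P Q ↔ (∀ i ∈ K, f i ∈ P) ∧ ∀ i, i ∉ K → f i ∈ Q := by
  rw [split, Fintype.mem_piFinset]
  refine ⟨fun h => ⟨fun i hi => by simpa [hi] using h i, fun i hi => by simpa [hi] using h i⟩,
    fun h i => ?_⟩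
  by_cases hi : i ∈ K
  · simpa [hi] using h.1 i hi
  · simpa [hi] using h.2 i hi

theorem card_split {M : ℕ} (K : Finset ι) (P Q : Finset (Fin M)) :
    (split K P Q).card = P.card ^ K.card * Q.card ^ (Fintype.card ι - K.card) := by
  rw [split, Fintype.card_piFinset]
  simp only [apply_ite Finset.card]
  rw [Finset.prod_ite, Finset.prod_const, Finset.prod_const]
  congr 2
  · simp
  · rw [← Finset.card_compl]; congr 1; ext; simp

/-- The functions that map `K` into the first `t + 1` cells of block `u`, not all of `K` into the
first `t`, and the complement of `K` outside of the first `s` cells. -/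
def slab (k M u t s : ℕ) (K : Finset ι) : Finset (ι → Fin M) :=
  split K (first k M u (t + 1)) (first k M u s)ᶜ \ split K (first k M u t) (first k M u s)ᶜ

theorem card_slab {k M u t s : ℕ} (h : 2 * k * u + t + 1 ≤ M) (hs : 2 * k * u + s ≤ M)
    (K : Finset ι) : ((slab k M u t s K).card : ℝ) =
      (((t : ℝ) + 1) ^ K.card - (t : ℝ) ^ K.card) * ((M : ℝ) - s) ^ (Fintype.card ι - K.card) := by
  have hsub : split K (first k M u t) (first k M u s)ᶜ ⊆
      split K (first k M u (t + 1)) (first k M u s)ᶜ := fun f hf => by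
    rw [mem_split] at hf ⊢
    exact ⟨fun i hi => first_mono (Nat.le_succ t) (hf.1 i hi), hf.2⟩
  rw [slab, Finset.card_sdiff_of_subset hsub, Nat.cast_sub (Finset.card_le_card hsub),
    card_split, card_split, Finset.card_compl, card_first (by omega), card_first (by omega),
    card_first (by omega), Fintype.card_fin]
  push_cast [Nat.cast_sub (show s ≤ M by omega)]
  ring

theorem mem_slab {k M u t s : ℕ} {K : Finset ι} {f : ι → Fin M} : f ∈ slab k M u t s K ↔
    (∀ i ∈ K, f i ∈ first k M u (t + 1)) ∧ (∀ i, i ∉ K → f i ∉ first k M u s) ∧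
      ∃ i ∈ K, f i ∉ first k M u t := by
  rw [slab, Finset.mem_sdiff, mem_split, mem_split]
  simp only [Finset.mem_compl]
  constructor
  · rintro ⟨⟨h1, h2⟩, h3⟩
    refine ⟨h1, h2, ?_⟩
    by_contra! h4
    exact h3 ⟨h4, h2⟩
  · rintro ⟨h1, h2, i, hi, h3⟩
    exact ⟨⟨h1, h2⟩, fun h4 => h3 (h4.1 i hi)⟩

/-- Some initial segment of block `u` receives exactly `k` keys, among them `x`. -/
def Taken (k M m : ℕ) (x : ι) (f : ι → Fin M) : Prop :=
  ∃ u < m, ∃ t, t ≤ 2 * k ∧ (Finset.univ.filter fun i => f i ∈ first k M u t).card = k ∧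
    f x ∈ first k M u t

/-- For s = t + 1 the placement determines `K`. This and `slab_le` make the slabs counted by `hit`
disjoint. -/
theorem slab_filter {k M u t : ℕ} {K : Finset ι} {f : ι → Fin M}
    (h : f ∈ slab k M u t (t + 1) K) : (Finset.univ.filter fun i => f i ∈ first k M u (t + 1)) = K := by
  obtain ⟨h1, h2, -⟩ := mem_slab.1 h
  ext i
  simp only [Finset.mem_filter, Finset.mem_univ, true_and]
  exact ⟨fun hi => by_contra fun hK => h2 i hK hi, h1 i⟩

/-- If t < t', then K ⊆ K', so the two sets agree by cardinality; but then no key of K' lies in cell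
t', although one has to. -/
theorem slab_le {k M u t t' : ℕ} {K K' : Finset ι} {f : ι → Fin M} (hK : K.card = K'.card)
    (h : f ∈ slab k M u t (t + 1) K) (h' : f ∈ slab k M u t' (t' + 1) K') : t' ≤ t := by
  by_contra! hlt
  have e := slab_filter h
  have e' := slab_filter h'
  have hsub : K ⊆ K' := by
    rw [← e, ← e']
    intro i hi
    simp only [Finset.mem_filter, Finset.mem_univ, true_and] at hi ⊢
    exact first_mono (by omega) hi
  have hKK := Finset.eq_of_subset_of_card_le hsub hK.ge
  subst hKK
  obtain ⟨i, hi, hn⟩ := (mem_slab.1 h').2.2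
  exact hn (first_mono (by omega) ((mem_slab.1 h).1 i hi))

theorem block_unique {k M u u' s t : ℕ} {c : Fin M} (hs : s ≤ 2 * k) (ht : t ≤ 2 * k)
    (h : c ∈ first k M u s) (h' : c ∈ first k M u' t) : u = u' := by
  rw [mem_first] at h h'
  by_contra hne
  rcases Nat.lt_or_gt_of_ne hne with hl | hl
  · have : 2 * k * (u + 1) ≤ 2 * k * u' := Nat.mul_le_mul_left _ hl
    rw [mul_add] at this; omega
  · have : 2 * k * (u' + 1) ≤ 2 * k * u := Nat.mul_le_mul_left _ hl
    rw [mul_add] at this; omega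

theorem end_le {k m u t : ℕ} (hu : u < m) (ht : t ≤ 2 * k) : 2 * k * u + t ≤ 2 * k * m := by
  have : 2 * k * (u + 1) ≤ 2 * k * m := Nat.mul_le_mul_left _ hu
  rw [mul_add] at this; omega

-- Each slab with x ∈ K consists of placements in which x is taken. The slabs are disjoint: x
-- determines the block u, and the placement then determines t and K. There are C(N - 1, k - 1) sets
-- K containing x.
open Classical in
theorem le_card_taken {k m : ℕ} (hk : 1 ≤ k) (x : ι) :
    (m : ℝ) * (Fintype.card ι - 1).choose (k - 1) *
      ∑ t ∈ Finset.range (2 * k), hit k (Fintype.card ι - k) (2 * k * m) t ≤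
    ((Finset.univ.filter fun f : ι → Fin (2 * k * m) => Taken k (2 * k * m) m x f).card : ℝ) := by
  set M := 2 * k * m with hM
  set Ks := (Finset.univ.powersetCard k : Finset (Finset ι)).filter fun K => x ∈ K with hKs
  have hKcard : Ks.card = (Fintype.card ι - 1).choose (k - 1) := by
    have h1 : Ks = ((Finset.univ.erase x).powersetCard (k - 1)).image (insert x) := by
      ext K
      simp only [hKs, Finset.mem_filter, Finset.mem_powersetCard, Finset.subset_univ, true_and,
        Finset.mem_image]
      constructor
      · rintro ⟨h2, h3⟩
        exact ⟨K.erase x, ⟨Finset.erase_subset_erase _ (Finset.subset_univ _),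
          by rw [Finset.card_erase_of_mem h3, h2]⟩, Finset.insert_erase h3⟩
      · rintro ⟨L, ⟨h2, h3⟩, rfl⟩
        have : x ∉ L := fun h => by simpa using h2 h
        exact ⟨by rw [Finset.card_insert_of_notMem this, h3]; omega, Finset.mem_insert_self _ _⟩
    rw [h1, Finset.card_image_of_injOn, Finset.card_powersetCard, Finset.card_erase_of_mem
      (Finset.mem_univ x), Finset.card_univ]
    intro L hL L' hL' he
    have h2 : ∀ L ∈ ((Finset.univ.erase x).powersetCard (k - 1) : Finset (Finset ι)), x ∉ L :=
      fun L hL h => by simpa using (Finset.mem_powersetCard.1 hL).1 h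
    rw [← Finset.erase_insert (h2 L hL), he, Finset.erase_insert (h2 L' hL')]
  set I := (Finset.range m ×ˢ Ks) ×ˢ Finset.range (2 * k) with hI
  have hcard : ((I.biUnion fun p => slab k M p.1.1 p.2 (p.2 + 1) p.1.2).card : ℝ) =
      (m : ℝ) * (Fintype.card ι - 1).choose (k - 1) *
      ∑ t ∈ Finset.range (2 * k), hit k (Fintype.card ι - k) M t := by
    rw [Finset.card_biUnion]
    · push_cast
      rw [hI, Finset.sum_product]
      have : ∀ a ∈ Finset.range m ×ˢ Ks, ∑ t ∈ Finset.range (2 * k),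
          ((slab k M a.1 t (t + 1) a.2).card : ℝ) =
          ∑ t ∈ Finset.range (2 * k), hit k (Fintype.card ι - k) M t := by
        intro a ha
        refine Finset.sum_congr rfl fun t ht => ?_
        simp only [Finset.mem_product, Finset.mem_range, hKs, Finset.mem_filter,
          Finset.mem_powersetCard] at ha ht
        have := end_le (k := k) (t := t + 1) ha.1 ht
        rw [card_slab (by omega) (by omega), ha.2.1.2, hit]
        push_cast; ring
      rw [Finset.sum_congr rfl this, Finset.sum_const, Finset.card_product, Finset.card_range,
        hKcard, nsmul_eq_mul]
      push_cast; ring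
    · rintro ⟨⟨u, K⟩, t⟩ hp ⟨⟨u', K'⟩, t'⟩ hp' hne
      rw [Function.onFun, Finset.disjoint_left]
      intro f hf hf'
      simp only [hI, Finset.mem_product, Finset.mem_range, hKs, Finset.mem_filter,
        Finset.mem_powersetCard, Finset.coe_product, Set.mem_prod, Finset.mem_coe] at hp hp' hf hf'
      have hu : u = u' := block_unique (s := t + 1) (t := t' + 1) (by omega) (by omega)
        ((mem_slab.1 hf).1 x hp.1.2.2) ((mem_slab.1 hf').1 x hp'.1.2.2)
      subst hu
      have hKK : K.card = K'.card := by rw [hp.1.2.1.2, hp'.1.2.1.2]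
      have ht : t = t' := le_antisymm (slab_le hKK.symm hf' hf) (slab_le hKK hf hf')
      subst ht
      exact hne (by rw [← slab_filter hf, ← slab_filter hf'])
  rw [← hcard]
  norm_cast
  refine Finset.card_le_card fun f hf => ?_
  obtain ⟨⟨⟨u, K⟩, t⟩, hp, hf⟩ := Finset.mem_biUnion.1 hf
  simp only [hI, Finset.mem_product, Finset.mem_range, hKs, Finset.mem_filter,
    Finset.mem_powersetCard] at hp hf
  rw [Finset.mem_filter]
  exact ⟨Finset.mem_univ _, u, hp.1.1, t + 1, by omega, by rw [slab_filter hf]; exact hp.1.2.1.2,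
    (mem_slab.1 hf).1 x hp.1.2.2⟩

/-- Consider the cell t at which the prefix count first reaches k, and choose a k-set K between the
keys before that cell and the keys up to it. The keys outside K avoid the first t cells, and some
key of K lies in cell t. K need not be unique, so this is a union bound. -/
theorem card_cross_le {k m : ℕ} (hk : 1 ≤ k) (hm : 1 ≤ m) :
    ((Finset.univ.filter fun f : ι → Fin (2 * k * m) =>
      k ≤ (Finset.univ.filter fun i => f i ∈ first k (2 * k * m) 0 (2 * k)).card).card : ℝ) ≤
    (Fintype.card ι).choose k *
      ∑ t ∈ Finset.range (2 * k), cross k (Fintype.card ι - k) (2 * k * m) t := by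
  set M := 2 * k * m with hM
  set I := (Finset.univ.powersetCard k : Finset (Finset ι)) ×ˢ Finset.range (2 * k) with hI
  have hsub : (Finset.univ.filter fun f : ι → Fin M =>
      k ≤ (Finset.univ.filter fun i => f i ∈ first k M 0 (2 * k)).card) ⊆
      I.biUnion fun p => slab k M 0 p.2 p.2 p.1 := by
    intro f hf
    have hf : k ≤ (Finset.univ.filter fun i => f i ∈ first k M 0 (2 * k)).card :=
      (Finset.mem_filter.1 hf).2
    have hex : ∃ t, k ≤ (Finset.univ.filter fun i => f i ∈ first k M 0 t).card := ⟨_, hf⟩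
    have h1 := Nat.find_spec hex
    have h2 := Nat.find_min' hex hf
    have h0 : Nat.find hex ≠ 0 := fun h0 => by
      rw [h0] at h1
      have : (Finset.univ.filter fun i => f i ∈ first k M 0 0) = ∅ := by
        ext i; simp [mem_first]
      rw [this, Finset.card_empty] at h1; omega
    obtain ⟨t, ht⟩ := Nat.exists_eq_succ_of_ne_zero h0
    have h3 := Nat.find_min hex (m := t) (by omega)
    rw [ht] at h1 h2
    push Not at h3
    obtain ⟨K, hK1, hK2, hK3⟩ := Finset.exists_subsuperset_card_eq
      (s := Finset.univ.filter fun i => f i ∈ first k M 0 t)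
      (t := Finset.univ.filter fun i => f i ∈ first k M 0 (t + 1)) (n := k)
      (fun i hi => by
        simp only [Finset.mem_filter, Finset.mem_univ, true_and] at hi ⊢
        exact first_mono (Nat.le_succ t) hi) h3.le h1
    rw [Finset.mem_biUnion]
    refine ⟨(K, t), by simp [hI, hK3]; omega, mem_slab.2 ⟨fun i hi => ?_, fun i hi hf' => ?_, ?_⟩⟩
    · exact (Finset.mem_filter.1 (hK2 hi)).2
    · exact hi (hK1 (Finset.mem_filter.2 ⟨Finset.mem_univ _, hf'⟩))
    · by_contra! hall
      have : K ⊆ Finset.univ.filter fun i => f i ∈ first k M 0 t := fun i hi =>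
        Finset.mem_filter.2 ⟨Finset.mem_univ _, hall i hi⟩
      have := Finset.card_le_card this
      omega
  have h1 := (Finset.card_le_card hsub).trans Finset.card_biUnion_le
  have h2 : ((Finset.univ.filter fun f : ι → Fin M =>
      k ≤ (Finset.univ.filter fun i => f i ∈ first k M 0 (2 * k)).card).card : ℝ) ≤
      ∑ p ∈ I, ((slab k M 0 p.2 p.2 p.1).card : ℝ) := by exact_mod_cast h1
  refine h2.trans (le_of_eq ?_)
  rw [hI, Finset.sum_product]
  have h3 : ∀ K ∈ (Finset.univ.powersetCard k : Finset (Finset ι)),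
      ∑ t ∈ Finset.range (2 * k), ((slab k M 0 t t K).card : ℝ) =
      ∑ t ∈ Finset.range (2 * k), cross k (Fintype.card ι - k) M t := by
    intro K hK
    refine Finset.sum_congr rfl fun t ht => ?_
    have := end_le (k := k) (m := m) (u := 0) (t := t + 1) hm (by
      have := Finset.mem_range.1 ht; omega)
    rw [card_slab (by omega) (by omega), (Finset.mem_powersetCard.1 hK).2, cross]
  rw [Finset.sum_congr rfl h3, Finset.sum_const, Finset.card_powersetCard, Finset.card_univ,
    nsmul_eq_mul]

/-- If there is one block, it contains all N ≥ k keys. Otherwise its expected load is at least 4k,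
and an exponential moment bounds the probability of a load below k. -/
theorem half_le_card_cross {k : ℕ} (hk : 1 ≤ k) (hN : k ≤ Fintype.card ι) {m : ℕ}
    (hm : m = Fill.blocks k (Fintype.card ι)) :
    ((2 * k * m : ℕ) : ℝ) ^ Fintype.card ι / 2 ≤
    ((Finset.univ.filter fun f : ι → Fin (2 * k * m) =>
      k ≤ (Finset.univ.filter fun i => f i ∈ first k (2 * k * m) 0 (2 * k)).card).card : ℝ) := by
  set N := Fintype.card ι with hNdef
  set M := 2 * k * m with hM
  set p : (ι → Fin M) → Prop := fun f =>
    k ≤ (Finset.univ.filter fun i => f i ∈ first k M 0 (2 * k)).card with hp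
  have htot := Finset.card_filter_add_card_filter_not (s := (Finset.univ : Finset (ι → Fin M))) p
  rw [Finset.card_univ, Fintype.card_fun, Fintype.card_fin, ← hNdef] at htot
  have htot' : ((Finset.univ.filter p).card : ℝ) + ((Finset.univ.filter fun f => ¬ p f).card : ℝ)
      = (M : ℝ) ^ N := by exact_mod_cast htot
  suffices h : ((Finset.univ.filter fun f => ¬ p f).card : ℝ) ≤ (M : ℝ) ^ N / 2 by linarith
  have hMpos : (0 : ℝ) < (M : ℝ) ^ N := by
    have : 0 < M := by rw [hM, hm, Fill.blocks]; positivity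
    positivity
  by_cases hm1 : m = 1
  · have hz : (Finset.univ.filter fun f => ¬ p f) = ∅ := by
      ext f
      simp only [Finset.mem_filter, Finset.mem_univ, true_and, Finset.notMem_empty, iff_false,
        not_not, hp]
      have : (Finset.univ.filter fun i => f i ∈ first k M 0 (2 * k)) = Finset.univ := by
        ext i
        have := (f i).2
        simp only [Finset.mem_filter, Finset.mem_univ, true_and, mem_first, iff_true]
        rw [hm1] at hM
        omega
      rw [this, Finset.card_univ]; exact hN
    rw [hz]; simp; positivity
  -- With q = ⌊N/(8k)⌋ ≥ 1 one has m = q + 1 ≤ 2q and 8kq ≤ N.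
  · have hNm : 4 * k * m ≤ N := by
      have h1 : 1 ≤ N / (8 * k) := by
        unfold Fill.blocks at hm
        revert hm
        generalize N / (8 * k) = q
        omega
      have h2 : N / (8 * k) * (8 * k) ≤ N := Nat.div_mul_le_self _ _
      unfold Fill.blocks at hm
      rw [hm]
      nlinarith
    -- The product of φ over the keys is 2 ^ (-X), where X is the load of block 0. If X < k, then 2
    -- ^ k times this product is at least 1, and the sum of the products over all placements factors
    -- into (Σ φ) ^ N = (M - k) ^ N.
    set φ : Fin M → ℝ := fun c => if c ∈ first k M 0 (2 * k) then 1 / 2 else 1 with hφ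
    have hm0 : 1 ≤ m := hm ▸ Nat.le_add_left _ _
    have hsumφ : ∑ c, φ c = M - k := by
      have h1 : (first k M 0 (2 * k)).card = 2 * k := card_first (end_le hm0 le_rfl)
      have h2 : ∀ c, φ c = 1 - (if c ∈ first k M 0 (2 * k) then 1 / 2 else 0) := fun c => by
        simp only [hφ]; split_ifs <;> norm_num
      simp only [h2]
      rw [Finset.sum_sub_distrib, ← Finset.sum_filter]
      simp [h1]
      ring
    have h1 : ((Finset.univ.filter fun f => ¬ p f).card : ℝ) ≤ 2 ^ k * ((M : ℝ) - k) ^ N := by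
      calc ((Finset.univ.filter fun f => ¬ p f).card : ℝ)
          = ∑ f ∈ Finset.univ.filter fun f => ¬ p f, (1 : ℝ) := by simp
        _ ≤ ∑ f ∈ Finset.univ.filter fun f => ¬ p f, 2 ^ k * ∏ i, φ (f i) := by
            refine Finset.sum_le_sum fun f hf => ?_
            have hf : ¬ k ≤ _ := (Finset.mem_filter.1 hf).2
            simp only [hφ]
            rw [Finset.prod_ite, Finset.prod_const, Finset.prod_const_one, mul_one, one_div,
              inv_pow, ← div_eq_mul_inv, one_le_div (by positivity)]
            exact pow_le_pow_right₀ (by norm_num) (by omega)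
        _ ≤ ∑ f : ι → Fin M, 2 ^ k * ∏ i, φ (f i) := by
            refine Finset.sum_le_sum_of_subset_of_nonneg (Finset.subset_univ _) fun f _ _ => ?_
            refine mul_nonneg (by positivity) (Finset.prod_nonneg fun i _ => ?_)
            simp only [hφ]; split_ifs <;> norm_num
        _ = 2 ^ k * ((M : ℝ) - k) ^ N := by
            rw [← Finset.mul_sum, ← hsumφ, hNdef, ← Finset.card_univ, ← Finset.prod_const,
              Finset.prod_univ_sum, Fintype.piFinset_univ]
    refine h1.trans ?_
    have hmR : (0 : ℝ) < m := by exact_mod_cast hm0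
    have hkR : (1 : ℝ) ≤ k := by exact_mod_cast hk
    have hMR : (M : ℝ) = 2 * k * m := by rw [hM]; push_cast; ring
    have h2 : ((M : ℝ) - k) = M * (1 - 1 / (2 * m)) := by rw [hMR]; field_simp
    have hm1R : (1 : ℝ) ≤ m := by exact_mod_cast hm0
    have h3 : (1 - 1 / (2 * m) : ℝ) ^ N ≤ (1 / 4) ^ k := by
      have h0 : (0 : ℝ) ≤ 1 - 1 / (2 * m) := by
        rw [sub_nonneg, div_le_one (by positivity)]; linarith
      calc (1 - 1 / (2 * m) : ℝ) ^ N ≤ (Real.exp (-(1 / (2 * m)))) ^ N := by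
            gcongr; exact Real.one_sub_le_exp_neg _
        _ = Real.exp (-(N / (2 * m))) := by rw [← Real.exp_nat_mul]; congr 1; ring
        _ ≤ Real.exp (-(2 * k)) := by
            apply Real.exp_le_exp.2
            rw [neg_le_neg_iff, le_div_iff₀ (by positivity)]
            have : ((4 * k * m : ℕ) : ℝ) ≤ N := by exact_mod_cast hNm
            push_cast at this; linarith
        _ = (Real.exp (-2)) ^ k := by rw [← Real.exp_nat_mul]; congr 1; ring
        _ ≤ (1 / 4) ^ k := by
            gcongr
            have h5 : (2 : ℝ) ≤ Real.exp 1 := by linarith [Real.add_one_le_exp (1 : ℝ)]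
            have h6 : Real.exp (-2) * (Real.exp 1 * Real.exp 1) = 1 := by
              rw [← Real.exp_add, ← Real.exp_add]; norm_num
            nlinarith [Real.exp_pos (-2), Real.exp_pos 1, mul_le_mul h5 h5 (by norm_num) (by positivity)]
    have h4 : (2 : ℝ) ^ k * (1 / 4) ^ k ≤ 1 / 2 := by
      rw [← mul_pow]
      calc (2 * (1 / 4) : ℝ) ^ k ≤ (2 * (1 / 4)) ^ 1 :=
            pow_le_pow_of_le_one (by norm_num) (by norm_num) hk
        _ = 1 / 2 := by norm_num
    rw [h2, mul_pow]
    calc (2 : ℝ) ^ k * ((M : ℝ) ^ N * (1 - 1 / (2 * m)) ^ N)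
        ≤ 2 ^ k * ((M : ℝ) ^ N * (1 / 4) ^ k) := by gcongr
      _ = (2 ^ k * (1 / 4) ^ k) * (M : ℝ) ^ N := by ring
      _ ≤ 1 / 2 * (M : ℝ) ^ N := by gcongr
      _ = _ := by ring

/-- The success probability of a key in one round. -/
noncomputable def prob : ℝ := 1 / (16 * (Real.exp 8 + Real.exp 2))

theorem prob_pos : 0 < prob := by unfold prob; positivity

theorem prob_lt_one : prob < 1 := by
  unfold prob
  rw [div_lt_one (by positivity)]
  have := Real.one_le_exp (x := 8) (by norm_num)
  have := Real.exp_pos 2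
  linarith

-- Double counting: M ^ N / 2 ≤ C(N, k) Σ `cross` ≤ c C(N, k) Σ `hit` with c = e⁸ + e². Since C(N,
-- k) = (N / k) C(N - 1, k - 1) ≤ 8m C(N - 1, k - 1), the right side is at most 8c times the number
-- of placements taking x. This explains the constant 16c in `prob`.
open Classical in
theorem prob_le_card_taken {k : ℕ} (hk : 1 ≤ k) (hN : k ≤ Fintype.card ι) {m : ℕ}
    (hm : m = Fill.blocks k (Fintype.card ι)) (x : ι) :
    prob * ((2 * k * m : ℕ) : ℝ) ^ Fintype.card ι ≤
    ((Finset.univ.filter fun f : ι → Fin (2 * k * m) => Taken k (2 * k * m) m x f).card : ℝ) := by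
  have hm0 : 1 ≤ m := hm ▸ Nat.le_add_left _ _
  have hNm : Fintype.card ι ≤ 8 * k * m := by
    rw [hm, Fill.blocks]
    exact (Nat.lt_mul_div_succ _ (by omega)).le
  have h1 := le_card_taken (m := m) hk x
  have h2 := card_cross_le (ι := ι) hk hm0
  have h3 := half_le_card_cross hk hN hm
  have h4 := sum_cross_le hk hm0 (j := Fintype.card ι - k) (by omega)
  set N := Fintype.card ι with hNdef
  set S := ∑ t ∈ Finset.range (2 * k), hit k (N - k) (2 * k * m) t
  set S' := ∑ t ∈ Finset.range (2 * k), cross k (N - k) (2 * k * m) t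
  have hch : (k : ℝ) * N.choose k = N * (N - 1).choose (k - 1) := by
    obtain ⟨a, ha⟩ : ∃ a, N = a + 1 := ⟨N - 1, by omega⟩
    obtain ⟨b, rfl⟩ : ∃ b, k = b + 1 := ⟨k - 1, by omega⟩
    rw [ha]
    have := Nat.add_one_mul_choose_eq a b
    simp only [Nat.add_sub_cancel]
    have h' : (((a + 1) * a.choose b : ℕ) : ℝ) = (((a + 1).choose (b + 1) * (b + 1) : ℕ) : ℝ) := by
      exact_mod_cast this
    push_cast at h' ⊢; linarith
  refine le_trans ?_ h1
  have hS : 0 ≤ S := Finset.sum_nonneg fun t ht => hit_nonneg (by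
    have := end_le (k := k) (u := 0) (t := t + 1) hm0 (by have := Finset.mem_range.1 ht; omega)
    omega)
  set c := Real.exp 8 + Real.exp 2 with hc
  have hcpos : 0 < c := by positivity
  have hNR : (N : ℝ) ≤ 8 * k * m := by exact_mod_cast hNm
  have hkR : (0 : ℝ) < k := by exact_mod_cast hk
  -- `M ^ N ≤ 2 c (N choose k) S` and `N choose k ≤ 8 m (N-1 choose k-1)`
  have h5 : ((2 * k * m : ℕ) : ℝ) ^ N ≤ 2 * (N.choose k * (c * S)) := by
    have : (N.choose k : ℝ) * S' ≤ N.choose k * (c * S) := by gcongr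
    linarith
  have h6 : (N.choose k : ℝ) ≤ 8 * m * (N - 1).choose (k - 1) := by
    have : (k : ℝ) * N.choose k ≤ k * (8 * m * (N - 1).choose (k - 1)) := by
      rw [hch]
      calc (N : ℝ) * (N - 1).choose (k - 1) ≤ 8 * k * m * (N - 1).choose (k - 1) := by gcongr
        _ = _ := by ring
    exact le_of_mul_le_mul_left this hkR
  have h7 : (N.choose k : ℝ) * (c * S) ≤ 8 * m * (N - 1).choose (k - 1) * (c * S) := by gcongr
  have hprob : prob = 1 / (16 * c) := rfl
  rw [hprob, div_mul_eq_mul_div, one_mul, div_le_iff₀ (by positivity)]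
  linarith

end Count


/-! ## Probability: the number of rounds that a key goes through -/

namespace Rounds

open Fill Count

/-- Independent uniform hash values of the keys `0, …, n - 1`: `Y j s m` is the value at key `j`
of the hash function with seed `s` and range `{0, …, m}`. -/
structure UniformHash {Ω : Type*} [MeasurableSpace Ω] (μ : Measure Ω)
    (Y : ℕ → ℕ → ℕ → Ω → ℕ) (n : ℕ) : Prop where
  measurable : ∀ j s m, Measurable (Y j s m)
  le : ∀ j s m ω, Y j s m ω ≤ m
  uniform : ∀ j < n, ∀ s m, ∀ v ≤ m, μ {ω | Y j s m ω = v} = ((m : ℝ≥0∞) + 1)⁻¹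
  indep : iIndepFun (fun i : ℕ × ℕ × Fin n => Y i.2.2 i.1 i.2.1) μ

theorem pre_congr {k : ℕ} {c c' : ℕ → ℕ} {A : Finset ℕ} (h : ∀ j ∈ A, c j = c' j) (u t : ℕ) :
    pre k c A u t = pre k c' A u t := by
  unfold pre; congr 1
  exact Finset.filter_congr fun j hj => by rw [h j hj]

theorem thr_congr {k : ℕ} {c c' : ℕ → ℕ} {A : Finset ℕ} (h : ∀ j ∈ A, c j = c' j) (u : ℕ) :
    thr k c A u = thr k c' A u := by
  unfold thr; congr 1; ext t; rw [pre_congr h]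

theorem bump_congr {k : ℕ} {c c' : ℕ → ℕ} {A : Finset ℕ} (h : ∀ j ∈ A, c j = c' j) :
    bump k c A = bump k c' A := Finset.filter_congr fun j hj => by rw [h j hj, thr_congr h]

/-- The outcome is a function of the finitely many natural numbers c j with j ∈ A. The σ-algebra is
explicit because it will be that of a single seed or of the earlier seeds. -/
theorem measurable_bump {Ω : Type*} (k : ℕ) (A : Finset ℕ) (c : Ω → ℕ → ℕ) (mΩ : MeasurableSpace Ω)
    (hc : ∀ j ∈ A, Measurable fun ω => c ω j) (B : Finset ℕ) :
    MeasurableSet {ω | bump k (c ω) A = B} := by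
  set g : (A → ℕ) → Finset ℕ := fun v => bump k (fun j : ℕ => if h : j ∈ A then v ⟨j, h⟩ else 0) A
  have h1 : {ω | bump k (c ω) A = B} = (fun ω (j : A) => c ω j) ⁻¹' {v | g v = B} := by
    ext ω
    simp only [Set.mem_ofPred_eq, Set.mem_preimage, g]
    rw [bump_congr (c' := fun j => if h : j ∈ A then c ω j else 0)]
    intro j hj
    simp [hj]
  rw [h1]
  exact (measurable_pi_lambda _ fun j : A => hc j.1 j.2) (Set.to_countable _).measurableSet

theorem measurable_mem_bump {Ω : Type*} (k : ℕ) (A : Finset ℕ) (c : Ω → ℕ → ℕ)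
    (mΩ : MeasurableSpace Ω) (hc : ∀ j ∈ A, Measurable fun ω => c ω j) (j : ℕ) :
    MeasurableSet {ω | j ∈ bump k (c ω) A} := by
  have : {ω | j ∈ bump k (c ω) A} =
      ⋃ B ∈ A.powerset.filter fun B => j ∈ B, {ω | bump k (c ω) A = B} := by
    ext ω
    simp only [Set.mem_ofPred_eq, Set.mem_iUnion, Finset.mem_filter, Finset.mem_powerset,
      exists_prop]
    constructor
    · intro h
      exact ⟨_, ⟨Finset.filter_subset _ _, h⟩, rfl⟩
    · rintro ⟨B, hB, rfl⟩
      exact hB.2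
  rw [this]
  exact Finset.measurableSet_biUnion _ fun B _ => measurable_bump k A c mΩ hc B

theorem alive_subset (k : ℕ) (h : ℕ → ℕ → ℕ → ℕ) (n l : ℕ) :
    alive k h n l ⊆ Finset.range n := alive_anti (Nat.zero_le l)

/-- The keys that take part in round `l`. -/
def active (k : ℕ) (h : ℕ → ℕ → ℕ → ℕ) (n l : ℕ) : Finset ℕ :=
  if (alive k h n l).card < k then ∅ else alive k h n l

/-- A bound for the probability that a key is not put into a bucket in a round. -/
noncomputable def stay : ℝ := 1 - prob

theorem stay_nonneg : 0 ≤ stay := sub_nonneg.2 prob_lt_one.le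
theorem stay_lt_one : stay < 1 := sub_lt_self _ prob_pos

variable {Ω : Type*} [mΩ : MeasurableSpace Ω] {μ : Measure Ω}
  {Y : ℕ → ℕ → ℕ → Ω → ℕ} {k n : ℕ}

/-- The hash values at `ω`. -/
abbrev at' (Y : ℕ → ℕ → ℕ → Ω → ℕ) (ω : Ω) : ℕ → ℕ → ℕ → ℕ := fun j s m => Y j s m ω

/-- The keys left before round l depend on seeds below l only. Besides the filtration of the seeds,
the constant filtration is used later for plain measurability. -/
theorem measurable_alive (k : ℕ) (mF : ℕ → MeasurableSpace Ω) (hmono : Monotone mF)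
    (hm : ∀ l, ∀ j < n, ∀ m, @Measurable _ _ (mF (l + 1)) _ (Y j l m)) (l : ℕ) (A : Finset ℕ) :
    MeasurableSet[mF l] {ω | alive k (at' Y ω) n l = A} := by
  induction l generalizing A with
  | zero => exact MeasurableSet.const (Finset.range n = A)
  | succ l ih =>
    have h1 : {ω | alive k (at' Y ω) n (l + 1) = A} =
        ⋃ B ∈ (Finset.range n).powerset, ({ω | alive k (at' Y ω) n l = B} ∩
          {ω | (if B.card < k then B else bump k (cell k (at' Y ω) l B) B) = A}) := by
      ext ω
      simp only [Set.mem_ofPred_eq, Set.mem_iUnion, Set.mem_inter_iff, Finset.mem_powerset,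
        exists_prop]
      constructor
      · intro h
        exact ⟨_, alive_subset _ _ _ _, rfl, h⟩
      · rintro ⟨B, hB, rfl, h⟩
        exact h
    rw [h1]
    refine Finset.measurableSet_biUnion _ fun B hB => ?_
    refine MeasurableSet.inter (hmono (Nat.le_succ l) _ (ih B)) ?_
    split_ifs
    · exact MeasurableSet.const _
    · exact measurable_bump k B (fun ω => cell k (at' Y ω) l B) (mF (l + 1)) (fun j hj =>
        hm l j (Finset.mem_range.1 (Finset.mem_powerset.1 hB hj)) _) A

/-- Any segment length with exactly k keys is at most the threshold, since the threshold is the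
largest one. -/
theorem notMem_bump_of_taken {c : ℕ → ℕ} {A : Finset ℕ} {m : ℕ} (hk : 1 ≤ k) (x : A)
    (f : A → Fin (2 * k * m)) (hf : ∀ i : A, c i = f i) (ht : Taken k (2 * k * m) m x f) :
    (x : ℕ) ∉ bump k c A := by
  obtain ⟨u, hu, t, ht, hcard, hx⟩ := ht
  have h1 : pre k c A u t = k := by
    refine Eq.trans ?_ hcard
    rw [pre]
    refine Finset.card_bij' (fun j hj => ⟨j, (Finset.mem_filter.1 hj).1⟩) (fun i _ => i.1) ?_ ?_
      (fun _ _ => rfl) (fun _ _ => rfl)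
    · intro j hj
      simp only [Finset.mem_filter, Finset.mem_univ, true_and, mem_first] at hj ⊢
      rw [← hf ⟨j, hj.1⟩]; exact hj.2
    · intro i hi
      simp only [Finset.mem_filter, Finset.mem_univ, true_and, mem_first] at hi ⊢
      rw [hf]; exact ⟨i.2, hi⟩
  have h2 : t ≤ thr k c A u := Nat.le_findGreatest ht h1
  rw [mem_first, ← hf, block_iff hk ht] at hx
  simp only [bump, Finset.mem_filter, not_and, not_le]
  intro _
  rw [hx.1]; omega

/-- For a deterministic set A the placements of its keys are equally likely, so the count in
`prob_le_card_taken` becomes a probability. -/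
theorem measure_mem_bump_le [IsProbabilityMeasure μ] (hY : UniformHash μ Y n) (hk : 1 ≤ k) (l : ℕ) {A : Finset ℕ}
    (hA : A ⊆ Finset.range n) (hcard : k ≤ A.card) {j : ℕ} (hj : j ∈ A) :
    μ {ω | j ∈ bump k (cell k (at' Y ω) l A) A} ≤ ENNReal.ofReal stay := by
  classical
  set m := blocks k A.card with hm
  set M := 2 * k * m with hM
  have hMpos : 0 < M := by rw [hM, hm, blocks]; positivity
  set E : (A → Fin M) → Set Ω := fun f => {ω | ∀ i : A, Y i l (M - 1) ω = f i} with hE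
  have hEm : ∀ f, MeasurableSet (E f) := fun f => by
    have : E f = ⋂ i : A, {ω | Y i l (M - 1) ω = f i} := by
      ext; simp only [hE, Set.mem_ofPred_eq, Set.mem_iInter]
    rw [this]
    exact MeasurableSet.iInter fun i => hY.measurable _ _ _ (measurableSet_singleton _)
  have hEμ : ∀ f, μ (E f) = ((M : ℝ≥0∞)⁻¹) ^ A.card := fun f => by
    have hlt : ∀ i : A, (i : ℕ) < n := fun i => Finset.mem_range.1 (hA i.2)
    have hinj : Function.Injective (fun i : A => ((l, M - 1, ⟨i, hlt i⟩) : ℕ × ℕ × Fin n)) := by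
      intro a b hab
      exact Subtype.ext (congrArg (fun p : ℕ × ℕ × Fin n => (p.2.2 : ℕ)) hab)
    have h1 := (hY.indep.precomp hinj).measure_inter_preimage_eq_mul Finset.univ
      (sets := fun i => {((f i : Fin M) : ℕ)}) (fun i _ => measurableSet_singleton _)
    have h2 : E f = ⋂ i ∈ (Finset.univ : Finset A), (Y i l (M - 1)) ⁻¹' {((f i : Fin M) : ℕ)} := by
      ext ω
      rw [Set.mem_iInter₂]
      exact ⟨fun h i _ => h i, fun h i => h i (Finset.mem_univ _)⟩
    rw [h2]
    refine h1.trans ?_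
    have h3 : ∀ i : A, μ ((Y i l (M - 1)) ⁻¹' {((f i : Fin M) : ℕ)}) = (M : ℝ≥0∞)⁻¹ := fun i => by
      have := hY.uniform i (hlt i) l (M - 1) (f i) (by have := (f i).2; omega)
      have hc : ((M - 1 : ℕ) : ℝ≥0∞) + 1 = M := by
        have : ((M - 1 + 1 : ℕ) : ℝ≥0∞) = M := by rw [Nat.sub_add_cancel hMpos]
        exact_mod_cast this
      rw [hc] at this
      exact this
    rw [Finset.prod_congr rfl fun i _ => h3 i, Finset.prod_const, Finset.card_univ,
      Fintype.card_coe]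
  have hbm : MeasurableSet {ω | j ∈ bump k (cell k (at' Y ω) l A) A} :=
    measurable_mem_bump k A (fun ω => cell k (at' Y ω) l A) mΩ (fun i _ => hY.measurable _ _ _) j
  set T := Finset.univ.filter fun f : A → Fin M => Taken k M m ⟨j, hj⟩ f with hT
  have hsub : (⋃ f ∈ T, E f) ⊆ {ω | j ∈ bump k (cell k (at' Y ω) l A) A}ᶜ := by
    intro ω hω
    obtain ⟨f, hf, hω⟩ := Set.mem_iUnion₂.1 hω
    exact notMem_bump_of_taken (c := cell k (at' Y ω) l A) hk ⟨j, hj⟩ f hω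
      (Finset.mem_filter.1 hf).2
  have hlow : ENNReal.ofReal prob ≤ μ (⋃ f ∈ T, E f) := by
    rw [measure_biUnion_finset _ fun f _ => hEm f]
    · rw [Finset.sum_congr rfl fun f _ => hEμ f, Finset.sum_const, nsmul_eq_mul]
      have h1 := prob_le_card_taken (ι := A) (m := m) hk (by simpa using hcard) (by simp [hm])
        ⟨j, hj⟩
      rw [Fintype.card_coe] at h1
      have h2 : ENNReal.ofReal (prob * (M : ℝ) ^ A.card) ≤ ENNReal.ofReal (T.card : ℝ) := by
        apply ENNReal.ofReal_le_ofReal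
        convert h1
      rw [ENNReal.ofReal_mul prob_pos.le, ENNReal.ofReal_pow (by positivity),
        ENNReal.ofReal_natCast, ENNReal.ofReal_natCast] at h2
      have hM0 : (M : ℝ≥0∞) ≠ 0 := by exact_mod_cast hMpos.ne'
      have hMt : (M : ℝ≥0∞) ≠ ∞ := ENNReal.natCast_ne_top M
      calc ENNReal.ofReal prob
          = ENNReal.ofReal prob * (M : ℝ≥0∞) ^ A.card * ((M : ℝ≥0∞)⁻¹) ^ A.card := by
            rw [mul_assoc, ← mul_pow, ENNReal.mul_inv_cancel hM0 hMt, one_pow, mul_one]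
        _ ≤ _ := by gcongr
    · intro f _ g _ hfg
      rw [Function.onFun, Set.disjoint_left]
      intro ω hf hg
      exact hfg (funext fun i => Fin.ext ((hf i).symm.trans (hg i)))
  have h3 : ENNReal.ofReal prob ≤ 1 - μ {ω | j ∈ bump k (cell k (at' Y ω) l A) A} := by
    rw [← prob_compl_eq_one_sub hbm]
    exact hlow.trans (measure_mono hsub)
  have h4 : μ {ω | j ∈ bump k (cell k (at' Y ω) l A) A} ≤ 1 := prob_le_one
  rw [stay, ENNReal.ofReal_sub _ prob_pos.le, ENNReal.ofReal_one]
  have h5 : ENNReal.ofReal prob + μ {ω | j ∈ bump k (cell k (at' Y ω) l A) A} ≤ 1 :=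
    (add_le_add_left h3 _).trans (tsub_add_cancel_of_le h4).le
  exact ENNReal.le_sub_of_add_le_left ENNReal.ofReal_ne_top h5

/-- Condition on the set A of keys left before round l. It is determined by the earlier seeds and
hence independent of the hash values of seed l, so `measure_mem_bump_le` applies to each A
separately. A key active in round l + 1 was active in round l and has been bumped there. -/
theorem measure_mem_active_le [IsProbabilityMeasure μ] (hY : UniformHash μ Y n) (hk : 1 ≤ k) (l j : ℕ) :
    μ {ω | j ∈ active k (at' Y ω) n l} ≤ ENNReal.ofReal stay ^ l := by
  classical
  induction l with
  | zero => simpa using prob_le_one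
  | succ l ih =>
    set mi : ℕ × ℕ × Fin n → MeasurableSpace Ω := fun i =>
      MeasurableSpace.comap (Y i.2.2 i.1 i.2.1) ⊤ with hmi
    have hle : ∀ i, mi i ≤ mΩ := fun i => (hY.measurable _ _ _).comap_le
    -- `F l` is generated by all seeds below l, and `G l` below by seed l alone.
    set F : ℕ → MeasurableSpace Ω := fun l => ⨆ i ∈ {i : ℕ × ℕ × Fin n | i.1 < l}, mi i with hF
    have hFm : ∀ l, ∀ j < n, ∀ m, @Measurable _ _ (F (l + 1)) _ (Y j l m) := fun l j hj m => by
      have h1 : mi (l, m, ⟨j, hj⟩) ≤ F (l + 1) :=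
        le_iSup₂ (f := fun i (_ : i ∈ {i : ℕ × ℕ × Fin n | i.1 < l + 1}) => mi i)
          (l, m, ⟨j, hj⟩) (Nat.lt_succ_self l)
      exact measurable_iff_comap_le.2 h1
    have hmono : Monotone F := fun a b hab =>
      biSup_mono fun i (hi : i.1 < a) => lt_of_lt_of_le hi hab
    have hFle : ∀ l, F l ≤ mΩ := fun l => iSup₂_le fun i _ => hle i
    set G : ℕ → MeasurableSpace Ω := fun l => ⨆ i ∈ {i : ℕ × ℕ × Fin n | i.1 = l}, mi i with hG
    have hind : Indep (F l) (G l) μ := by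
      refine indep_iSup_of_disjoint hle hY.indep ?_
      rw [Set.disjoint_left]
      intro i (h1 : i.1 < l) (h2 : i.1 = l)
      omega
    have hGm : ∀ j < n, ∀ m, @Measurable _ _ (G l) _ (Y j l m) := fun j hj m => by
      have h1 : mi (l, m, ⟨j, hj⟩) ≤ G l :=
        le_iSup₂ (f := fun i (_ : i ∈ {i : ℕ × ℕ × Fin n | i.1 = l}) => mi i)
          (l, m, ⟨j, hj⟩) rfl
      exact measurable_iff_comap_le.2 h1
    set I := (Finset.range n).powerset.filter fun A => k ≤ A.card ∧ j ∈ A with hI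
    have hsub : {ω | j ∈ active k (at' Y ω) n (l + 1)} ⊆
        ⋃ A ∈ I, ({ω | alive k (at' Y ω) n l = A} ∩ {ω | j ∈ bump k (cell k (at' Y ω) l A) A}) := by
      intro ω hω
      simp only [Set.mem_ofPred_eq, active] at hω
      split_ifs at hω with h1
      · simp at hω
      · have h2 : ¬ (alive k (at' Y ω) n l).card < k := fun h3 => h1 (by
          rw [alive, if_pos h3]; exact h3)
        rw [alive, if_neg h2] at hω
        refine Set.mem_iUnion₂.2 ⟨alive k (at' Y ω) n l, ?_, rfl, hω⟩
        simp only [hI, Finset.mem_filter, Finset.mem_powerset]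
        exact ⟨alive_subset _ _ _ _, by omega, (Finset.mem_filter.1 hω).1⟩
    have hmA : ∀ A, MeasurableSet[F l] {ω | alive k (at' Y ω) n l = A} :=
      measurable_alive k F hmono hFm l
    have hstep : ∀ A ∈ I, μ ({ω | alive k (at' Y ω) n l = A} ∩
        {ω | j ∈ bump k (cell k (at' Y ω) l A) A}) ≤
        μ {ω | alive k (at' Y ω) n l = A} * ENNReal.ofReal stay := fun A hA => by
      simp only [hI, Finset.mem_filter, Finset.mem_powerset] at hA
      have h1 : MeasurableSet[G l] {ω | j ∈ bump k (cell k (at' Y ω) l A) A} :=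
        measurable_mem_bump k A (fun ω => cell k (at' Y ω) l A) (G l)
          (fun i hi => hGm i (Finset.mem_range.1 (hA.1 hi)) _) j
      rw [(Indep_iff _ _ μ).1 hind _ _ (hmA A) h1]
      gcongr
      exact measure_mem_bump_le hY hk l hA.1 hA.2.1 hA.2.2
    calc μ {ω | j ∈ active k (at' Y ω) n (l + 1)}
        ≤ ∑ A ∈ I, μ ({ω | alive k (at' Y ω) n l = A} ∩
          {ω | j ∈ bump k (cell k (at' Y ω) l A) A}) :=
          (measure_mono hsub).trans (measure_biUnion_finset_le _ _)
      _ ≤ ∑ A ∈ I, μ {ω | alive k (at' Y ω) n l = A} * ENNReal.ofReal stay :=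
          Finset.sum_le_sum hstep
      _ = μ (⋃ A ∈ I, {ω | alive k (at' Y ω) n l = A}) * ENNReal.ofReal stay := by
          rw [← Finset.sum_mul, measure_biUnion_finset _ fun A _ => hFle l _ (hmA A)]
          intro A _ B _ hAB
          rw [Function.onFun, Set.disjoint_left]
          intro ω h1 h2
          exact hAB (h1.symm.trans h2)
      _ ≤ μ {ω | j ∈ active k (at' Y ω) n l} * ENNReal.ofReal stay := by
          gcongr
          refine Set.iUnion₂_subset fun A hA ω hω => ?_
          simp only [hI, Finset.mem_filter, Finset.mem_powerset] at hA
          simp only [Set.mem_ofPred_eq] at hω ⊢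
          rw [active, hω, if_neg (by omega)]
          exact hA.2.2
      _ ≤ ENNReal.ofReal stay ^ l * ENNReal.ofReal stay := by gcongr
      _ = _ := (pow_succ _ _).symm

theorem measurableSet_mem_active (hY : UniformHash μ Y n) (k l j : ℕ) :
    MeasurableSet {ω | j ∈ active k (at' Y ω) n l} := by
  classical
  have : {ω | j ∈ active k (at' Y ω) n l} = ⋃ A ∈ (Finset.range n).powerset.filter fun A =>
      k ≤ A.card ∧ j ∈ A, {ω | alive k (at' Y ω) n l = A} := by
    ext ω
    simp only [Set.mem_ofPred_eq, Set.mem_iUnion, Finset.mem_filter, Finset.mem_powerset,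
      exists_prop, active]
    constructor
    · intro h
      split_ifs at h with h1
      · simp at h
      · exact ⟨_, ⟨alive_subset _ _ _ _, by omega, h⟩, rfl⟩
    · rintro ⟨A, hA, rfl⟩
      rw [if_neg (by omega)]; exact hA.2.2
  rw [this]
  exact Finset.measurableSet_biUnion _ fun A _ => measurable_alive k (fun _ => mΩ)
    (fun _ _ _ => le_rfl) (fun l j _ m => hY.measurable j l m) l A

theorem lintegral_card_active_le [IsProbabilityMeasure μ] (hY : UniformHash μ Y n) (hk : 1 ≤ k) (l : ℕ) :
    ∫⁻ ω, ((active k (at' Y ω) n l).card : ℝ≥0∞) ∂μ ≤ n * ENNReal.ofReal stay ^ l := by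
  have h1 : ∀ ω, ((active k (at' Y ω) n l).card : ℝ≥0∞) =
      ∑ j ∈ Finset.range n, {ω | j ∈ active k (at' Y ω) n l}.indicator 1 ω := fun ω => by
    have hsub : active k (at' Y ω) n l ⊆ Finset.range n := by
      unfold active; split_ifs
      · simp
      · exact alive_subset _ _ _ _
    simp only [Set.indicator_apply, Set.mem_ofPred_eq, Pi.one_apply]
    rw [Finset.sum_ite, Finset.sum_const_zero, add_zero, Finset.sum_const, nsmul_eq_mul, mul_one]
    congr 2
    ext j
    simp only [Finset.mem_filter]
    exact ⟨fun h => ⟨hsub h, h⟩, fun h => h.2⟩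
  simp only [h1]
  rw [lintegral_finsetSum _ fun j _ =>
    (measurable_one.indicator (measurableSet_mem_active hY k l j))]
  calc _ ≤ ∑ j ∈ Finset.range n, ENNReal.ofReal stay ^ l := by
        refine Finset.sum_le_sum fun j _ => ?_
        rw [lintegral_indicator_one (measurableSet_mem_active hY k l j)]
        exact measure_mem_active_le hY hk l j
    _ = _ := by simp

theorem measurable_card_active (hY : UniformHash μ Y n) (k l : ℕ) :
    Measurable fun ω => ((active k (at' Y ω) n l).card : ℝ≥0∞) := by
  classical
  have h1 : Measurable[mΩ, ⊤] fun ω => alive k (at' Y ω) n l := by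
    let : MeasurableSpace (Finset ℕ) := ⊤
    exact measurable_to_countable' fun A => measurable_alive k (fun _ => mΩ)
      (fun _ _ _ => le_rfl) (fun l j _ m => hY.measurable j l m) l A
  let : MeasurableSpace (Finset ℕ) := ⊤
  have h2 : Measurable fun A : Finset ℕ =>
      (((if A.card < k then ∅ else A : Finset ℕ).card : ℕ) : ℝ≥0∞) := measurable_from_top
  exact h2.comp h1

/-- Markov's inequality for the number of active keys, which equals the number of remaining keys if
the latter is at least k. -/
theorem mul_measure_le_card_alive [IsProbabilityMeasure μ] (hY : UniformHash μ Y n) (hk : 1 ≤ k)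
    (l : ℕ) : k * μ {ω | k ≤ (alive k (at' Y ω) n l).card} ≤ n * ENNReal.ofReal stay ^ l := by
  refine le_trans ?_ (lintegral_card_active_le hY hk l)
  refine le_trans ?_ (mul_meas_ge_le_lintegral (measurable_card_active hY k l) (k : ℝ≥0∞))
  gcongr
  rename_i ω
  intro hω
  rw [active, if_neg (by omega)]
  exact_mod_cast hω

theorem stay_ennreal_lt_one : ENNReal.ofReal stay < 1 := by
  rw [← ENNReal.ofReal_one]
  exact (ENNReal.ofReal_lt_ofReal_iff one_pos).2 stay_lt_one

theorem ae_exists_card_alive_lt [IsProbabilityMeasure μ] (hY : UniformHash μ Y n) (hk : 1 ≤ k) :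
    ∀ᵐ ω ∂μ, ∃ l, (alive k (at' Y ω) n l).card < k := by
  rw [ae_iff]
  push Not
  refine le_antisymm (ge_of_tendsto' (x := Filter.atTop)
    (f := fun l : ℕ => (n : ℝ≥0∞) * ENNReal.ofReal stay ^ l) ?_ fun l => ?_) zero_le
  · have := ENNReal.Tendsto.const_mul (a := (n : ℝ≥0∞))
      (ENNReal.tendsto_pow_atTop_nhds_zero_of_lt_one stay_ennreal_lt_one)
      (Or.inr (ENNReal.natCast_ne_top n))
    simpa using this
  · refine le_trans ?_ (mul_measure_le_card_alive hY hk l)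
    calc _ ≤ μ {ω | k ≤ (alive k (at' Y ω) n l).card} := measure_mono (Set.ofPred_subset_ofPred.2 fun ω hω => hω l)
      _ = 1 * μ {ω | k ≤ (alive k (at' Y ω) n l).card} := (one_mul _).symm
      _ ≤ _ := by gcongr; exact_mod_cast hk

end Rounds


/-! ## Packing several numbers into a word -/

namespace Pack

/-- Number of binary digits `1`. -/
def popc (y : ℕ) : ℕ := if y = 0 then 0 else popc (y / 2) + y % 2
decreasing_by omega

theorem popc_zero : popc 0 = 0 := by rw [popc]; simp

theorem popc_step (y : ℕ) : popc y = popc (y / 2) + y % 2 := by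
  by_cases h : y = 0
  · subst h; simp [popc_zero]
  · rw [popc, if_neg h]

theorem popc_add_pow (j : ℕ) {F b : ℕ} (hF : F < 2 ^ j) (hb : b ≤ 1) :
    popc (F + b * 2 ^ j) = popc F + b := by
  induction j generalizing F with
  | zero =>
    have hF0 : F = 0 := by simpa using hF
    subst hF0
    rw [popc_step]
    have : b / 2 = 0 := by omega
    simp [this, popc_zero, Nat.mod_eq_of_lt (show b < 2 by omega)]
  | succ j ih =>
    rw [popc_step (F + _), popc_step F, pow_succ]
    have h1 : (F + b * (2 ^ j * 2)) / 2 = F / 2 + b * 2 ^ j := by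
      rw [← mul_assoc, Nat.add_mul_div_right _ _ (by norm_num)]
    have h2 : (F + b * (2 ^ j * 2)) % 2 = F % 2 := by
      rw [← mul_assoc, Nat.add_mul_mod_self_right]
    rw [h1, h2, ih (by rw [pow_succ] at hF; omega)]
    omega

/-- The numbers `f 0, …, f (c - 1)` packed into fields of `d` bits. -/
def pack (d : ℕ) (f : ℕ → ℕ) : ℕ → ℕ
  | 0 => 0
  | c + 1 => pack d f c + f c * 2 ^ (d * c)

theorem pack_lt {d : ℕ} {f : ℕ → ℕ} (hf : ∀ i, f i < 2 ^ d) (c : ℕ) :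
    pack d f c < 2 ^ (d * c) := by
  induction c with
  | zero => simp [pack]
  | succ c ih =>
    have h1 : f c * 2 ^ (d * c) + 2 ^ (d * c) ≤ 2 ^ (d * (c + 1)) := by
      have : 2 ^ (d * (c + 1)) = 2 ^ d * 2 ^ (d * c) := by rw [← pow_add]; ring_nf
      rw [this, ← Nat.succ_mul]
      exact Nat.mul_le_mul_right _ (hf c)
    rw [pack]; omega

/-- Masking a packed word restores the word as it was after i fields; for flags this leaves those of
the earlier blocks. -/
theorem pack_mod {d : ℕ} {f : ℕ → ℕ} (hf : ∀ i, f i < 2 ^ d) {i c : ℕ} (h : i ≤ c) :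
    pack d f c % 2 ^ (d * i) = pack d f i := by
  induction c, h using Nat.le_induction with
  | base => exact Nat.mod_eq_of_lt (pack_lt hf i)
  | succ c hc ih =>
    rw [pack]
    have : 2 ^ (d * c) = 2 ^ (d * i) * 2 ^ (d * (c - i)) := by
      rw [← pow_add, ← mul_add]; congr 2; omega
    rw [this, mul_left_comm, Nat.add_mul_mod_self_left, ih]

theorem pack_field {d : ℕ} {f : ℕ → ℕ} (hf : ∀ i, f i < 2 ^ d) {i c : ℕ} (h : i < c) :
    pack d f c / 2 ^ (d * i) % 2 ^ d = f i := by
  have h1 := pack_mod hf (show i + 1 ≤ c from h)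
  have h2 : 2 ^ (d * (i + 1)) = 2 ^ (d * i) * 2 ^ d := by rw [← pow_add]; ring_nf
  rw [← Nat.mod_mul_right_div_self, ← h2, h1, pack, Nat.add_mul_div_right _ _ (by positivity),
    Nat.div_eq_of_lt (pack_lt hf i), zero_add]

end Pack

/-! ## The layout of the data structure -/

namespace Rounds

open Fill Pack

variable (k : ℕ) (h : ℕ → ℕ → ℕ → ℕ) (n : ℕ)

/-- Number of blocks in round `l`. -/
def nblocks (l : ℕ) : ℕ := blocks k (alive k h n l).card

/-- Threshold of a block in round `l`. -/
def thrAt (l u : ℕ) : ℕ := thr k (pos k h n l) (alive k h n l) u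

/-- Number of blocks before `u` with a bucket, in round `l`. -/
def fullsAt (l u : ℕ) : ℕ := fulls k (pos k h n l) (alive k h n l) u

/-- Is a bucket obtained from block `u`? -/
def flagAt (l u : ℕ) : ℕ := if thrAt k h n l u ≠ 0 then 1 else 0

/-- Address of the record of round `l`, for groups of `g` blocks. -/
def adr (g : ℕ) : ℕ → ℕ
  | 0 => 4 + 2 ^ g
  | l + 1 => adr g l + 1 + 3 * ((nblocks k h n l - 1) / g + 1)

/-- The first `u` blocks of round `l` are recorded in groups of `g` blocks behind address `p`. -/
def Groups (g d p l u : ℕ) (mem : ℕ → ℕ) : Prop := ∀ a, g * a < u →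
  mem (p + 1 + 3 * a) = 1 + base k h n l + fullsAt k h n l (g * a) ∧
  mem (p + 1 + 3 * a + 1) = pack 1 (fun i => flagAt k h n l (g * a + i)) (min g (u - g * a)) ∧
  mem (p + 1 + 3 * a + 2) = pack d (fun i => thrAt k h n l (g * a + i)) (min g (u - g * a))

/-- The record of round `l` is stored at address `p`. -/
def Record (g d p l : ℕ) (mem : ℕ → ℕ) : Prop :=
  mem p = nblocks k h n l ∧ Groups k h n g d p l (nblocks k h n l) mem

variable {k h n}

theorem nblocks_pos (l : ℕ) : 1 ≤ nblocks k h n l := Nat.le_add_left _ _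

theorem flagAt_le (l u : ℕ) : flagAt k h n l u ≤ 1 := by unfold flagAt; split_ifs <;> omega

theorem fullsAt_succ (l u : ℕ) :
    fullsAt k h n l (u + 1) = fullsAt k h n l u + flagAt k h n l u := fulls_succ u

/-- The digit sum of the flags is the rank that is needed to number the buckets. -/
theorem popc_flags (l u c : ℕ) :
    fullsAt k h n l u + popc (pack 1 (fun i => flagAt k h n l (u + i)) c) =
      fullsAt k h n l (u + c) := by
  have hf : ∀ i, flagAt k h n l (u + i) < 2 ^ 1 := fun i => by
    have := flagAt_le (k := k) (h := h) (n := n) l (u + i); omega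
  induction c with
  | zero => simp [pack, popc_zero]
  | succ c ih =>
    have := pack_lt (f := fun i => flagAt k h n l (u + i)) hf c
    rw [pack, one_mul, popc_add_pow c (by simpa using this) (flagAt_le _ _), ← add_assoc, ih,
      ← add_assoc, fullsAt_succ]

theorem thrAt_lt {d : ℕ} (hd : 2 * k < 2 ^ d) (l u : ℕ) : thrAt k h n l u < 2 ^ d :=
  (thr_le _ _ _ _).trans_lt hd

/-- Recording one more block. -/
theorem Groups.succ {g d p l u : ℕ} {mem mem' : ℕ → ℕ} (hg : 1 ≤ g)
    (hG : Groups k h n g d p l u mem)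
    (hsame : ∀ a, a < u / g → ∀ i < 3, mem' (p + 1 + 3 * a + i) = mem (p + 1 + 3 * a + i))
    (h0 : mem' (p + 1 + 3 * (u / g)) = if u % g = 0 then 1 + base k h n l + fullsAt k h n l u else
      mem (p + 1 + 3 * (u / g)))
    (h1 : mem' (p + 1 + 3 * (u / g) + 1) = (if u % g = 0 then 0 else
      mem (p + 1 + 3 * (u / g) + 1)) + flagAt k h n l u * 2 ^ (u % g))
    (h2 : mem' (p + 1 + 3 * (u / g) + 2) = (if u % g = 0 then 0 else
      mem (p + 1 + 3 * (u / g) + 2)) + thrAt k h n l u * 2 ^ (d * (u % g))) :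
    Groups k h n g d p l (u + 1) mem' := by
  intro a ha
  have hdm := Nat.div_add_mod u g
  have hml := Nat.mod_lt u (show 0 < g by omega)
  rcases lt_trichotomy a (u / g) with hlt | rfl | hgt
  -- Groups before that of block u are complete and unchanged; the group of u is extended or begun;
  -- later groups contain no block up to u.
  · have h3 : g * a + g ≤ g * (u / g) := by
      rw [← Nat.mul_succ]; exact Nat.mul_le_mul_left _ hlt
    have e0 := hsame a hlt 0 (by norm_num)
    have e1 := hsame a hlt 1 (by norm_num)
    have e2 := hsame a hlt 2 (by norm_num)
    obtain ⟨g0, g1, g2⟩ := hG a (by omega)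
    rw [show min g (u - g * a) = g by omega] at g1 g2
    rw [show min g (u + 1 - g * a) = g by omega]
    rw [add_zero] at e0
    exact ⟨e0.trans g0, e1.trans g1, e2.trans g2⟩
  · rw [show min g (u + 1 - g * (u / g)) = u % g + 1 by omega, pack, pack]
    by_cases hz : u % g = 0
    · rw [if_pos hz] at h0 h1 h2
      have hu : g * (u / g) = u := by omega
      rw [hz] at h1 h2 ⊢
      rw [h0, h1, h2, hu]
      simp [pack]
    · rw [if_neg hz] at h0 h1 h2
      obtain ⟨g0, g1, g2⟩ := hG (u / g) (by omega)
      rw [show min g (u - g * (u / g)) = u % g by omega] at g1 g2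
      rw [h0, h1, h2, g0, g1, g2, hdm, one_mul]
      exact ⟨rfl, rfl, rfl⟩
  · exfalso
    have : g * (u / g) + g ≤ g * a := by rw [← Nat.mul_succ]; exact Nat.mul_le_mul_left _ hgt
    omega

/-- What can be read off from the record of a round. -/
theorem Record.read {g d p l u : ℕ} {mem : ℕ → ℕ} (hg : 1 ≤ g) (hd : 2 * k < 2 ^ d)
    (hR : Record k h n g d p l mem) (hu : u < nblocks k h n l) :
    mem (p + 1 + 3 * (u / g)) + popc (mem (p + 1 + 3 * (u / g) + 1) % 2 ^ (u % g)) =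
      1 + base k h n l + fullsAt k h n l u ∧
    mem (p + 1 + 3 * (u / g) + 2) / 2 ^ (d * (u % g)) % 2 ^ d = thrAt k h n l u := by
  have hdm := Nat.div_add_mod u g
  have hml := Nat.mod_lt u (show 0 < g by omega)
  obtain ⟨g0, g1, g2⟩ := hR.2 (u / g) (by omega)
  rw [g0, g1, g2]
  have hf : ∀ i, flagAt k h n l (g * (u / g) + i) < 2 ^ 1 := fun i => by
    have := flagAt_le (k := k) (h := h) (n := n) l (g * (u / g) + i); omega
  constructor
  · have := pack_mod (f := fun i => flagAt k h n l (g * (u / g) + i)) hf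
      (show u % g ≤ min g (nblocks k h n l - g * (u / g)) by omega)
    rw [one_mul] at this
    rw [this, add_assoc, popc_flags, hdm]
  · rw [pack_field (f := fun i => thrAt k h n l (g * (u / g) + i)) (fun i => thrAt_lt hd _ _)
      (show u % g < min g (nblocks k h n l - g * (u / g)) by omega), hdm]

end Rounds


/-! ## The loops of one round of the construction

Registers: `0` number of keys, `1` the parameter `k`, `3` field width, `4` group size, `5` address
of the current record, `6` address of the list of the keys that are left, `7` their number,
`8` next bucket, `9` round, `10` number of blocks, `11` number of cells, `12` address of the
cells. -/

set_option linter.unusedSimpArgs false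

namespace RAM

open Ex (v ld)

/-- Clear a cell. -/
def zeroB : Blk := .sq (.put (v 12 + v 13) (.c 0)) (.set 13 (v 13 + .c 1))

/-- Count a key in its cell. -/
def countB : Blk :=
  .sq (.hsh 14 (ld (v 6 + v 13)) (v 9) (v 11 - .c 1)) <|
  .sq (.put (v 12 + v 14) (ld (v 12 + v 14) + .c 1)) (.set 13 (v 13 + .c 1))

/-- Record the block in register `17`, with the threshold in register `16`. -/
def flushB : Blk :=
  .sq (.set 19 (v 5 + .c 1 + .c 3 * (v 17 / v 4))) <|
  .sq (.set 14 (v 17 % v 4)) <|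
  .sq (.cond (v 14) .nop (.sq (.put (v 19) (v 8)) <|
    .sq (.put (v 19 + .c 1) (.c 0)) (.put (v 19 + .c 2) (.c 0)))) <|
  .sq (.put (v 19 + .c 2) (ld (v 19 + .c 2) + .bin .shl (v 16) (v 3 * v 14))) <|
  .sq (.cond (v 16) (.sq (.put (v 19 + .c 1) (ld (v 19 + .c 1) + .bin .shl (.c 1) (v 14)))
    (.set 8 (v 8 + .c 1))) .nop) <|
  .sq (.put (v 12 + v 11 + v 17) (v 16)) <|
  .sq (.set 17 (v 17 + .c 1)) <| .sq (.set 15 (.c 0)) <| .sq (.set 16 (.c 0)) (.set 18 (.c 0))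

/-- Look at a cell. -/
def lookB : Blk :=
  .sq (.set 15 (v 15 + ld (v 12 + v 13))) <|
  .sq (.set 18 (v 18 + .c 1)) <|
  .sq (.set 13 (v 13 + .c 1))
  (.cond (.bin .eq (v 15) (v 1)) (.set 16 (v 18)) .nop)

/-- Look at a cell, and record the block after its last cell. -/
def scanB : Blk := .sq lookB (.cond (.bin .eq (v 18) (.c 2 * v 1)) flushB .nop)

/-- Keep a key, unless it is put into a bucket. -/
def filtB : Blk :=
  .sq (.set 13 (v 13 - .c 1)) <|
  .sq (.set 15 (ld (v 6 + v 13))) <|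
  .sq (.hsh 14 (v 15) (v 9) (v 11 - .c 1))
  (.cond (.bin .lt (v 14 % (.c 2 * v 1)) (ld (v 12 + v 11 + v 14 / (.c 2 * v 1)))) .nop
    (.sq (.set 17 (v 17 - .c 1)) (.put (v 17) (v 15))))

variable {U : Type*} {M : Env U} {V : ℕ}

/-- The memory holds the list `L` from address `X` on. -/
def IsList (mem : ℕ → ℕ) (X : ℕ) (L : List ℕ) : Prop :=
  ∀ i (hi : i < L.length), mem (X + i) = L[i]

theorem zero_run {σ : State} {Y m : ℕ} (h11 : σ.reg 11 = m) (h12 : σ.reg 12 = Y)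
    (h13 : σ.reg 13 = 0) (hV : Y + m + 1 ≤ V) :
    ∃ σ', RunT M (whl (.bin .lt (v 13) (v 11)) zeroB.comp) σ σ' ((m + 1) * (20 * unit M V)) ∧
      (∀ r, r ≠ 13 → σ'.reg r = σ.reg r) ∧ (∀ i < m, σ'.mem (Y + i) = 0) ∧
      (∀ a, a < Y ∨ Y + m ≤ a → σ'.mem a = σ.mem a) := by
  obtain ⟨σ', hr, h1, h2, h3, h4⟩ := RunT.whl_count (M := M) (V := V) (b := zeroB)
    (e := .bin .lt (v 13) (v 11)) m (fun i s => s.reg 13 = i ∧ (∀ r, r ≠ 13 → s.reg r = σ.reg r) ∧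
      (∀ j < i, s.mem (Y + j) = 0) ∧ (∀ a, a < Y ∨ Y + m ≤ a → s.mem a = σ.mem a))
    (by
      rintro i hi s ⟨h1, h2, h3, h4⟩
      have e11 := (h2 11 (by decide)).trans h11
      have e12 := (h2 12 (by decide)).trans h12
      refine ⟨?_, ?_, ?_, ?_⟩
      · simp [h1, e11, hi]; omega
      · simp [h1, e11, hi]
      · simp [zeroB, Blk.ok, Blk.exec, State.setMem, h1, e12]; omega
      · refine ⟨?_, ?_, ?_, ?_⟩
        · simp [zeroB, Blk.exec, State.setReg, State.setMem, h1]
        · intro r hr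
          simp [zeroB, Blk.exec, State.setReg, State.setMem, Function.update_apply, hr, h2]
        · intro j hj
          simp only [zeroB, Blk.exec, State.setReg, State.setMem, Function.update_apply, h1, e12,
            Ex.eval_add, Ex.eval_v, Ex.eval_c]
          split_ifs
          · rfl
          · exact h3 j (by omega)
        · intro a ha
          simp only [zeroB, Blk.exec, State.setReg, State.setMem, Function.update_apply, h1, e12,
            Ex.eval_add, Ex.eval_v, Ex.eval_c]
          rw [if_neg (by omega)]
          exact h4 a ha)
    (by
      rintro s ⟨h1, h2, -⟩
      have e11 := (h2 11 (by decide)).trans h11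
      simp [h1, e11]; omega) σ ⟨h13, fun _ _ => rfl, by simp, fun _ _ => rfl⟩
  exact ⟨σ', hr.mono (Nat.mul_le_mul_left _ (Nat.mul_le_mul_right _ (by decide))), h2, h3, h4⟩

theorem count_run {σ : State} {X Y m N l : ℕ} {L : List ℕ} {c : ℕ → ℕ} (h6 : σ.reg 6 = X)
    (h7 : σ.reg 7 = N) (h9 : σ.reg 9 = l) (h11 : σ.reg 11 = m) (h12 : σ.reg 12 = Y)
    (h13 : σ.reg 13 = 0) (hN : L.length = N) (hL : IsList σ.mem X L) (hXY : X + N ≤ Y)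
    (h0 : ∀ i < m, σ.mem (Y + i) = 0) (hc : ∀ j ∈ L, M.hv j l (m - 1) = c j)
    (hcm : ∀ j ∈ L, c j < m) (hLV : ∀ j ∈ L, j ≤ V) (hl : l ≤ V) (hV : Y + m + 1 ≤ V) :
    ∃ σ', RunT M (whl (.bin .lt (v 13) (v 7)) countB.comp) σ σ' ((N + 1) * (40 * unit M V)) ∧
      (∀ r, r ≠ 13 → r ≠ 14 → σ'.reg r = σ.reg r) ∧
      (∀ i < m, σ'.mem (Y + i) = L.countP fun j => c j = i) ∧
      (∀ a, a < Y ∨ Y + m ≤ a → σ'.mem a = σ.mem a) := by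
  obtain ⟨σ', hr, h1, h2, h3, h4⟩ := RunT.whl_count (M := M) (V := V) (b := countB)
    (e := .bin .lt (v 13) (v 7)) N (fun i s => s.reg 13 = i ∧
      (∀ r, r ≠ 13 → r ≠ 14 → s.reg r = σ.reg r) ∧
      (∀ q < m, s.mem (Y + q) = (L.take i).countP fun j => c j = q) ∧
      (∀ a, a < Y ∨ Y + m ≤ a → s.mem a = σ.mem a))
    (by
      rintro i hi s ⟨h1, h2, h3, h4⟩
      have e6 := (h2 6 (by decide) (by decide)).trans h6
      have e7 := (h2 7 (by decide) (by decide)).trans h7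
      have e9 := (h2 9 (by decide) (by decide)).trans h9
      have e11 := (h2 11 (by decide) (by decide)).trans h11
      have e12 := (h2 12 (by decide) (by decide)).trans h12
      have hiL : i < L.length := by omega
      have hmem : L[i] ∈ L := List.getElem_mem hiL
      have hk : s.mem (X + i) = L[i] := (h4 _ (Or.inl (by omega))).trans (hL i hiL)
      have hcV := hcm _ hmem
      have hlist := hLV _ hmem
      have hcnt : s.mem (Y + c L[i]) ≤ N := by
        rw [h3 _ hcV]
        exact List.countP_le_length.trans (by simp; omega)
      refine ⟨?_, ?_, ?_, ?_⟩
      · simp [h1, e7, hi]; omega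
      · simp [h1, e7, hi]
      · simp [countB, Blk.ok, Blk.exec, State.setReg, State.setMem, Function.update_apply, h1, e6,
          e9, e11, e12, hk, hc _ hmem]
        omega
      · refine ⟨?_, ?_, ?_, ?_⟩
        · simp [countB, Blk.exec, State.setReg, State.setMem, Function.update_apply, h1]
        · intro r hr hr'
          simp [countB, Blk.exec, State.setReg, State.setMem, Function.update_apply, hr, hr', h2]
        · intro q hq
          rw [List.take_succ_eq_append_getElem hiL, List.countP_append, ← h3 _ hq]
          simp [countB, Blk.exec, State.setReg, State.setMem, Function.update_apply, h1, e6,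
            e9, e11, e12, hk, hc _ hmem, List.countP_cons]
          split_ifs with ha hb hb
          · rw [← ha, h3 _ hq]
          · omega
          · omega
          · rfl
        · intro a ha
          simp only [countB, Blk.exec, State.setReg, State.setMem, Function.update_apply]
          simp [h1, e6, e9, e11, e12, hk, hc _ hmem]
          rw [if_neg (by omega)]
          exact h4 a ha)
    (by
      rintro s ⟨h1, h2, -⟩
      have e7 := (h2 7 (by decide) (by decide)).trans h7
      simp [h1, e7]; omega) σ ⟨h13, fun _ _ _ => rfl, by simpa using h0, fun _ _ => rfl⟩
  refine ⟨σ', hr.mono (Nat.mul_le_mul_left _ (Nat.mul_le_mul_right _ (by decide))), h2, ?_, h4⟩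
  rwa [← hN, List.take_length] at h3

/-- The list is read from its end and the survivors are written downwards from Z, so their order is
kept and the new list ends just below Z. By X + 2N ≤ Z the old list is not overwritten. Thresholds
are read from the unpacked copy behind the cells. -/
theorem filt_run {σ : State} {X Y m N l k Z : ℕ} {L : List ℕ} {c thr : ℕ → ℕ} (h1 : σ.reg 1 = k)
    (h6 : σ.reg 6 = X) (h9 : σ.reg 9 = l) (h11 : σ.reg 11 = m) (h12 : σ.reg 12 = Y)
    (h13 : σ.reg 13 = N) (h17 : σ.reg 17 = Z) (hN : L.length = N) (hL : IsList σ.mem X L)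
    (hXZ : X + 2 * N ≤ Z) (hZY : Z ≤ Y) (hc : ∀ j ∈ L, M.hv j l (m - 1) = c j)
    (hcm : ∀ j ∈ L, c j < m) (hthr : ∀ j ∈ L, σ.mem (Y + m + c j / (2 * k)) = thr (c j / (2 * k)))
    (ht : ∀ u, thr u ≤ 2 * k)
    (hLV : ∀ j ∈ L, j ≤ V) (hl : l ≤ V) (hV : Y + 2 * m + 2 * k + 1 ≤ V) :
    ∃ σ' L', RunT M (whl (v 13) filtB.comp) σ σ' ((N + 1) * (60 * unit M V)) ∧
      (∀ r, r ≠ 13 → r ≠ 14 → r ≠ 15 → r ≠ 17 → σ'.reg r = σ.reg r) ∧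
      L' = L.filter (fun j => thr (c j / (2 * k)) ≤ c j % (2 * k)) ∧
      σ'.reg 17 = Z - L'.length ∧ IsList σ'.mem (Z - L'.length) L' ∧
      (∀ a, a < X → σ'.mem a = σ.mem a) := by
  set P : ℕ → Bool := fun j => thr (c j / (2 * k)) ≤ c j % (2 * k) with hP
  obtain ⟨σ', hr, g1, g2, g3, g4, g5⟩ := RunT.whl_count (M := M) (V := V) (b := filtB)
    (e := v 13) N (fun i s => s.reg 13 = N - i ∧
      (∀ r, r ≠ 13 → r ≠ 14 → r ≠ 15 → r ≠ 17 → s.reg r = σ.reg r) ∧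
      s.reg 17 = Z - ((L.drop (N - i)).filter P).length ∧
      IsList s.mem (Z - ((L.drop (N - i)).filter P).length) ((L.drop (N - i)).filter P) ∧
      (∀ a, a < Z - i ∨ Z ≤ a → s.mem a = σ.mem a))
    (by
      rintro i hi s ⟨g1, g2, g3, g4, g5⟩
      have e1 := (g2 1 (by decide) (by decide) (by decide) (by decide)).trans h1
      have e6 := (g2 6 (by decide) (by decide) (by decide) (by decide)).trans h6
      have e9 := (g2 9 (by decide) (by decide) (by decide) (by decide)).trans h9
      have e11 := (g2 11 (by decide) (by decide) (by decide) (by decide)).trans h11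
      have e12 := (g2 12 (by decide) (by decide) (by decide) (by decide)).trans h12
      obtain ⟨p, hp⟩ : ∃ p, N - i = p + 1 := ⟨N - i - 1, by omega⟩
      have hp' : N - (i + 1) = p := by omega
      rw [hp] at g1 g3 g4
      rw [hp']
      have hpL : p < L.length := by omega
      have hmem : L[p] ∈ L := List.getElem_mem hpL
      have hk : s.mem (X + p) = L[p] := (g5 _ (Or.inl (by omega))).trans (hL p hpL)
      have hcV := hcm _ hmem
      have hlist := hLV _ hmem
      have htV := ht (c L[p] / (2 * k))
      have hdiv : c L[p] / (2 * k) ≤ c L[p] := Nat.div_le_self _ _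
      have hth : s.mem (Y + m + c L[p] / (2 * k)) = thr (c L[p] / (2 * k)) :=
        (g5 _ (Or.inr (hZY.trans (by rw [add_assoc]; exact Nat.le_add_right _ _)))).trans
          (hthr _ hmem)
      have hdrop : L.drop p = L[p] :: L.drop (p + 1) := List.drop_eq_getElem_cons hpL
      set L₁ := (L.drop (p + 1)).filter P with hL₁
      have hlen : L₁.length ≤ i := (List.length_filter_le _ _).trans (by simp; omega)
      refine ⟨?_, ?_, ?_, ?_⟩
      · simp [g1]; omega
      · simp [g1]
      · simp only [filtB, Blk.ok, Blk.exec]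
        simp [State.setReg, Function.update_apply, g1, e1, e6, e9, e11, e12, g3, hk, hc _ hmem, hth]
        split_ifs <;> omega
      · have hcase : L₁.length = ((L.drop p).filter P).length ∧ P L[p] = false ∨
            ((L.drop p).filter P) = L[p] :: L₁ ∧ P L[p] = true := by
          rw [hdrop, List.filter_cons]
          cases hPp : P L[p] <;> simp [hL₁]
        rcases hcase with ⟨-, hf⟩ | ⟨hcons, ht'⟩
        · have hfl : (L.drop p).filter P = L₁ := by
            rw [hdrop, List.filter_cons_of_neg (by simp [hf])]
          have hlt : c L[p] % (2 * k) < thr (c L[p] / (2 * k)) := by simpa [hP] using hf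
          rw [hfl]
          refine ⟨?_, ?_, ?_, ?_, ?_⟩
          · simp [filtB, Blk.exec, State.setReg, Function.update_apply, g1, e1, e6, e9, e11, e12,
              hk, hc _ hmem, hth, hlt]
          · intro r a1 a2 a3 a4
            simp [filtB, Blk.exec, State.setReg, Function.update_apply, g1, e1, e6, e9, e11, e12,
              hk, hc _ hmem, hth, hlt, a1, a2, a3, g2 r a1 a2 a3 a4]
          · simp [filtB, Blk.exec, State.setReg, Function.update_apply, g1, e1, e6, e9, e11, e12,
              hk, hc _ hmem, hth, hlt, g3]
          · simpa [filtB, Blk.exec, State.setReg, Function.update_apply, g1, e1, e6, e9, e11, e12,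
              hk, hc _ hmem, hth, hlt] using g4
          · intro a ha
            simpa [filtB, Blk.exec, State.setReg, Function.update_apply, g1, e1, e6, e9, e11, e12,
              hk, hc _ hmem, hth, hlt] using g5 a (by omega)
        · have hlt : ¬ c L[p] % (2 * k) < thr (c L[p] / (2 * k)) := by simpa [hP] using ht'
          rw [hcons]
          refine ⟨?_, ?_, ?_, ?_, ?_⟩
          · simp [filtB, Blk.exec, State.setReg, State.setMem, Function.update_apply, g1, e1, e6,
              e9, e11, e12, hk, hc _ hmem, hth, hlt]
          · intro r a1 a2 a3 a4
            simp [filtB, Blk.exec, State.setReg, State.setMem, Function.update_apply, g1, e1, e6,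
              e9, e11, e12, hk, hc _ hmem, hth, hlt, a1, a2, a3, a4, g2 r a1 a2 a3 a4]
          · simp [filtB, Blk.exec, State.setReg, State.setMem, Function.update_apply, g1, e1, e6,
              e9, e11, e12, hk, hc _ hmem, hth, hlt, g3]
            omega
          · intro q hq
            simp only [List.length_cons] at hq ⊢
            simp [filtB, Blk.exec, State.setReg, State.setMem, Function.update_apply, g1, e1, e6,
              e9, e11, e12, hk, hc _ hmem, hth, hlt, g3]
            rcases Nat.eq_zero_or_pos q with rfl | hq0
            · rw [if_pos (by omega)]; rfl
            · obtain ⟨q, rfl⟩ : ∃ q', q = q' + 1 := ⟨q - 1, by omega⟩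
              rw [if_neg (by omega)]
              have := g4 q (by omega)
              rw [show Z - (L₁.length + 1) + (q + 1) = Z - L₁.length + q by omega, this]
              simp
          · intro a ha
            simp [filtB, Blk.exec, State.setReg, State.setMem, Function.update_apply, g1, e1, e6,
              e9, e11, e12, hk, hc _ hmem, hth, hlt, g3]
            rw [if_neg (by omega)]
            exact g5 a (by omega))
    (by
      rintro s ⟨g1, -⟩
      simp [g1]) σ ⟨by simp [h13], fun _ _ _ _ _ => rfl, by rw [Nat.sub_zero, ← hN, List.drop_length]; simpa using h17,
        by rw [Nat.sub_zero, ← hN, List.drop_length]; intro i hi; simp at hi, fun _ _ => rfl⟩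
  rw [Nat.sub_self, List.drop_zero] at g3 g4
  exact ⟨σ', _, hr.mono (Nat.mul_le_mul_left _ (Nat.mul_le_mul_right _ (by decide))), g2, rfl, g3, g4, fun a ha => g5 a (by omega)⟩

end RAM



/-! ### Scanning the cells and recording the blocks -/

namespace RAM

open Ex (v ld)
open Rounds Pack Fill

variable {U : Type*} {M : Env U} {V : ℕ}

theorem flush_exec {H : ℕ → ℕ → ℕ → ℕ} {s : State} {P Y m d g u t b q j : ℕ} (e3 : s.reg 3 = d)
    (e4 : s.reg 4 = g) (e5 : s.reg 5 = P) (e8 : s.reg 8 = b) (e11 : s.reg 11 = m)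
    (e12 : s.reg 12 = Y) (e16 : s.reg 16 = t) (e17 : s.reg 17 = u) (hq : q = P + 1 + 3 * (u / g))
    (hj : j = u % g) (hqY : q + 2 < Y + m) :
    let s' := flushB.exec H s
    (∀ r, r ≠ 8 → r ≠ 14 → r ≠ 15 → r ≠ 16 → r ≠ 17 → r ≠ 18 → r ≠ 19 → s'.reg r = s.reg r) ∧
    s'.reg 8 = b + (if t ≠ 0 then 1 else 0) ∧ s'.reg 15 = 0 ∧ s'.reg 16 = 0 ∧
    s'.reg 17 = u + 1 ∧ s'.reg 18 = 0 ∧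
    ∀ a, s'.mem a = if a = Y + m + u then t else
      if a = q + 1 then (if j = 0 then 0 else s.mem (q + 1)) + (if t ≠ 0 then 1 else 0) * 2 ^ j else
      if a = q + 2 then (if j = 0 then 0 else s.mem (q + 2)) + t * 2 ^ (d * j) else
      if a = q then (if j = 0 then b else s.mem q) else s.mem a := by
  intro s'
  by_cases hj0 : j = 0 <;> by_cases ht : t = 0
  all_goals
    refine ⟨?_, ?_, ?_, ?_, ?_, ?_, ?_⟩
    · intro r a1 a2 a3 a4 a5 a6 a7
      simp [s', flushB, Blk.exec, State.setReg, State.setMem, Function.update_apply, e3, e4, e5, e8,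
        e11, e12, e16, e17, ← hq, ← hj, hj0, ht, a1, a2, a3, a4, a5, a6, a7]
    · simp [s', flushB, Blk.exec, State.setReg, State.setMem, Function.update_apply, e3, e4, e5, e8,
        e11, e12, e16, e17, ← hq, ← hj, hj0, ht]
    · simp [s', flushB, Blk.exec, State.setReg, State.setMem, Function.update_apply, e3, e4, e5, e8,
        e11, e12, e16, e17, ← hq, ← hj, hj0, ht]
    · simp [s', flushB, Blk.exec, State.setReg, State.setMem, Function.update_apply, e3, e4, e5, e8,
        e11, e12, e16, e17, ← hq, ← hj, hj0, ht]
    · simp [s', flushB, Blk.exec, State.setReg, State.setMem, Function.update_apply, e3, e4, e5, e8,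
        e11, e12, e16, e17, ← hq, ← hj, hj0, ht]
    · simp [s', flushB, Blk.exec, State.setReg, State.setMem, Function.update_apply, e3, e4, e5, e8,
        e11, e12, e16, e17, ← hq, ← hj, hj0, ht]
    · intro a
      simp [s', flushB, Blk.exec, State.setReg, State.setMem, Function.update_apply, e3, e4, e5, e8,
        e11, e12, e16, e17, ← hq, ← hj, hj0, ht]
      by_cases c1 : a = Y + m + u
      · simp [c1]
      by_cases c2 : a = q + 1
      · subst c2; simp [c1]
      by_cases c3 : a = q + 2
      · subst c3; simp [c1]
      by_cases c4 : a = q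
      · subst c4; simp [c1]
      simp [c1, c2, c3, c4]

theorem flush_ok {H : ℕ → ℕ → ℕ → ℕ} {s : State} {P Y m d g u t b q j : ℕ} (e3 : s.reg 3 = d)
    (e4 : s.reg 4 = g) (e5 : s.reg 5 = P) (e8 : s.reg 8 = b) (e11 : s.reg 11 = m)
    (e12 : s.reg 12 = Y) (e16 : s.reg 16 = t) (e17 : s.reg 17 = u) (hq : q = P + 1 + 3 * (u / g))
    (hj : j = u % g) (hqY : q + 2 < Y + m) (hV : Y + m + u + 3 ≤ V) (hd : d ≤ V) (hg : g ≤ V)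
    (hb : b + 1 ≤ V) (ht : t ≤ V) (hdj : d * j ≤ V) (hzq : j ≠ 0 → s.mem q ≤ V)
    (hz1 : (if j = 0 then 0 else s.mem (q + 1)) + 2 ^ j ≤ V)
    (hz2 : (if j = 0 then 0 else s.mem (q + 2)) + t * 2 ^ (d * j) ≤ V) :
    flushB.ok H V s := by
  have h3 : 3 * (u / g) ≤ V := by omega
  have h4 : u / g ≤ V := by omega
  have hjV : j ≤ V := hj ▸ (Nat.mod_le _ _).trans (by omega)
  by_cases hj0 : j = 0 <;> by_cases ht0 : t = 0
  all_goals
    simp [hj0] at hz1 hz2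
    simp [flushB, Blk.ok, Blk.exec, State.setReg, State.setMem, Function.update_apply, e3, e4, e5, e8,
        e11, e12, e16, e17, ← hq, ← hj, hj0, ht0, hz1, hz2]
    try simp [ht0] at hz2
    try simp [hj0] at hdj
    try omega
    try (generalize t * 2 ^ (d * j) = p2 at *; generalize 2 ^ j = p1 at *
         generalize d * j = p3 at *; omega)

theorem pre_succ (k : ℕ) (c : ℕ → ℕ) (A : Finset ℕ) (u b : ℕ) :
    pre k c A u (b + 1) = pre k c A u b + (A.filter fun j => c j = 2 * k * u + b).card := by
  unfold pre
  rw [← Finset.card_union_of_disjoint]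
  · congr 1
    ext j
    simp only [Finset.mem_union, Finset.mem_filter]
    constructor
    · rintro ⟨h1, h2, h3⟩
      by_cases h : c j = 2 * k * u + b
      · exact Or.inr ⟨h1, h⟩
      · exact Or.inl ⟨h1, h2, by omega⟩
    · rintro (⟨h1, h2, h3⟩ | ⟨h1, h2⟩)
      · exact ⟨h1, h2, by omega⟩
      · exact ⟨h1, by omega, by omega⟩
  · rw [Finset.disjoint_left]
    intro j h1 h2
    rw [Finset.mem_filter] at h1 h2
    omega

/-- The largest `t ≤ b` such that `k` keys lie in the first `t` cells of block `u`. -/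
def best (k : ℕ) (c : ℕ → ℕ) (A : Finset ℕ) (u b : ℕ) : ℕ :=
  Nat.findGreatest (fun t => pre k c A u t = k) b

theorem best_succ (k : ℕ) (c : ℕ → ℕ) (A : Finset ℕ) (u b : ℕ) :
    best k c A u (b + 1) = if pre k c A u (b + 1) = k then b + 1 else best k c A u b :=
  Nat.findGreatest_succ _

theorem look_exec {H : ℕ → ℕ → ℕ → ℕ} {s : State} {k Y i x t b : ℕ} (e1 : s.reg 1 = k)
    (e12 : s.reg 12 = Y) (e13 : s.reg 13 = i) (e15 : s.reg 15 = x) (e16 : s.reg 16 = t)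
    (e18 : s.reg 18 = b) :
    let s' := lookB.exec H s
    (∀ r, r ≠ 13 → r ≠ 15 → r ≠ 16 → r ≠ 18 → s'.reg r = s.reg r) ∧ s'.reg 13 = i + 1 ∧
    s'.reg 15 = x + s.mem (Y + i) ∧
    s'.reg 16 = (if x + s.mem (Y + i) = k then b + 1 else t) ∧ s'.reg 18 = b + 1 ∧
    s'.mem = s.mem := by
  intro s'
  by_cases hc : x + s.mem (Y + i) = k
  all_goals
    refine ⟨?_, ?_, ?_, ?_, ?_, ?_⟩
    · intro r a1 a2 a3 a4
      simp [s', lookB, Blk.exec, State.setReg, Function.update_apply, e1, e12, e13, e15, e16,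
        e18, hc, a1, a2, a3, a4]
    all_goals
      simp [s', lookB, Blk.exec, State.setReg, Function.update_apply, e1, e12, e13, e15, e16,
        e18, hc]

theorem look_ok {H : ℕ → ℕ → ℕ → ℕ} {s : State} {k Y i x b : ℕ} (e1 : s.reg 1 = k)
    (e12 : s.reg 12 = Y) (e13 : s.reg 13 = i) (e15 : s.reg 15 = x) (e18 : s.reg 18 = b)
    (h1 : Y + i + 1 ≤ V) (h2 : x + s.mem (Y + i) ≤ V) (h3 : b + 1 ≤ V) (h4 : k ≤ V) :
    lookB.ok H V s := by
  simp [lookB, Blk.ok, Blk.exec, State.setReg, Function.update_apply, e1, e12, e13, e15, e18]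
  split_ifs <;> omega

variable {k n l : ℕ} {h : ℕ → ℕ → ℕ → ℕ}

theorem fullsAt_le (l u : ℕ) : fullsAt k h n l u ≤ u :=
  (Finset.card_filter_le _ _).trans (Finset.card_range u).le

/-- The invariant writes the position as i = 2ku + b with b < 2k: registers 15 and 16 hold the
prefix count and the best threshold after b cells of block u, and the u blocks before it are
recorded. -/
theorem scan_run {σ : State} {P Y m d g B N : ℕ} (hk : 1 ≤ k) (hg : 1 ≤ g)
    (hB : B = nblocks k h n l) (hN : N = (alive k h n l).card) (hm : m = 2 * k * B)
    (hd : 2 * k < 2 ^ d)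
    (e1 : σ.reg 1 = k) (e3 : σ.reg 3 = d) (e4 : σ.reg 4 = g) (e5 : σ.reg 5 = P)
    (e8 : σ.reg 8 = 1 + base k h n l) (e11 : σ.reg 11 = m) (e12 : σ.reg 12 = Y)
    (e13 : σ.reg 13 = 0) (e15 : σ.reg 15 = 0) (e16 : σ.reg 16 = 0) (e17 : σ.reg 17 = 0)
    (e18 : σ.reg 18 = 0)
    (hcnt : ∀ i < m, σ.mem (Y + i) = ((alive k h n l).filter fun j => pos k h n l j = i).card)
    (hPY : P + 1 + 3 * ((B - 1) / g + 1) ≤ Y)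
    (hV : Y + m + B + N + 2 * k + d + g + base k h n l + 3 ≤ V) (hVd : 2 ^ (d * g) ≤ V)
    (hVg : 2 ^ g ≤ V) (hdg : d * g ≤ V) :
    ∃ σ', RunT M (whl (.bin .lt (v 13) (v 11)) scanB.comp) σ σ' ((m + 1) * (120 * unit M V)) ∧
      (∀ r, r ≠ 8 → r < 13 → σ'.reg r = σ.reg r) ∧
      σ'.reg 8 = 1 + base k h n l + fullsAt k h n l B ∧
      Groups k h n g d P l B σ'.mem ∧ (∀ u < B, σ'.mem (Y + m + u) = thrAt k h n l u) ∧
      (∀ a, (a < P + 1 ∨ P + 1 + 3 * ((B - 1) / g + 1) ≤ a ∧ a < Y + m) →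
        σ'.mem a = σ.mem a) := by
  set A := alive k h n l with hA
  set c := pos k h n l with hc
  obtain ⟨σ', hr, u, b, hub, hb, g13, g15, g16, g17, g18, g8, gr, gG, gT, gm⟩ := RunT.whl_count
    (M := M) (V := V) (b := scanB) (e := .bin .lt (v 13) (v 11)) m
    (fun i s => ∃ u b, i = 2 * k * u + b ∧ b < 2 * k ∧ s.reg 13 = i ∧ s.reg 15 = pre k c A u b ∧
      s.reg 16 = best k c A u b ∧ s.reg 17 = u ∧ s.reg 18 = b ∧
      s.reg 8 = 1 + base k h n l + fullsAt k h n l u ∧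
      (∀ r, r ≠ 8 → r < 13 → s.reg r = σ.reg r) ∧
      Groups k h n g d P l u s.mem ∧ (∀ u' < u, s.mem (Y + m + u') = thrAt k h n l u') ∧
      (∀ a, (a < P + 1 ∨ P + 1 + 3 * ((B - 1) / g + 1) ≤ a ∧ a < Y + m) → s.mem a = σ.mem a))
    (by
      rintro i hi s ⟨u, b, hub, hb, g13, g15, g16, g17, g18, g8, gr, gG, gT, gm⟩
      have f1 := (gr 1 (by decide) (by decide)).trans e1
      have f3 := (gr 3 (by decide) (by decide)).trans e3
      have f4 := (gr 4 (by decide) (by decide)).trans e4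
      have f5 := (gr 5 (by decide) (by decide)).trans e5
      have f11 := (gr 11 (by decide) (by decide)).trans e11
      have f12 := (gr 12 (by decide) (by decide)).trans e12
      have hu : u < B := by
        by_contra hcon
        have : 2 * k * B ≤ 2 * k * u := Nat.mul_le_mul_left _ (by omega)
        omega
      have hug : u / g ≤ (B - 1) / g := Nat.div_le_div_right (by omega)
      have hmi : s.mem (Y + i) = (A.filter fun j => c j = 2 * k * u + b).card := by
        rw [gm _ (Or.inr ⟨by omega, by omega⟩), hcnt i hi, hub]
      have hx : pre k c A u b + s.mem (Y + i) = pre k c A u (b + 1) := by rw [hmi, pre_succ]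
      have hxN : pre k c A u (b + 1) ≤ N := hN ▸ Finset.card_filter_le _ _
      have hfu := fullsAt_le (k := k) (h := h) (n := n) l u
      obtain ⟨l1, l13, l15, l16, l18, lm⟩ := look_exec (H := M.hv) f1 f12 g13 g15 g16 g18
      rw [hx] at l15 l16
      rw [← best_succ] at l16
      have lok : lookB.ok M.hv V s := look_ok f1 f12 g13 g15 g18 (by omega) (by omega) (by omega)
        (by omega)
      set s1 := lookB.exec M.hv s with hs1
      have k1 := (l1 1 (by decide) (by decide) (by decide) (by decide)).trans f1
      have k3 := (l1 3 (by decide) (by decide) (by decide) (by decide)).trans f3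
      have k4 := (l1 4 (by decide) (by decide) (by decide) (by decide)).trans f4
      have k5 := (l1 5 (by decide) (by decide) (by decide) (by decide)).trans f5
      have k8 := (l1 8 (by decide) (by decide) (by decide) (by decide)).trans g8
      have k11 := (l1 11 (by decide) (by decide) (by decide) (by decide)).trans f11
      have k12 := (l1 12 (by decide) (by decide) (by decide) (by decide)).trans f12
      have k17 := (l1 17 (by decide) (by decide) (by decide) (by decide)).trans g17
      refine ⟨by simp [g13, f11, hi]; omega, by simp [g13, f11, hi], ?_, ?_⟩
      · refine ⟨lok, ?_, ?_, ?_⟩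
        · simp [← hs1, l18, k1]
          split_ifs <;> omega
        · intro _; trivial
        · intro he
          have hb1 : b + 1 = 2 * k := by simpa [← hs1, l18, k1] using he
          have l16' : s1.reg 16 = thrAt k h n l u := by rw [l16, hb1]; rfl
          have htle : thrAt k h n l u ≤ 2 * k := thr_le _ _ _ _
          have hjg : u % g + 1 ≤ g := Nat.mod_lt _ (by omega)
          have hdm := Nat.div_add_mod u g
          have hft : ∀ i, thrAt k h n l (g * (u / g) + i) < 2 ^ d := fun i => thrAt_lt hd _ _
          have hff : ∀ i, flagAt k h n l (g * (u / g) + i) < 2 ^ 1 := fun i => by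
            have := flagAt_le (k := k) (h := h) (n := n) l (g * (u / g) + i); omega
          have hp1 := pack_lt (f := fun i => flagAt k h n l (g * (u / g) + i)) hff (u % g)
          -- The word after adding the new threshold is again a packing, of at most g fields, hence
          -- below 2 ^ (d * g).
          have hp2 := pack_lt (f := fun i => thrAt k h n l (g * (u / g) + i)) hft (u % g + 1)
          have hz : u % g ≠ 0 → s.mem (P + 1 + 3 * (u / g)) ≤ V ∧
              s.mem (P + 1 + 3 * (u / g) + 1) = pack 1 (fun i => flagAt k h n l (g * (u / g) + i))
                (u % g) ∧
              s.mem (P + 1 + 3 * (u / g) + 2) = pack d (fun i => thrAt k h n l (g * (u / g) + i))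
                (u % g) := by
            intro hne
            obtain ⟨q0, q1, q2⟩ := gG (u / g) (by omega)
            rw [show min g (u - g * (u / g)) = u % g by omega] at q1 q2
            refine ⟨?_, q1, q2⟩
            rw [q0]
            have := fullsAt_le (k := k) (h := h) (n := n) l (g * (u / g))
            omega
          have hpow1 : 2 ^ (u % g + 1) ≤ V :=
            (Nat.pow_le_pow_right (by norm_num) hjg).trans hVg
          have hpow2 : 2 ^ (d * (u % g + 1)) ≤ V :=
            (Nat.pow_le_pow_right (by norm_num) (Nat.mul_le_mul_left d hjg)).trans hVd
          refine flush_ok k3 k4 k5 k8 k11 k12 l16' k17 rfl rfl (by omega) (by omega) (by omega)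
            (by omega) (by omega) (by omega)
            ((Nat.mul_le_mul_left d (by omega : u % g ≤ g)).trans hdg) ?_ ?_ ?_
          · intro hne; rw [lm]; exact (hz hne).1
          · rw [lm]
            rw [one_mul] at hp1
            rw [pow_succ] at hpow1
            split_ifs with h0
            · omega
            · rw [(hz h0).2.1]; omega
          · rw [lm]
            rw [pack, hdm] at hp2
            split_ifs with h0
            · rw [h0] at hp2 hpow2 ⊢
              simp only [pack] at hp2
              omega
            · rw [(hz h0).2.2]; omega
      · have hex : scanB.exec M.hv s = if b + 1 = 2 * k then flushB.exec M.hv s1 else s1 := by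
          simp only [scanB, Blk.exec, ← hs1, Ex.eval_eq, Ex.eval_v, l18, Ex.eval_mul, Ex.eval_c, k1]
          by_cases hb1 : b + 1 = 2 * k <;> simp [hb1]
        rw [hex]
        split_ifs with hb1
        · have l16' : s1.reg 16 = thrAt k h n l u := by rw [l16, hb1]; rfl
          obtain ⟨w1, w8, w15, w16, w17, w18, wm⟩ := flush_exec (H := M.hv) k3 k4 k5 k8 k11 k12 l16'
            k17 rfl rfl (show P + 1 + 3 * (u / g) + 2 < Y + m by omega)
          refine ⟨u + 1, 0, by rw [mul_add]; omega, by omega, ?_, ?_, ?_, w17, w18, ?_, ?_, ?_, ?_, ?_⟩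
          · exact (w1 13 (by decide) (by decide) (by decide) (by decide) (by decide) (by decide)
              (by decide)).trans l13
          · rw [w15]; symm; simp [pre]
          · rw [w16]; rfl
          · rw [w8, fullsAt_succ, ← add_assoc]; rfl
          · intro r r1 r2
            rw [w1 r r1 (by omega) (by omega) (by omega) (by omega) (by omega) (by omega),
              l1 r (by omega) (by omega) (by omega) (by omega), gr r r1 r2]
          · refine gG.succ (mem' := (flushB.exec M.hv s1).mem) hg ?_ ?_ ?_ ?_
            · intro a ha i hi
              rw [wm, if_neg (by omega), if_neg (by omega), if_neg (by omega), if_neg (by omega), lm]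
            · rw [wm, if_neg (by omega), if_neg (by omega), if_neg (by omega), if_pos rfl, lm]
            · rw [wm, if_neg (by omega), if_pos rfl, lm]; rfl
            · rw [wm, if_neg (by omega), if_neg (by omega), if_pos rfl, lm]
          · intro u' hu'
            rw [wm]
            by_cases heq : u' = u
            · rw [heq, if_pos rfl]
            · rw [if_neg (by omega), if_neg (by omega), if_neg (by omega), if_neg (by omega), lm]
              exact gT u' (by omega)
          · intro a ha
            rw [wm, if_neg (by omega), if_neg (by omega), if_neg (by omega), if_neg (by omega), lm]
            exact gm a ha
        · refine ⟨u, b + 1, by omega, by omega, l13, l15, l16, k17, l18, k8, ?_, ?_, ?_, ?_⟩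
          · intro r r1 r2
            rw [l1 r (by omega) (by omega) (by omega) (by omega), gr r r1 r2]
          · rw [lm]; exact gG
          · rw [lm]; exact gT
          · rw [lm]; exact gm)
    (by
      rintro s ⟨u, b, -, -, g13, -, -, -, -, -, gr, -⟩
      have f11 := (gr 11 (by decide) (by decide)).trans e11
      simp [g13, f11]; omega) σ ⟨0, 0, by simp, by omega, e13, by rw [e15]; symm; simp [pre],
        by rw [e16]; rfl, e17, e18, by rw [e8]; simp [fullsAt, fulls], fun _ _ _ => rfl,
        fun a ha => by omega, fun u hu => by omega, fun _ _ => rfl⟩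
  -- 2kB = 2ku + b with b < 2k leaves only this possibility.
  have huB : u = B := by
    rcases lt_trichotomy u B with hl | he | hl
    · have : 2 * k * (u + 1) ≤ 2 * k * B := Nat.mul_le_mul_left _ hl
      rw [mul_add] at this; omega
    · exact he
    · have : 2 * k * (B + 1) ≤ 2 * k * u := Nat.mul_le_mul_left _ hl
      rw [mul_add] at this; omega
  subst huB
  exact ⟨σ', hr.mono (Nat.mul_le_mul_left _ (Nat.mul_le_mul_right _ (by decide))), gr, g8, gG, gT,
    gm⟩

end RAM


/-! ## One round of the construction -/


namespace RAM

open Ex (v ld)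
open Rounds Pack Fill

/-- Prepare a round. -/
def prepB : Blk :=
  .sq (.set 10 (v 7 / (.c 8 * v 1) + .c 1)) <|
  .sq (.set 11 (.c 2 * v 1 * v 10)) <|
  .sq (.set 12 (v 6 + v 7 + (.c 4 * v 0 + .c 4))) (.set 13 (.c 0))

/-- Prepare the scan. -/
def prepScanB : Blk :=
  .sq (.put (v 5) (v 10)) <| .sq (.set 13 (.c 0)) <| .sq (.set 15 (.c 0)) <|
  .sq (.set 16 (.c 0)) <| .sq (.set 17 (.c 0)) (.set 18 (.c 0))

/-- Prepare the removal of the keys that have got a bucket. -/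
def prepFiltB : Blk := .sq (.set 13 (v 7)) (.set 17 (v 12))

/-- Finish a round. -/
def doneB : Blk :=
  .sq (.set 5 (v 5 + .c 1 + .c 3 * ((v 10 - .c 1) / v 4 + .c 1))) <|
  .sq (.set 7 (v 12 - v 17)) <| .sq (.set 6 (v 17)) (.set 9 (v 9 + .c 1))

/-- One round. -/
def roundP : Prog :=
  .seq prepB.comp <| .seq (whl (.bin .lt (v 13) (v 11)) zeroB.comp) <|
  .seq (Blk.set 13 (.c 0)).comp <| .seq (whl (.bin .lt (v 13) (v 7)) countB.comp) <|
  .seq prepScanB.comp <| .seq (whl (.bin .lt (v 13) (v 11)) scanB.comp) <|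
  .seq prepFiltB.comp <| .seq (whl (v 13) filtB.comp) doneB.comp

variable {U : Type*} {M : Env U} {V : ℕ} {k n : ℕ} {h : ℕ → ℕ → ℕ → ℕ}

theorem Groups.congr {g d p l u : ℕ} {mem mem' : ℕ → ℕ} (hg : 1 ≤ g)
    (hG : Groups k h n g d p l u mem)
    (he : ∀ a, p + 1 ≤ a → a < p + 1 + 3 * ((u - 1) / g + 1) → mem' a = mem a) :
    Groups k h n g d p l u mem' := by
  intro a ha
  have : a ≤ (u - 1) / g := by
    rw [Nat.le_div_iff_mul_le (by omega), mul_comm]; omega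
  rw [he _ (by omega) (by omega), he _ (by omega) (by omega), he _ (by omega) (by omega)]
  exact hG a ha

theorem Record.congr {g d l : ℕ} {mem mem' : ℕ → ℕ} (hg : 1 ≤ g)
    (hR : Record k h n g d (adr k h n g l) l mem)
    (he : ∀ a, adr k h n g l ≤ a → a < adr k h n g (l + 1) → mem' a = mem a) :
    Record k h n g d (adr k h n g l) l mem' :=
  ⟨(he _ le_rfl (by rw [adr]; omega)).trans hR.1,
    Groups.congr hg hR.2 fun a h1 h2 => he a (by omega) (by rw [adr]; omega)⟩

theorem adr_mono {g : ℕ} : Monotone (adr k h n g) := monotone_nat_of_le_succ fun l => by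
  rw [adr]; omega

/-- The part of the data structure that is complete after `l` rounds. -/
structure Stored (k : ℕ) (h : ℕ → ℕ → ℕ → ℕ) (n g d w l : ℕ) (mem : ℕ → ℕ) : Prop where
  m0 : mem 0 = k
  m1 : mem 1 = g
  m2 : mem 2 = d
  m3 : mem 3 = 2 ^ g
  table : ∀ y < 2 ^ g, mem (4 + y) = popc y
  recs : ∀ i < l, Record k h n g d (adr k h n g i) i mem
  small : ∀ a < adr k h n g l, mem a < 2 ^ w

theorem base_le (hk : 1 ≤ k) (hb : ∀ j s m, h j s m ≤ m) (l : ℕ) : base k h n l ≤ n := by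
  have := card_alive_add (n := n) hk hb l
  nlinarith [Nat.zero_le (base k h n l)]

/-- Every new entry is a proper word: the numbers of blocks and of buckets are at most n + 1 ≤ n +
k, and the packings use at most g and d * g ≤ w bits. -/
theorem Stored.succ {g d w l : ℕ} {mem mem' : ℕ → ℕ} (hk : 1 ≤ k)
    (hb : ∀ j s m, h j s m ≤ m) (hg : 1 ≤ g) (hd : 2 * k < 2 ^ d) (hdw : d * g ≤ w)
    (hw : n + k < 2 ^ w) (hact : ¬ (alive k h n l).card < k) (hS : Stored k h n g d w l mem)
    (hsame : ∀ a < adr k h n g l, mem' a = mem a)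
    (hR : Record k h n g d (adr k h n g l) l mem') : Stored k h n g d w (l + 1) mem' := by
  have h0 : 4 + 2 ^ g ≤ adr k h n g l := adr_mono (Nat.zero_le l)
  have hpos : 0 < 2 ^ g := by positivity
  refine ⟨(hsame 0 (by omega)).trans hS.m0, (hsame 1 (by omega)).trans hS.m1,
    (hsame 2 (by omega)).trans hS.m2, (hsame 3 (by omega)).trans hS.m3,
    fun y hy => (hsame _ (by omega)).trans (hS.table y hy), ?_, ?_⟩
  · intro i hi
    rcases Nat.lt_succ_iff_lt_or_eq.1 hi with hlt | rfl
    · exact Record.congr hg (hS.recs i hlt) fun a _ ha =>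
        hsame a (ha.trans_le (adr_mono (show i + 1 ≤ l from hlt)))
    · exact hR
  · intro a ha
    by_cases hal : a < adr k h n g l
    · rw [hsame a hal]; exact hS.small a hal
    rw [adr] at ha
    have hd1 : 1 ≤ d := by
      by_contra hcon
      have : d = 0 := by omega
      subst this; simp at hd; omega
    have hgw : 2 ^ (1 * g) ≤ 2 ^ w :=
      Nat.pow_le_pow_right (by norm_num) ((Nat.mul_le_mul_right g hd1).trans hdw)
    have hdw' : 2 ^ (d * g) ≤ 2 ^ w := Nat.pow_le_pow_right (by norm_num) hdw
    have hbase := base_le (n := n) hk hb (l + 1)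
    have hbs : base k h n (l + 1) = base k h n l + fullsAt k h n l (nblocks k h n l) := by
      rw [base, if_neg hact]; rfl
    rcases Nat.eq_or_lt_of_le (not_lt.1 hal) with he | hlt
    · rw [← he, hR.1]
      have h1 : (alive k h n l).card ≤ n := by
        have := card_alive_add (n := n) hk hb l; omega
      have h2 : (alive k h n l).card / (8 * k) ≤ (alive k h n l).card := Nat.div_le_self _ _
      have : nblocks k h n l ≤ n + 1 := Nat.add_le_add_right (h2.trans h1) 1
      omega
    · obtain ⟨q, i, hi, haq⟩ : ∃ q i, i < 3 ∧ a = adr k h n g l + 1 + 3 * q + i :=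
        ⟨(a - adr k h n g l - 1) / 3, (a - adr k h n g l - 1) % 3, Nat.mod_lt _ (by norm_num),
          by omega⟩
      have hq : q ≤ (nblocks k h n l - 1) / g := by omega
      have hqm : g * q < nblocks k h n l := by
        have := (Nat.le_div_iff_mul_le (by omega)).1 hq
        have := nblocks_pos (k := k) (h := h) (n := n) l
        rw [mul_comm]; omega
      obtain ⟨r0, r1, r2⟩ := hR.2 q hqm
      have hff : ∀ i, flagAt k h n l (g * q + i) < 2 ^ 1 := fun i => by
        have := flagAt_le (k := k) (h := h) (n := n) l (g * q + i); omega
      have hft : ∀ i, thrAt k h n l (g * q + i) < 2 ^ d := fun i => thrAt_lt hd _ _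
      have hmin : min g (nblocks k h n l - g * q) ≤ g := min_le_left _ _
      interval_cases i
      · rw [haq, add_zero, r0]
        have : fullsAt k h n l (g * q) ≤ fullsAt k h n l (nblocks k h n l) := fulls_mono hqm.le
        omega
      · rw [haq, r1]
        exact (pack_lt hff _).trans_le ((Nat.pow_le_pow_right (by norm_num)
          (Nat.mul_le_mul_left 1 hmin)).trans hgw)
      · rw [haq, r2]
        exact (pack_lt hft _).trans_le ((Nat.pow_le_pow_right (by norm_num)
          (Nat.mul_le_mul_left d hmin)).trans hdw')

/-- The state before round `l`. -/
structure RoundInv (k : ℕ) (h : ℕ → ℕ → ℕ → ℕ) (n g d w l : ℕ) (σ : State) : Prop where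
  r0 : σ.reg 0 = n
  r1 : σ.reg 1 = k
  r3 : σ.reg 3 = d
  r4 : σ.reg 4 = g
  r5 : σ.reg 5 = adr k h n g l
  r7 : σ.reg 7 = (alive k h n l).card
  r8 : σ.reg 8 = 1 + base k h n l
  r9 : σ.reg 9 = l
  list : ∃ L : List ℕ, L.Nodup ∧ L.toFinset = alive k h n l ∧ IsList σ.mem (σ.reg 6) L
  lower : adr k h n g l + (8 * n + 8) ≤ σ.reg 6
  upper : σ.reg 6 ≤ 4 + 2 ^ g + (8 * n + 8) + l * (5 * n + 4)
  stored : Stored k h n g d w l σ.mem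

theorem prepB_exec {H : ℕ → ℕ → ℕ → ℕ} {s : State} :
    let s' := prepB.exec H s
    (∀ r, r ≠ 10 → r ≠ 11 → r ≠ 12 → r ≠ 13 → s'.reg r = s.reg r) ∧
    s'.reg 10 = s.reg 7 / (8 * s.reg 1) + 1 ∧
    s'.reg 11 = 2 * s.reg 1 * (s.reg 7 / (8 * s.reg 1) + 1) ∧
    s'.reg 12 = s.reg 6 + s.reg 7 + (4 * s.reg 0 + 4) ∧ s'.reg 13 = 0 ∧ s'.mem = s.mem := by
  intro s'
  refine ⟨fun r a1 a2 a3 a4 => ?_, ?_, ?_, ?_, ?_, ?_⟩ <;>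
    simp [s', prepB, Blk.exec, State.setReg, Function.update_apply, *]

theorem prepScanB_exec {H : ℕ → ℕ → ℕ → ℕ} {s : State} :
    let s' := prepScanB.exec H s
    (∀ r, r < 13 → s'.reg r = s.reg r) ∧ s'.reg 13 = 0 ∧ s'.reg 15 = 0 ∧ s'.reg 16 = 0 ∧
    s'.reg 17 = 0 ∧ s'.reg 18 = 0 ∧ s'.mem = Function.update s.mem (s.reg 5) (s.reg 10) := by
  intro s'
  refine ⟨fun r a1 => ?_, ?_, ?_, ?_, ?_, ?_, ?_⟩
  · have b1 : r ≠ 13 := by omega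
    have b2 : r ≠ 15 := by omega
    have b3 : r ≠ 16 := by omega
    have b4 : r ≠ 17 := by omega
    have b5 : r ≠ 18 := by omega
    simp [s', prepScanB, Blk.exec, State.setReg, State.setMem, Function.update_apply, *]
  all_goals simp [s', prepScanB, Blk.exec, State.setReg, State.setMem, Function.update_apply]

theorem doneB_exec {H : ℕ → ℕ → ℕ → ℕ} {s : State} :
    let s' := doneB.exec H s
    (∀ r, r ≠ 5 → r ≠ 6 → r ≠ 7 → r ≠ 9 → s'.reg r = s.reg r) ∧
    s'.reg 5 = s.reg 5 + 1 + 3 * ((s.reg 10 - 1) / s.reg 4 + 1) ∧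
    s'.reg 7 = s.reg 12 - s.reg 17 ∧ s'.reg 6 = s.reg 17 ∧ s'.reg 9 = s.reg 9 + 1 ∧
    s'.mem = s.mem := by
  intro s'
  refine ⟨fun r a1 a2 a3 a4 => ?_, ?_, ?_, ?_, ?_, ?_⟩ <;>
    simp [s', doneB, Blk.exec, State.setReg, Function.update_apply, *]

/-- The records grow upwards, and their number has no a priori bound, so the working area moves
ahead of them. The list starts at X, the cells at Y = X + N + 4n + 4, and the new list ends just
below Y. Thus X grows by at least 4n + 4, more than the length of a record, and by at most 5n + 4.
-/
theorem round_run {g d w l : ℕ} {σ : State} (hk : 1 ≤ k) (hkn : k ≤ n)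
    (hb : ∀ j s m, h j s m ≤ m) (hg : 1 ≤ g) (hd : 2 * k < 2 ^ d) (hdw : d * g ≤ w)
    (hw : n + k < 2 ^ w) (hact : ¬ (alive k h n l).card < k) (hM : M.hv = h)
    (hI : RoundInv k h n g d w l σ) (hV : σ.reg 6 + 40 * n + d + g + l + 100 ≤ V)
    (hwV : 2 ^ w ≤ V) (hw2 : w ≤ V) :
    ∃ σ', RunT M roundP σ σ' (2000 * (alive k h n l).card * unit M V) ∧
      RoundInv k h n g d w (l + 1) σ' := by
  obtain ⟨L, hLn, hLA, hL⟩ := hI.list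
  have hNn : (alive k h n l).card ≤ n := by
    have := card_alive_add (n := n) hk hb l; omega
  have i7 := hI.r7
  set A := alive k h n l with hA
  set N := A.card with hN
  set c := pos k h n l with hc
  set B := nblocks k h n l with hB
  set X := σ.reg 6 with hX
  set m := 2 * k * B with hm
  have hBeq : B = N / (8 * k) + 1 := rfl
  have hB1 : B ≤ N + 1 := Nat.add_le_add_right (Nat.div_le_self _ _) 1
  have hB8 : 8 * (B - 1) ≤ N := by
    have h1 : N / (8 * k) ≤ N / 8 := Nat.div_le_div_left (by omega) (by norm_num)
    rw [hBeq, Nat.add_sub_cancel]; omega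
  -- m = 2k ⌊N/(8k)⌋ + 2k ≤ N/4 + 2N, using k ≤ N.
  have hmN : m ≤ 3 * N := by
    have h1 : 8 * k * (N / (8 * k)) ≤ N := Nat.mul_div_le _ _
    have h2 : m = 2 * k * (N / (8 * k)) + 2 * k := by rw [hm, hBeq]; ring
    have h3 : 8 * k * (N / (8 * k)) = 4 * (2 * k * (N / (8 * k))) := by ring
    omega
  have hlen : L.length = N := by rw [hN, ← hLA, List.toFinset_card_of_nodup hLn]
  have hLmem : ∀ j ∈ L, j ∈ A := fun j hj => by rw [← hLA]; exact List.mem_toFinset.2 hj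
  have hLn' : ∀ j ∈ L, j < n := fun j hj =>
    Finset.mem_range.1 (alive_subset _ _ _ _ (hLmem j hj))
  have hck : ∀ j ∈ L, M.hv j l (m - 1) = c j := fun j _ => by rw [hM]; rfl
  have hcm : ∀ j ∈ L, c j < m := fun j _ => cell_lt hk hb _ _ _
  have hbase := base_le (n := n) hk hb l
  have hadr : adr k h n g (l + 1) = adr k h n g l + 1 + 3 * ((B - 1) / g + 1) := rfl
  have hBg : (B - 1) / g ≤ B - 1 := Nat.div_le_self _ _
  have hz0 := Nat.zero_le ((B - 1) / g)
  obtain ⟨z, hz⟩ : ∃ z, z = (B - 1) / g := ⟨_, rfl⟩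
  rw [← hz] at hadr hBg
  have hlow := hI.lower
  -- preparation
  obtain ⟨p1, p10, p11, p12, p13, pm⟩ := prepB_exec (H := M.hv) (s := σ)
  have pok : prepB.ok M.hv V σ := by
    have h8 : N / (8 * k) ≤ N := Nat.div_le_self _ _
    have h9 : 2 * k * (N / (8 * k) + 1) = m := by rw [hm, hBeq]
    simp only [prepB, Blk.ok, Blk.exec, State.setReg, Function.update_apply, Ex.ok, Ex.eval]
    simp only [hI.r0, hI.r1, i7, ← hX, Ex.eval, BinOp.apply, h9]
    simp
    simp only [hI.r1, i7, h9]
    omega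
  rw [i7, hI.r1] at p10 p11
  rw [i7, hI.r0] at p12
  rw [← hBeq] at p10 p11
  rw [← hm] at p11
  have q1 := (p1 1 (by decide) (by decide) (by decide) (by decide)).trans hI.r1
  have q3 := (p1 3 (by decide) (by decide) (by decide) (by decide)).trans hI.r3
  have q4 := (p1 4 (by decide) (by decide) (by decide) (by decide)).trans hI.r4
  have q5 := (p1 5 (by decide) (by decide) (by decide) (by decide)).trans hI.r5
  have q6 : (prepB.exec M.hv σ).reg 6 = X := p1 6 (by decide) (by decide) (by decide) (by decide)
  have q7 := (p1 7 (by decide) (by decide) (by decide) (by decide)).trans i7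
  have q8 := (p1 8 (by decide) (by decide) (by decide) (by decide)).trans hI.r8
  have q9 := (p1 9 (by decide) (by decide) (by decide) (by decide)).trans hI.r9
  have q0 := (p1 0 (by decide) (by decide) (by decide) (by decide)).trans hI.r0
  have run1 := Blk.run M V _ _ pok
  set s1 := prepB.exec M.hv σ with hs1
  set Y := X + N + (4 * n + 4) with hY
  -- clear the cells
  obtain ⟨s2, run2, z1, z2, z3⟩ := zero_run (M := M) (V := V) (σ := s1) (Y := Y) (m := m)
    p11 p12 p13 (by omega)
  have ok3 : (Blk.set 13 (.c 0)).ok M.hv V s2 := by simp [Blk.ok]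
  have run3 := Blk.run M V _ _ ok3
  -- count
  set s3 := (Blk.set 13 (.c 0)).exec M.hv s2 with hs3
  have t1 : ∀ r, r ≠ 13 → s3.reg r = s1.reg r := fun r hr => by
    rw [← z1 r hr]; simp [hs3, Blk.exec, State.setReg, Function.update_apply, hr]
  have t13 : s3.reg 13 = 0 := by simp [hs3, Blk.exec, State.setReg]
  have tm : s3.mem = s2.mem := rfl
  obtain ⟨s4, run4, c1, c2, c3⟩ := count_run (M := M) (V := V) (σ := s3) (X := X) (Y := Y) (m := m)
    (N := N) (l := l) (L := L) (c := c) ((t1 6 (by decide)).trans q6) ((t1 7 (by decide)).trans q7)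
    ((t1 9 (by decide)).trans q9) ((t1 11 (by decide)).trans p11) ((t1 12 (by decide)).trans p12)
    t13 hlen (fun i hi => by
      rw [tm, z3 _ (Or.inl (by omega)), pm]; exact hL i hi) (by omega)
    (fun i hi => by rw [tm]; exact z2 i hi) hck hcm (fun j hj => by have := hLn' j hj; omega)
    (by omega) (by omega)
  -- scan
  have u1 : ∀ r, r < 13 → s4.reg r = s1.reg r := fun r hr =>
    (c1 r (by omega) (by omega)).trans (t1 r (by omega))
  have um : ∀ a, a < Y → s4.mem a = σ.mem a := fun a ha => by
    rw [c3 a (Or.inl ha), tm, z3 a (Or.inl ha), pm]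
  have ok5 : prepScanB.ok M.hv V s4 := by
    simp [prepScanB, Blk.ok, Blk.exec, State.setReg, State.setMem, Function.update_apply,
      u1 5 (by decide), u1 10 (by decide), q5, p10]
    have h8 : N / (8 * k) ≤ N := Nat.div_le_self _ _
    omega
  have run5 := Blk.run M V _ _ ok5
  obtain ⟨v1, v13, v15, v16, v17, v18, vm⟩ := prepScanB_exec (H := M.hv) (s := s4)
  set s5 := prepScanB.exec M.hv s4 with hs5
  have v1' : ∀ r, r < 13 → s5.reg r = s1.reg r := fun r hr => (v1 r hr).trans (u1 r hr)
  have vm' : ∀ a, a ≠ adr k h n g l → s5.mem a = s4.mem a := fun a ha => by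
    rw [vm, u1 5 (by decide), q5, Function.update_of_ne ha]
  have hd1 : 1 ≤ d := by
    by_contra hcon
    have : d = 0 := by omega
    subst this; simp at hd; omega
  have hgd : g ≤ d * g := Nat.le_mul_of_pos_left _ hd1
  have hcard : ∀ i, L.countP (fun j => c j = i) = (A.filter fun j => c j = i).card := fun i => by
    rw [List.countP_eq_length_filter, ← List.toFinset_card_of_nodup (hLn.filter _),
      List.toFinset_filter, hLA]
    simp
  obtain ⟨s6, run6, w1, w8, wG, wT, wm⟩ := scan_run (M := M) (V := V) (σ := s5)
    (P := adr k h n g l) (Y := Y) (m := m) (d := d) (g := g) (B := B) (N := N) (k := k) (n := n)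
    (l := l) (h := h) hk hg rfl rfl rfl hd
    ((v1' 1 (by decide)).trans q1) ((v1' 3 (by decide)).trans q3) ((v1' 4 (by decide)).trans q4)
    ((v1' 5 (by decide)).trans q5) ((v1' 8 (by decide)).trans q8) ((v1' 11 (by decide)).trans p11)
    ((v1' 12 (by decide)).trans p12) v13 v15 v16 v17 v18
    (fun i hi => by rw [vm' _ (by omega), c2 i hi, hcard]) (by omega) (by omega)
    ((Nat.pow_le_pow_right (by norm_num) hdw).trans hwV)
    ((Nat.pow_le_pow_right (by norm_num) (hgd.trans hdw)).trans hwV) (hdw.trans hw2)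
  -- remove the keys with a bucket
  have x1 : ∀ r, r ≠ 8 → r < 13 → s6.reg r = s1.reg r := fun r h8 hr =>
    (w1 r h8 hr).trans (v1' r hr)
  have xm : ∀ a, adr k h n g (l + 1) ≤ a → a < Y → s6.mem a = σ.mem a := fun a h1 h2 => by
    rw [wm a (Or.inr ⟨by omega, by omega⟩), vm' a (by omega), um a h2]
  have xm' : ∀ a, a < adr k h n g l → s6.mem a = σ.mem a := fun a h1 => by
    rw [wm a (Or.inl (by omega)), vm' a (by omega), um a (by omega)]
  have xP : s6.mem (adr k h n g l) = B := by
    rw [wm _ (Or.inl (by omega)), vm, u1 5 (by decide), q5, Function.update_self, u1 10 (by decide),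
      p10]
  have ok7 : prepFiltB.ok M.hv V s6 := by
    simp [prepFiltB, Blk.ok, Blk.exec, State.setReg, Function.update_apply, x1 7 (by decide)
      (by decide), x1 12 (by decide) (by decide), q7, p12]
    omega
  have run7 := Blk.run M V _ _ ok7
  set s7 := prepFiltB.exec M.hv s6 with hs7
  have y1 : ∀ r, r ≠ 13 → r ≠ 17 → s7.reg r = s6.reg r := fun r a1 a2 => by
    simp [hs7, prepFiltB, Blk.exec, State.setReg, Function.update_apply, a1, a2]
  have y13 : s7.reg 13 = N := by
    have := (x1 7 (by decide) (by decide)).trans q7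
    simpa [hs7, prepFiltB, Blk.exec, State.setReg, Function.update_apply] using this
  have y17 : s7.reg 17 = Y := by
    have := (x1 12 (by decide) (by decide)).trans p12
    simpa [hs7, prepFiltB, Blk.exec, State.setReg, Function.update_apply] using this
  have ym : s7.mem = s6.mem := rfl
  have y1' : ∀ r, r ≠ 8 → r < 13 → s7.reg r = s1.reg r := fun r a1 a2 =>
    (y1 r (by omega) (by omega)).trans (x1 r a1 a2)
  obtain ⟨s8, L', run8, f1, fL, f17, fl, fm⟩ := filt_run (M := M) (V := V) (σ := s7) (X := X) (Y := Y)
    (m := m) (N := N) (l := l) (k := k) (Z := Y) (L := L) (c := c) (thr := thrAt k h n l)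
    ((y1' 1 (by decide) (by decide)).trans q1) ((y1' 6 (by decide) (by decide)).trans q6)
    ((y1' 9 (by decide) (by decide)).trans q9) ((y1' 11 (by decide) (by decide)).trans p11)
    ((y1' 12 (by decide) (by decide)).trans p12) y13 y17 hlen
    (fun i hi => by rw [ym, xm _ (by omega) (by omega)]; exact hL i hi)
    (by omega) le_rfl hck hcm
    (fun j hj => by rw [ym]; exact wT _ (Nat.div_lt_of_lt_mul (hcm j hj)))
    (fun u => thr_le _ _ _ _) (fun j hj => by have := hLn' j hj; omega) (by omega) (by omega)
  have f1' : ∀ r, r ≠ 8 → r < 13 → s8.reg r = s1.reg r := fun r a1 a2 =>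
    (f1 r (by omega) (by omega) (by omega) (by omega)).trans (y1' r a1 a2)
  have hL'len : L'.length ≤ N := by rw [fL, ← hlen]; exact List.length_filter_le _ _
  have ok9 : doneB.ok M.hv V s8 := by
    simp [doneB, Blk.ok, Blk.exec, State.setReg, State.setMem, Function.update_apply,
      f1' 5 (by decide) (by decide), f1' 10 (by decide) (by decide), f1' 4 (by decide) (by decide),
      f1' 12 (by decide) (by decide), f1' 9 (by decide) (by decide), f17, q5, p10, q4, p12, q9, ← hz]
    omega
  have run9 := Blk.run M V _ _ ok9
  obtain ⟨d1, d5, d7, d6, d9, dm⟩ := doneB_exec (H := M.hv) (s := s8)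
  set s9 := doneB.exec M.hv s8 with hs9
  have dm' : ∀ a, a < X → s9.mem a = s6.mem a := fun a ha => by rw [dm, fm a ha, ym]
  have hRec : Record k h n g d (adr k h n g l) l s9.mem :=
    ⟨by rw [dm' _ (by omega)]; exact xP, Groups.congr hg wG fun a _ h2 => dm' a (by rw [← hB, ← hz] at h2; omega)⟩
  have hL'n : L'.Nodup := fL ▸ hLn.filter _
  have halive : alive k h n (l + 1) = bump k c A := by rw [alive, if_neg hact]
  have hL'A : L'.toFinset = alive k h n (l + 1) := by
    rw [halive, fL, List.toFinset_filter, hLA]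
    simp [bump, thrAt, hc, hA]
  have hL'card : L'.length = (alive k h n (l + 1)).card := by
    rw [← hL'A, List.toFinset_card_of_nodup hL'n]
  refine ⟨s9, (run1.seq (run2.seq (run3.seq (run4.seq (run5.seq (run6.seq (run7.seq
    (run8.seq run9)))))))).mono ?_, ?_⟩
  · have e1 : prepB.cost = 26 := rfl
    have e3 : (Blk.set 13 (.c 0)).cost = 2 := rfl
    have e5 : prepScanB.cost = 13 := rfl
    have e7 : prepFiltB.cost = 4 := rfl
    have e9 : doneB.cost = 24 := rfl
    rw [e1, e3, e5, e7, e9]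
    have hN1 : 1 ≤ N := by omega
    have : 26 + (m + 1) * 20 + 2 + (N + 1) * 40 + 13 + (m + 1) * 120 + 4 + (N + 1) * 60 + 24 ≤
        2000 * N := by omega
    calc _ = (26 + (m + 1) * 20 + 2 + (N + 1) * 40 + 13 + (m + 1) * 120 + 4 + (N + 1) * 60 + 24) *
          unit M V := by ring
      _ ≤ _ := Nat.mul_le_mul_right _ this
  · have hY5 : Y = X + N + (4 * n + 4) := rfl
    refine ⟨?_, ?_, ?_, ?_, ?_, ?_, ?_, ?_, ⟨L', hL'n, hL'A, ?_⟩, ?_, ?_, ?_⟩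
    · rw [d1 0 (by decide) (by decide) (by decide) (by decide), f1' 0 (by decide) (by decide), q0]
    · rw [d1 1 (by decide) (by decide) (by decide) (by decide), f1' 1 (by decide) (by decide), q1]
    · rw [d1 3 (by decide) (by decide) (by decide) (by decide), f1' 3 (by decide) (by decide), q3]
    · rw [d1 4 (by decide) (by decide) (by decide) (by decide), f1' 4 (by decide) (by decide), q4]
    · rw [d5, f1' 5 (by decide) (by decide), f1' 10 (by decide) (by decide),
        f1' 4 (by decide) (by decide), q5, q4, p10]; rfl
    · rw [d7, f1' 12 (by decide) (by decide), p12, f17, ← hL'card]; omega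
    · rw [d1 8 (by decide) (by decide) (by decide) (by decide),
        f1 8 (by decide) (by decide) (by decide) (by decide), y1 8 (by decide) (by decide), w8, base,
        if_neg hact, add_assoc]; rfl
    · rw [d9, f1' 9 (by decide) (by decide), q9]
    · rw [dm, d6, f17]; exact fl
    · rw [d6, f17, hadr]; omega
    · rw [d6, f17]
      have hu := hI.upper
      rw [← hX] at hu
      have : (l + 1) * (5 * n + 4) = l * (5 * n + 4) + (5 * n + 4) := by ring
      omega
    · exact Stored.succ hk hb hg hd hdw hw hact hI.stored
        (fun a ha => by rw [dm' a (by omega), xm' a ha]) hRec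

end RAM


/-! ## The construction program -/


namespace RAM

open Ex (v ld)
open Rounds Pack Fill

/-- Halve register `10` and count in register `r`. -/
def sizeB (r : ℕ) : Blk := .sq (.set 10 (v 10 / .c 2)) (.set r (v r + .c 1))

/-- Write an entry of the table of digit sums. -/
def tableB : Blk :=
  .sq (.put (.c 4 + v 13) (ld (.c 4 + v 13 / .c 2) + v 13 % .c 2)) (.set 13 (v 13 + .c 1))

/-- Write an entry of the list of the keys. -/
def listB : Blk := .sq (.put (v 6 + v 13) (v 13)) (.set 13 (v 13 + .c 1))

/-- Write the parameters. -/
def paramB : Blk :=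
  .sq (.set 4 (v 11 / v 3)) <| .sq (.set 10 (.bin .shl (.c 1) (v 4))) <|
  .sq (.put (.c 0) (v 1)) <| .sq (.put (.c 1) (v 4)) <| .sq (.put (.c 2) (v 3)) <|
  .sq (.put (.c 3) (v 10)) (.set 13 (.c 1))

/-- Prepare the list of the keys. -/
def prepListB : Blk :=
  .sq (.set 5 (.c 4 + v 10)) <| .sq (.set 6 (v 5 + (.c 8 * v 0 + .c 8))) <|
  .sq (.set 7 (v 0)) <| .sq (.set 8 (.c 1)) <| .sq (.set 9 (.c 0)) (.set 13 (.c 0))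

/-- Everything before the first round. -/
def setupP : Prog :=
  .seq (Blk.set 10 (v 0 + v 1)).comp <| .seq (whl (v 10) (sizeB 11).comp) <|
  .seq (Blk.set 10 (.c 2 * v 1)).comp <| .seq (whl (v 10) (sizeB 3).comp) <|
  .seq paramB.comp <| .seq (whl (.bin .lt (v 13) (v 10)) tableB.comp) <|
  .seq prepListB.comp (whl (.bin .lt (v 13) (v 0)) listB.comp)

/-- Write the end marker. -/
def endB : Blk :=
  .sq (.put (v 5) (.c 0)) <| .sq (.put (v 5 + .c 1) (v 8)) (.set 0 (v 5 + .c 2))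

/-- The condition that there are enough keys for another round. -/
def moreE : Ex := .bin .eq (.bin .lt (v 7) (v 1)) (.c 0)

/-- The construction program. -/
def buildP : Prog :=
  cnd (.bin .lt (v 0) (v 1)) (Blk.set 0 (.c 0)).comp <|
  .seq setupP <| .seq (whl moreE roundP) endB.comp

variable {U : Type*} {M : Env U} {V : ℕ} {k n : ℕ} {h : ℕ → ℕ → ℕ → ℕ}

/-- The bit length of x is the number of halvings until 0 is reached. -/
theorem size_run {σ : State} {r x : ℕ} (hr : r < 20) (hr0 : r ≠ 10) (h10 : σ.reg 10 = x)
    (hσ : σ.reg r = 0) (hV : x + 2 ≤ V) :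
    ∃ σ', RunT M (whl (v 10) (sizeB r).comp) σ σ' ((x + 1) * (12 * unit M V)) ∧
      σ'.reg r = x.size ∧ (∀ q, q ≠ r → q ≠ 10 → σ'.reg q = σ.reg q) ∧ σ'.mem = σ.mem := by
  have hx : x.size ≤ x := Nat.size_le.2 Nat.lt_two_pow_self
  obtain ⟨σ', hrun, h1, h2, h3, h4⟩ := RunT.whl_count (M := M) (V := V) (b := sizeB r)
    (e := v 10) x.size (fun i s => s.reg r = i ∧ s.reg 10 = x / 2 ^ i ∧
      (∀ q, q ≠ r → q ≠ 10 → s.reg q = σ.reg q) ∧ s.mem = σ.mem)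
    (by
      rintro i hi s ⟨h1, h2, h3, h4⟩
      have hd : x / 2 ^ i ≤ x := Nat.div_le_self _ _
      have h0 : 0 < x / 2 ^ i := Nat.div_pos (Nat.lt_size.1 hi) (by positivity)
      obtain ⟨y, hy⟩ : ∃ y, y = x / 2 ^ i := ⟨_, rfl⟩
      have hs : x / 2 ^ (i + 1) = y / 2 := by rw [pow_succ, ← Nat.div_div_eq_div_mul, hy]
      rw [← hy] at h2 hd h0
      refine ⟨?_, ?_, ?_, ?_, ?_, ?_, ?_⟩
      · simp [h2]; omega
      · simp [h2]; omega
      · simp [sizeB, Blk.ok, Blk.exec, State.setReg, h1, h2, hr, hr0, Function.update_apply]; omega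
      · simp [sizeB, Blk.exec, State.setReg, h1, h2, hr0]
      · simp [sizeB, Blk.exec, State.setReg, h1, h2, hr0, hr0.symm, hs]
      · intro q a1 a2
        simp [sizeB, Blk.exec, State.setReg, a1, a2, h3]
      · exact h4)
    (by
      rintro s ⟨h1, h2, -⟩
      have : x / 2 ^ x.size = 0 := Nat.div_eq_of_lt (Nat.lt_size_self x)
      simp [h2, this]) σ ⟨hσ, by simpa using h10, fun _ _ _ => rfl, rfl⟩
  exact ⟨σ', hrun.mono (Nat.mul_le_mul (by omega) (Nat.mul_le_mul_right _
    (show 1 + 1 + (sizeB r).cost ≤ 12 from (by decide : (2 + (4 + 4) : ℕ) ≤ 12)))), h1, h3, h4⟩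

theorem popc_le (y : ℕ) : popc y ≤ y := by
  induction y using Nat.strong_induction_on with
  | _ y ih =>
    rcases Nat.eq_zero_or_pos y with rfl | hy
    · rw [popc_zero]
    · rw [popc_step]
      have := ih (y / 2) (by omega)
      omega

/-- Entry y is obtained from entry y / 2, which is already there. Entry 0 is the initial content 0
of cell 4. -/
theorem table_run {σ : State} {G : ℕ} (hG : 1 ≤ G) (h10 : σ.reg 10 = G) (h13 : σ.reg 13 = 1)
    (h4 : σ.mem 4 = 0) (hV : G + 10 ≤ V) :
    ∃ σ', RunT M (whl (.bin .lt (v 13) (v 10)) tableB.comp) σ σ' (G * (24 * unit M V)) ∧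
      (∀ q, q ≠ 13 → σ'.reg q = σ.reg q) ∧ (∀ y < G, σ'.mem (4 + y) = popc y) ∧
      (∀ a, a < 4 → σ'.mem a = σ.mem a) := by
  obtain ⟨σ', hrun, h1, h2, h3, h4⟩ := RunT.whl_count (M := M) (V := V) (b := tableB)
    (e := .bin .lt (v 13) (v 10)) (G - 1) (fun i s => s.reg 13 = i + 1 ∧
      (∀ q, q ≠ 13 → s.reg q = σ.reg q) ∧ (∀ y ≤ i, s.mem (4 + y) = popc y) ∧
      (∀ a, a < 4 → s.mem a = σ.mem a))
    (by
      rintro i hi s ⟨h1, h2, h3, h4⟩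
      have e10 := (h2 10 (by decide)).trans h10
      have h5 := popc_step (i + 1)
      have h6 := popc_le (i + 1)
      have h7 := h3 ((i + 1) / 2) (by omega)
      rw [← h7] at h5
      refine ⟨?_, ?_, ?_, ?_, ?_, ?_, ?_⟩
      · simp [h1, e10]; split_ifs <;> omega
      · simp [h1, e10]; omega
      · simp [tableB, Blk.ok, Blk.exec, State.setMem, h1, e10]; omega
      · simp [tableB, Blk.exec, State.setReg, State.setMem, h1]
      · intro q hq
        simp [tableB, Blk.exec, State.setReg, State.setMem, hq, h2]
      · intro y hy
        simp only [tableB, Blk.exec, State.setReg, State.setMem, Function.update_apply, h1,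
          Ex.eval_add, Ex.eval_v, Ex.eval_c, Ex.eval_ld, Ex.eval_div, Ex.eval_mod]
        split_ifs with hc
        · rw [show y = i + 1 by omega]; exact h5.symm
        · exact h3 y (by omega)
      · intro a ha
        simp only [tableB, Blk.exec, State.setReg, State.setMem, Function.update_apply, h1,
          Ex.eval_add, Ex.eval_v, Ex.eval_c, Ex.eval_ld, Ex.eval_div, Ex.eval_mod]
        rw [if_neg (by omega)]
        exact h4 a ha)
    (by
      rintro s ⟨h1, h2, -⟩
      have e10 := (h2 10 (by decide)).trans h10
      simp [h1, e10]; split_ifs <;> omega) σ ⟨by simpa using h13, fun _ _ => rfl, by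
        intro y hy
        rw [Nat.le_zero.1 hy, popc_zero]; exact h4, fun _ _ => rfl⟩
  exact ⟨σ', hrun.mono (Nat.mul_le_mul (by omega) (Nat.mul_le_mul_right _ (by decide))), h2,
    fun y hy => h3 y (by omega), h4⟩

theorem list_run {σ : State} {X : ℕ} (h0 : σ.reg 0 = n) (h6 : σ.reg 6 = X) (h13 : σ.reg 13 = 0)
    (hV : X + n + 1 ≤ V) :
    ∃ σ', RunT M (whl (.bin .lt (v 13) (v 0)) listB.comp) σ σ' ((n + 1) * (20 * unit M V)) ∧
      (∀ q, q ≠ 13 → σ'.reg q = σ.reg q) ∧ (∀ i < n, σ'.mem (X + i) = i) ∧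
      (∀ a, a < X → σ'.mem a = σ.mem a) := by
  obtain ⟨σ', hrun, h1, h2, h3, h4⟩ := RunT.whl_count (M := M) (V := V) (b := listB)
    (e := .bin .lt (v 13) (v 0)) n (fun i s => s.reg 13 = i ∧
      (∀ q, q ≠ 13 → s.reg q = σ.reg q) ∧ (∀ j < i, s.mem (X + j) = j) ∧
      (∀ a, a < X → s.mem a = σ.mem a))
    (by
      rintro i hi s ⟨h1, h2, h3, h4⟩
      have e0 := (h2 0 (by decide)).trans h0
      have e6 := (h2 6 (by decide)).trans h6
      refine ⟨?_, ?_, ?_, ?_, ?_, ?_, ?_⟩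
      · simp [h1, e0, hi]; omega
      · simp [h1, e0, hi]
      · simp [listB, Blk.ok, Blk.exec, State.setMem, h1, e6]; omega
      · simp [listB, Blk.exec, State.setReg, State.setMem, h1]
      · intro q hq
        simp [listB, Blk.exec, State.setReg, State.setMem, hq, h2]
      · intro y hy
        simp only [listB, Blk.exec, State.setReg, State.setMem, Function.update_apply, h1, e6,
          Ex.eval_add, Ex.eval_v, Ex.eval_c]
        split_ifs with hc
        · omega
        · exact h3 y (by omega)
      · intro a ha
        simp only [listB, Blk.exec, State.setReg, State.setMem, Function.update_apply, h1, e6,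
          Ex.eval_add, Ex.eval_v, Ex.eval_c]
        rw [if_neg (by omega)]
        exact h4 a ha)
    (by
      rintro s ⟨h1, h2, -⟩
      have e0 := (h2 0 (by decide)).trans h0
      simp [h1, e0]; omega) σ ⟨h13, fun _ _ => rfl, by simp, fun _ _ => rfl⟩
  exact ⟨σ', hrun.mono (Nat.mul_le_mul (by omega) (Nat.mul_le_mul_right _ (by decide))), h2, h3,
    h4⟩

theorem paramB_exec {H : ℕ → ℕ → ℕ → ℕ} {s : State} :
    let s' := paramB.exec H s
    let g := s.reg 11 / s.reg 3
    (∀ r, r ≠ 4 → r ≠ 10 → r ≠ 13 → s'.reg r = s.reg r) ∧ s'.reg 4 = g ∧ s'.reg 10 = 2 ^ g ∧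
    s'.reg 13 = 1 ∧ s'.mem 0 = s.reg 1 ∧ s'.mem 1 = g ∧ s'.mem 2 = s.reg 3 ∧ s'.mem 3 = 2 ^ g ∧
    (∀ a, 4 ≤ a → s'.mem a = s.mem a) := by
  intro s' g
  refine ⟨fun r a1 a2 a3 => ?_, ?_, ?_, ?_, ?_, ?_, ?_, ?_, fun a ha => ?_⟩
  · simp [s', paramB, Blk.exec, State.setReg, State.setMem, Function.update_apply, *]
  on_goal 8 =>
    have b0 : a ≠ 0 := by omega
    have b1 : a ≠ 1 := by omega
    have b2 : a ≠ 2 := by omega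
    have b3 : a ≠ 3 := by omega
    simp [s', paramB, Blk.exec, State.setReg, State.setMem, Function.update_apply, *]
  all_goals simp [s', g, paramB, Blk.exec, State.setReg, State.setMem, Function.update_apply]

theorem prepListB_exec {H : ℕ → ℕ → ℕ → ℕ} {s : State} :
    let s' := prepListB.exec H s
    (∀ r, r < 5 → s'.reg r = s.reg r) ∧ s'.reg 5 = 4 + s.reg 10 ∧
    s'.reg 6 = 4 + s.reg 10 + (8 * s.reg 0 + 8) ∧
    s'.reg 7 = s.reg 0 ∧ s'.reg 8 = 1 ∧ s'.reg 9 = 0 ∧ s'.reg 13 = 0 ∧ s'.mem = s.mem := by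
  intro s'
  refine ⟨fun r a1 => ?_, ?_, ?_, ?_, ?_, ?_, ?_, ?_⟩
  · interval_cases r <;>
      simp [s', prepListB, Blk.exec, State.setReg, Function.update_apply]
  all_goals simp [s', prepListB, Blk.exec, State.setReg, Function.update_apply]

/-- Facts on the parameters. -/
theorem params (hk : 1 ≤ k) (hkn : k ≤ n) :
    let d := (2 * k).size
    let w := (n + k).size
    let g := w / d
    2 ≤ d ∧ 1 ≤ g ∧ g < w ∧ d ≤ w ∧ 2 * k < 2 ^ d ∧ n + k < 2 ^ w ∧ d * g ≤ w ∧
      2 ^ w ≤ 2 * (n + k) ∧ w ≤ n + k := by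
  intro d w g
  have hd : 2 ≤ d := by
    exact Nat.lt_size.2 (show 2 ^ 1 ≤ 2 * k by omega)
  have hdw : d ≤ w := Nat.size_le_size (by omega)
  have hg : 1 ≤ g := Nat.div_pos hdw (by omega)
  have hgd : d * g ≤ w := Nat.mul_div_le _ _
  refine ⟨hd, hg, ?_, hdw, Nat.lt_size_self _, Nat.lt_size_self _, hgd, ?_,
    Nat.size_le.2 Nat.lt_two_pow_self⟩
  · nlinarith
  · have h1 : 2 ^ (w - 1) ≤ n + k := Nat.lt_size.1 (show w - 1 < (n + k).size by omega)
    have h2 : 2 ^ w = 2 * 2 ^ (w - 1) := by rw [← pow_succ']; congr 1; omega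
    omega

theorem setup_run (hk : 1 ≤ k) (hkn : k ≤ n) (hV : 256 * n ≤ V) :
    ∃ σ', RunT M setupP (buildInit n k) σ' (300 * n * unit M V) ∧
      RoundInv k h n ((n + k).size / (2 * k).size) (2 * k).size (n + k).size 0 σ' := by
  obtain ⟨hd, hg, hgw, hdw, hd2, hw2, hdg, hwn, hwle⟩ := params hk hkn
  set d := (2 * k).size
  set w := (n + k).size
  have hgg : 2 ^ (w / d) < 2 ^ w := Nat.pow_lt_pow_right (by norm_num) hgw
  obtain ⟨g, hgdef⟩ : ∃ g, g = w / d := ⟨_, rfl⟩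
  rw [← hgdef] at hg hgw hdg hgg ⊢
  have hg0 : g < 2 ^ g := Nat.lt_two_pow_self
  have ok1 : (Blk.set 10 (v 0 + v 1)).ok M.hv V (buildInit n k) := by
    simp [Blk.ok, buildInit]; omega
  obtain ⟨s2, run2, a11, ar, am⟩ := size_run (M := M) (V := V) (r := 11) (x := n + k)
    (σ := (Blk.set 10 (v 0 + v 1)).exec M.hv (buildInit n k)) (by decide) (by decide)
    (by simp [Blk.exec, State.setReg, buildInit]) (by simp [Blk.exec, State.setReg, buildInit])
    (by omega)
  have b0 : s2.reg 0 = n := (ar 0 (by decide) (by decide)).trans rfl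
  have b1 : s2.reg 1 = k := (ar 1 (by decide) (by decide)).trans rfl
  have b3 : s2.reg 3 = 0 := (ar 3 (by decide) (by decide)).trans rfl
  have ok3 : (Blk.set 10 (.c 2 * v 1)).ok M.hv V s2 := by
    simp [Blk.ok, b1]; omega
  obtain ⟨s4, run4, c3, cr, cm⟩ := size_run (M := M) (V := V) (r := 3) (x := 2 * k)
    (σ := (Blk.set 10 (.c 2 * v 1)).exec M.hv s2) (by decide) (by decide)
    (by simp [Blk.exec, State.setReg, b1]) (by simp [Blk.exec, State.setReg, b3])
    (by omega)
  have c0 : s4.reg 0 = n := (cr 0 (by decide) (by decide)).trans b0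
  have c1 : s4.reg 1 = k := (cr 1 (by decide) (by decide)).trans b1
  have c11 : s4.reg 11 = w := (cr 11 (by decide) (by decide)).trans a11
  have cm' : s4.mem = fun _ => 0 := cm.trans am
  have ok5 : paramB.ok M.hv V s4 := by
    simp [paramB, Blk.ok, Blk.exec, State.setReg, State.setMem, Function.update_apply, c1, c3, c11]
    rw [← hgdef]
    omega
  obtain ⟨dr, d4, d10, d13, dm0, dm1, dm2, dm3, dm⟩ := paramB_exec (H := M.hv) (s := s4)
  rw [c11, c3, ← hgdef] at d4 d10 dm1 dm3
  rw [c1] at dm0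
  rw [c3] at dm2
  obtain ⟨s6, run6, er, et, em⟩ := table_run (M := M) (V := V) (G := 2 ^ g) Nat.one_le_two_pow d10
    d13 (by rw [dm 4 le_rfl, cm']) (by omega)
  have e0 : s6.reg 0 = n := (er 0 (by decide)).trans ((dr 0 (by decide) (by decide) (by decide)).trans c0)
  have e1 : s6.reg 1 = k := (er 1 (by decide)).trans ((dr 1 (by decide) (by decide) (by decide)).trans c1)
  have e3 : s6.reg 3 = d := (er 3 (by decide)).trans ((dr 3 (by decide) (by decide) (by decide)).trans c3)
  have e4 : s6.reg 4 = g := (er 4 (by decide)).trans d4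
  have e10 : s6.reg 10 = 2 ^ g := (er 10 (by decide)).trans d10
  have ok7 : prepListB.ok M.hv V s6 := by
    simp [prepListB, Blk.ok, Blk.exec, State.setReg, State.setMem, Function.update_apply, e0, e10]
    omega
  obtain ⟨fr, f5, f6, f7, f8, f9, f13, fm⟩ := prepListB_exec (H := M.hv) (s := s6)
  rw [e10] at f5 f6
  rw [e0] at f6 f7
  obtain ⟨s8, run8, gr, gl, gm⟩ := list_run (M := M) (V := V) (n := n)
    ((fr 0 (by decide)).trans e0) f6 f13 (by omega)
  refine ⟨s8, ((Blk.run M V _ _ ok1).seq (run2.seq ((Blk.run M V _ _ ok3).seq (run4.seq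
    ((Blk.run M V _ _ ok5).seq (run6.seq ((Blk.run M V _ _ ok7).seq run8))))))).mono ?_, ?_⟩
  · have x1 : (Blk.set 10 (v 0 + v 1)).cost ≤ 10 := by decide
    have x3 : (Blk.set 10 (.c 2 * v 1)).cost ≤ 10 := by decide
    have x5 : paramB.cost ≤ 30 := by decide
    have x7 : prepListB.cost ≤ 30 := by decide
    have : (Blk.set 10 (v 0 + v 1)).cost + ((n + k + 1) * 12 + ((Blk.set 10 (.c 2 * v 1)).cost +
        ((2 * k + 1) * 12 + (paramB.cost + (2 ^ g * 24 + (prepListB.cost + (n + 1) * 20)))))) ≤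
        300 * n := by omega
    calc _ = ((Blk.set 10 (v 0 + v 1)).cost + ((n + k + 1) * 12 + ((Blk.set 10 (.c 2 * v 1)).cost +
        ((2 * k + 1) * 12 + (paramB.cost + (2 ^ g * 24 + (prepListB.cost + (n + 1) * 20))))))) *
          unit M V := by ring
      _ ≤ _ := Nat.mul_le_mul_right _ this
  · have hadr : adr k h n g 0 = 4 + 2 ^ g := rfl
    have hm : ∀ a, a < 4 + 2 ^ g → s8.mem a = s6.mem a := fun a ha => by
      rw [gm a (by omega), fm]
    have m0 : s8.mem 0 = k := by rw [hm _ (by omega), em _ (by omega), dm0]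
    have m1 : s8.mem 1 = g := by rw [hm _ (by omega), em _ (by omega), dm1]
    have m2 : s8.mem 2 = d := by rw [hm _ (by omega), em _ (by omega), dm2]
    have m3 : s8.mem 3 = 2 ^ g := by rw [hm _ (by omega), em _ (by omega), dm3]
    have mt : ∀ y < 2 ^ g, s8.mem (4 + y) = popc y := fun y hy => by
      rw [hm _ (by omega), et y hy]
    refine ⟨?_, ?_, ?_, ?_, ?_, ?_, ?_, ?_, ⟨List.range n, List.nodup_range, ?_, ?_⟩, ?_, ?_,
      ⟨m0, m1, m2, m3, mt, by simp, ?_⟩⟩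
    · rw [gr 0 (by decide), fr 0 (by decide), e0]
    · rw [gr 1 (by decide), fr 1 (by decide), e1]
    · rw [gr 3 (by decide), fr 3 (by decide), e3]
    · rw [gr 4 (by decide), fr 4 (by decide), e4]
    · rw [gr 5 (by decide), f5, hadr]
    · rw [gr 7 (by decide), f7, alive, Finset.card_range]
    · rw [gr 8 (by decide), f8, base]
    · rw [gr 9 (by decide), f9]
    · rw [alive]; ext; simp
    · intro i hi
      rw [List.length_range] at hi
      rw [gr 6 (by decide), f6, gl i hi, List.getElem_range]
    · rw [gr 6 (by decide), f6, hadr]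
    · rw [gr 6 (by decide), f6]; omega
    · intro a ha
      rw [hadr] at ha
      rcases Nat.lt_or_ge a 4 with h4 | h4
      · have hdd : d < 2 ^ d := Nat.lt_two_pow_self
        have hdw' : 2 ^ d ≤ 2 ^ w := Nat.pow_le_pow_right (by norm_num) hdw
        interval_cases a
        · rw [m0]; omega
        · rw [m1]; omega
        · rw [m2]; omega
        · rw [m3]; omega
      · obtain ⟨y, rfl⟩ := Nat.exists_eq_add_of_le h4
        rw [mt y (by omega)]
        have := popc_le y
        omega

/-- 256n(l + 1) has at most 8 + w + (l + 1) bits. A bound linear in l is crude but suffices, because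
the probability of reaching round l decays geometrically. -/
theorem words_le {l : ℕ} (hM : M.w = (n + k).size) (hn : 1 ≤ n) :
    M.words (256 * n * (l + 1)) ≤ l + 11 := by
  have hw : 0 < (n + k).size := Nat.size_pos.2 (by omega)
  have h1 : (256 * n * (l + 1)).size ≤ 8 + (n + k).size + (l + 1) := by
    rw [Nat.size_le, pow_add, pow_add]
    have a1 : n < 2 ^ (n + k).size := lt_of_le_of_lt (by omega) (Nat.lt_size_self (n + k))
    have a2 : l + 1 < 2 ^ (l + 1) := Nat.lt_two_pow_self
    have a3 : 256 * n ≤ 2 ^ 8 * 2 ^ (n + k).size := by norm_num; omega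
    exact Nat.mul_lt_mul_of_le_of_lt a3 a2 (by positivity)
  rw [Env.words, hM]
  have h2 : (256 * n * (l + 1)).size / (n + k).size ≤ l + 10 := by
    rw [Nat.div_le_iff_le_mul_add_pred hw]
    have : (l + 9) * 1 ≤ (l + 9) * (n + k).size := Nat.mul_le_mul_left _ hw
    nlinarith
  omega

theorem unit_le {l : ℕ} (hM : M.w = (n + k).size) (hn : 1 ≤ n) :
    unit M (256 * n * (l + 1)) ≤ 1089 * (l + 1) ^ 2 := by
  have := words_le (l := l) hM hn
  unfold unit
  have h2 : 3 * M.words (256 * n * (l + 1)) ≤ 33 * (l + 1) := by omega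
  calc _ ≤ (33 * (l + 1)) ^ 2 := Nat.pow_le_pow_left h2 2
    _ = _ := by ring

/-- All numbers in round l are at most 256n(l + 1), because the working area advances by at most 5n
+ 4 per round. By `unit_le` an instruction then costs at most 1089 (l + 1)². -/
theorem rounds_run {T : ℕ} (hk : 1 ≤ k) (hkn : k ≤ n) (hb : ∀ j s m, h j s m ≤ m)
    (hM : M.hv = h) (hw : M.w = (n + k).size) (hT : (alive k h n T).card < k)
    (hlt : ∀ i < T, k ≤ (alive k h n i).card) :
    ∀ j l σ, l + j = T →
      RoundInv k h n ((n + k).size / (2 * k).size) (2 * k).size (n + k).size l σ →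
      ∃ σ', RunT M (whl moreE roundP) σ σ' ((∑ i ∈ Finset.Ico l T,
          2010 * 1089 * ((i + 1) ^ 2 * (alive k h n i).card)) + 10 * 1089 * (T + 1) ^ 2) ∧
        RoundInv k h n ((n + k).size / (2 * k).size) (2 * k).size (n + k).size T σ' := by
  obtain ⟨hd, hg, hgw, hdw, hd2, hw2, hdg, hwn, hwle⟩ := params hk hkn
  set d := (2 * k).size
  set w := (n + k).size with hwdef
  have hgg : 2 ^ (w / d) < 2 ^ w := Nat.pow_lt_pow_right (by norm_num) hgw
  obtain ⟨g, hgdef⟩ : ∃ g, g = w / d := ⟨_, rfl⟩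
  rw [← hgdef] at hg hgw hdg hgg ⊢
  have hok : ∀ l σ, RoundInv k h n g d w l σ → moreE.ok (256 * n * (l + 1)) σ := by
    intro l σ hσ
    have h1 : (alive k h n l).card ≤ n := by
      have := card_alive_add (n := n) hk hb l; omega
    have h2 : 256 * n ≤ 256 * n * (l + 1) := Nat.le_mul_of_pos_right _ (by omega)
    simp [moreE, hσ.r7, hσ.r1]
    split_ifs <;> omega
  intro j
  induction j with
  | zero =>
    rintro l σ rfl hσ
    refine ⟨σ, (RunT.whl_false (hok _ _ hσ) ?_).mono ?_, hσ⟩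
    · simp only [add_zero] at hT
      simp [moreE, hσ.r7, hσ.r1, hT]
    · have := unit_le (l := l) hw (hk.trans hkn)
      have hc : moreE.cost + 1 ≤ 10 := by decide
      calc _ ≤ 10 * (1089 * (l + 1) ^ 2) := Nat.mul_le_mul hc this
        _ ≤ _ := by simp; ring_nf; rfl
  | succ j ih =>
    intro l σ hl hσ
    have hact := hlt l (by omega)
    have hV : σ.reg 6 + 40 * n + d + g + l + 100 ≤ 256 * n * (l + 1) := by
      have := hσ.upper
      have e1 : 256 * n * (l + 1) = 256 * (l * n) + 256 * n := by ring
      have e2 : l * (5 * n + 4) = 5 * (l * n) + 4 * l := by ring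
      have e3 : l ≤ l * n := Nat.le_mul_of_pos_right _ (by omega)
      omega
    have h2 : 256 * n ≤ 256 * n * (l + 1) := Nat.le_mul_of_pos_right _ (by omega)
    obtain ⟨σ₁, run1, h1⟩ := round_run (V := 256 * n * (l + 1)) hk hkn hb hg hd2 hdg hw2
      (not_lt.2 hact) hM hσ hV (by omega) (by omega)
    obtain ⟨σ', run, h'⟩ := ih (l + 1) σ₁ (by omega) h1
    refine ⟨σ', (RunT.whl_true (hok _ _ hσ) ?_ run1 run).mono ?_, h'⟩
    · simp [moreE, hσ.r7, hσ.r1, hact]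
    · rw [Finset.sum_eq_sum_Ico_succ_bot (by omega : l < T)]
      have hu := unit_le (l := l) hw (hk.trans hkn)
      have hc : moreE.cost + 1 ≤ 10 := by decide
      have hN : 1 ≤ (alive k h n l).card := hk.trans hact
      have : (moreE.cost + 1) * unit M (256 * n * (l + 1)) +
          2000 * (alive k h n l).card * unit M (256 * n * (l + 1)) ≤
          2010 * 1089 * ((l + 1) ^ 2 * (alive k h n l).card) := by
        calc _ = (moreE.cost + 1 + 2000 * (alive k h n l).card) *
              unit M (256 * n * (l + 1)) := by ring
          _ ≤ (2010 * (alive k h n l).card) * (1089 * (l + 1) ^ 2) :=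
            Nat.mul_le_mul (by omega) hu
          _ = _ := by ring
      omega

/-- What the construction leaves in the memory, if `T` is the number of rounds. -/
structure Built (k : ℕ) (h : ℕ → ℕ → ℕ → ℕ) (n T : ℕ) (σ : State) : Prop where
  len : σ.reg 0 = adr k h n ((n + k).size / (2 * k).size) T + 2
  stored : Stored k h n ((n + k).size / (2 * k).size) (2 * k).size (n + k).size T σ.mem
  finish : σ.mem (adr k h n ((n + k).size / (2 * k).size) T) = 0
  last : σ.mem (adr k h n ((n + k).size / (2 * k).size) T + 1) = 1 + base k h n T

theorem build_run {T : ℕ} (hk : 1 ≤ k) (hkn : k ≤ n) (hb : ∀ j s m, h j s m ≤ m)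
    (hM : M.hv = h) (hw : M.w = (n + k).size) (hT : (alive k h n T).card < k)
    (hlt : ∀ i < T, k ≤ (alive k h n i).card) :
    ∃ σ t, Exec M buildP (buildInit n k) σ t ∧ Built k h n T σ ∧
      t ≤ 10 ^ 6 * n + 10 ^ 7 * ∑ i ∈ Finset.range T, (i + 1) ^ 2 * (alive k h n i).card := by
  have hn : 1 ≤ n := hk.trans hkn
  obtain ⟨s1, run1, h1⟩ := setup_run (M := M) (h := h) (V := 256 * n * (0 + 1)) hk hkn (by simp)
  obtain ⟨s2, run2, h2⟩ := rounds_run hk hkn hb hM hw hT hlt T 0 s1 (by simp) h1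
  obtain ⟨hd, hg, hgw, hdw, hd2, hw2, hdg, hwn, hwle⟩ := params hk hkn
  set d := (2 * k).size with hddef
  set w := (n + k).size with hwdef
  have hgg : 2 ^ (w / d) < 2 ^ w := Nat.pow_lt_pow_right (by norm_num) hgw
  obtain ⟨g, hgdef⟩ : ∃ g, g = w / d := ⟨_, rfl⟩
  rw [← hgdef] at hg hgw hdg hgg h1 h2
  have hbase := base_le (n := n) hk hb T
  have hadr : adr k h n g T + 20 ≤ 256 * n * (T + 1) := by
    have u1 := h2.upper
    have u2 := h2.lower
    have e1 : 256 * n * (T + 1) = 256 * (T * n) + 256 * n := by ring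
    have e2 : T * (5 * n + 4) = 5 * (T * n) + 4 * T := by ring
    have e3 : T ≤ T * n := Nat.le_mul_of_pos_right _ (by omega)
    omega
  have h256 : 256 * n ≤ 256 * n * (T + 1) := Nat.le_mul_of_pos_right _ (by omega)
  have ok3 : endB.ok M.hv (256 * n * (T + 1)) s2 := by
    simp [endB, Blk.ok, Blk.exec, State.setReg, State.setMem, Function.update_apply, h2.r5, h2.r8]
    omega
  have okc : (Ex.bin .lt (v 0) (v 1)).ok (256 * n * (0 + 1)) (buildInit n k) := by
    simp [buildInit]
    split_ifs <;> omega
  have run := RunT.cnd_false (p := (Blk.set 0 (.c 0)).comp) okc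
    (by simp [buildInit]; omega)
    (run1.seq (run2.seq (Blk.run M (256 * n * (T + 1)) endB s2 ok3)))
  obtain ⟨σ, t, hex, hag, ht⟩ := run _ (Agree.refl _)
  have hmem : ∀ a, a ≠ adr k h n g T → a ≠ adr k h n g T + 1 → σ.mem a = s2.mem a := by
    intro a a1 a2
    rw [hag.2]
    simp [endB, Blk.exec, State.setReg, State.setMem, Function.update_apply, h2.r5, h2.r8, a1, a2]
  have hlow := h2.lower
  refine ⟨σ, t, hex, ?_, ht.trans ?_⟩
  · have hS : Stored k h n g d w T σ.mem := by
      have h0 : 4 + 2 ^ g ≤ adr k h n g T := adr_mono (Nat.zero_le T)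
      have hpos : 0 < 2 ^ g := by positivity
      have hS := h2.stored
      refine ⟨(hmem 0 (by omega) (by omega)).trans hS.m0, (hmem 1 (by omega) (by omega)).trans hS.m1,
        (hmem 2 (by omega) (by omega)).trans hS.m2, (hmem 3 (by omega) (by omega)).trans hS.m3,
        fun y hy => (hmem _ (by omega) (by omega)).trans (hS.table y hy), fun i hi => ?_,
        fun a ha => ?_⟩
      · refine Record.congr hg (hS.recs i hi) fun a _ ha => ?_
        have : adr k h n g (i + 1) ≤ adr k h n g T := adr_mono hi
        exact hmem a (by omega) (by omega)
      · rw [hmem a (by omega) (by omega)]; exact hS.small a ha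
    refine ⟨?_, ?_, ?_, ?_⟩ <;> rw [← hddef, ← hwdef, ← hgdef]
    · rw [hag.1 0 (by decide)]
      simp [endB, Blk.exec, State.setReg, State.setMem, Function.update_apply, h2.r5]
    · exact hS
    · rw [hag.2]
      simp [endB, Blk.exec, State.setReg, State.setMem, Function.update_apply, h2.r5, h2.r8]
    · rw [hag.2]
      simp [endB, Blk.exec, State.setReg, State.setMem, Function.update_apply, h2.r5, h2.r8]
  · have hu0 := unit_le (l := 0) hw hn
    have huT := unit_le (l := T) hw hn
    have hc : (Ex.bin .lt (v 0) (v 1)).cost + 1 ≤ 10 := by decide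
    have hc' : endB.cost ≤ 20 := by decide
    have p1 := Nat.mul_le_mul hc hu0
    have p2 := Nat.mul_le_mul_left (300 * n) hu0
    have p3 := Nat.mul_le_mul hc' huT
    -- Writing the end marker is charged to round T - 1, which contributes at least T², and (T + 1)²
    -- ≤ 4T². Without any round it is charged to n ≥ 1.
    have p4 : (T + 1) ^ 2 ≤ n + 4 * ∑ i ∈ Finset.range T, (i + 1) ^ 2 * (alive k h n i).card := by
      rcases Nat.eq_zero_or_pos T with rfl | hT0
      · simp; omega
      · have := Finset.single_le_sum (f := fun i => (i + 1) ^ 2 * (alive k h n i).card)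
          (fun _ _ => Nat.zero_le _) (Finset.mem_range.2 (show T - 1 < T by omega))
        have h3 := hk.trans (hlt (T - 1) (by omega))
        have h4 : (T - 1 + 1) ^ 2 * 1 ≤ (T - 1 + 1) ^ 2 * (alive k h n (T - 1)).card :=
          Nat.mul_le_mul_left _ h3
        rw [Nat.sub_add_cancel hT0] at h4 this
        nlinarith
    rw [← Finset.mul_sum, ← Finset.range_eq_Ico]
    set W := ∑ i ∈ Finset.range T, (i + 1) ^ 2 * (alive k h n i).card
    simp only [zero_add, one_pow, mul_one] at p1 p2 ⊢
    omega

/-- An empty data structure is produced, since for n < k the admitted space may be less than one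
word. -/
theorem build_run_small (hkn : n < k) (hw : M.w = (n + k).size) :
    ∃ σ t, Exec M buildP (buildInit n k) σ t ∧ σ.reg 0 = 0 ∧ t ≤ 1000 := by
  have okc : (Ex.bin .lt (v 0) (v 1)).ok (n + k) (buildInit n k) := by
    simp [buildInit]
    split_ifs; omega
  have run := RunT.cnd_true (M := M) (q := .seq setupP <| .seq (whl moreE roundP) endB.comp) okc
    (by simp [buildInit]; omega)
    (Blk.run M (n + k) (Blk.set 0 (.c 0)) (buildInit n k) (by simp [Blk.ok]))
  obtain ⟨σ, t, hex, hag, ht⟩ := run _ (Agree.refl _)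
  refine ⟨σ, t, hex, (hag.1 0 (by decide)).trans (by simp [Blk.exec, State.setReg]), ht.trans ?_⟩
  have h1 : unit M (n + k) = 36 := by
    rw [unit, Env.words, hw, Nat.div_self (Nat.size_pos.2 (by omega))]; rfl
  rw [h1]; decide

end RAM


/-! ## The query program -/


namespace RAM

open Ex (v ld)
open Rounds Pack Fill

/-- Read the parameters and the beginning of the first record. -/
def openB : Blk :=
  .sq (.set 4 (ld (.c 1))) <| .sq (.set 3 (ld (.c 2))) <| .sq (.set 5 (.c 4 + ld (.c 3))) <|
  .sq (.set 9 (.c 0)) <| .sq (.set 7 (ld (v 5))) (.set 0 (ld (v 5 + .c 1)))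

/-- Find the cell of the key and the threshold of its block. -/
def locB : Blk :=
  .sq (.hsh 11 (.c 0) (v 9) (.c 2 * v 1 * v 7 - .c 1)) <|
  .sq (.set 12 (v 11 / (.c 2 * v 1))) <|
  .sq (.set 13 (v 5 + .c 1 + .c 3 * (v 12 / v 4))) <|
  .sq (.set 14 (v 12 % v 4))
  (.set 15 (.bin .shr (ld (v 13 + .c 2)) (v 3 * v 14) % .bin .shl (.c 1) (v 3)))

/-- Compute the bucket. -/
def takeB : Blk :=
  .sq (.set 0 (ld (v 13) + ld (.c 4 + ld (v 13 + .c 1) % .bin .shl (.c 1) (v 14))))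
    -- Register 7 is the loop condition, so the search ends here.
    (.set 7 (.c 0))

/-- Go to the next record. -/
def nextB : Blk :=
  .sq (.set 5 (v 5 + .c 1 + .c 3 * ((v 7 - .c 1) / v 4 + .c 1))) <|
  .sq (.set 9 (v 9 + .c 1)) <| .sq (.set 7 (ld (v 5))) (.set 0 (ld (v 5 + .c 1)))

/-- The condition that the key has got a bucket in the current round. -/
def hitE : Ex := .bin .lt (v 11 % (.c 2 * v 1)) (v 15)

/-- Look at one round. -/
def stepP : Prog := .seq locB.comp (cnd hitE takeB.comp nextB.comp)

/-- The query program. -/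
def queryP : Prog :=
  .seq (Blk.set 1 (ld (.c 0))).comp <|
  cnd (v 1) (.seq openB.comp (whl (v 7) stepP)) (Blk.set 0 (.c 1)).comp

variable {U : Type*} {M : Env U} {V : ℕ} {k n : ℕ} {h : ℕ → ℕ → ℕ → ℕ}

theorem nblocks_le (hk : 1 ≤ k) (hb : ∀ j s m, h j s m ≤ m) (l : ℕ) : nblocks k h n l ≤ n + 1 := by
  have h1 : (alive k h n l).card ≤ n := by
    have := card_alive_add (n := n) hk hb l; omega
  exact Nat.add_le_add_right ((Nat.div_le_self _ _).trans h1) 1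

theorem cells_le (hk : 1 ≤ k) (hkn : k ≤ n) (hb : ∀ j s m, h j s m ≤ m) (l : ℕ) :
    2 * k * nblocks k h n l ≤ 3 * n := by
  have h1 : (alive k h n l).card ≤ n := by
    have := card_alive_add (n := n) hk hb l; omega
  obtain ⟨N, hN⟩ : ∃ N, N = (alive k h n l).card := ⟨_, rfl⟩
  rw [← hN] at h1
  have h2 : 8 * k * (N / (8 * k)) ≤ N := Nat.mul_div_le _ _
  have h3 : nblocks k h n l = N / (8 * k) + 1 := by rw [hN]; rfl
  have h4 : 2 * k * nblocks k h n l = 2 * k * (N / (8 * k)) + 2 * k := by rw [h3]; ring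
  have h5 : 8 * k * (N / (8 * k)) = 4 * (2 * k * (N / (8 * k))) := by ring
  omega

theorem adr_le {g : ℕ} (hk : 1 ≤ k) (hb : ∀ j s m, h j s m ≤ m) (l : ℕ) :
    adr k h n g l ≤ 4 + 2 ^ g + l * (3 * n + 4) := by
  induction l with
  | zero => simp [adr]
  | succ l ih =>
    have h1 := nblocks_le (n := n) hk hb l
    have h2 := nblocks_pos (k := k) (h := h) (n := n) l
    have h3 : (nblocks k h n l - 1) / g ≤ nblocks k h n l - 1 := Nat.div_le_self _ _
    obtain ⟨z, hz⟩ : ∃ z, z = (nblocks k h n l - 1) / g := ⟨_, rfl⟩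
    rw [adr, ← hz]
    rw [← hz] at h3
    have : (l + 1) * (3 * n + 4) = l * (3 * n + 4) + (3 * n + 4) := by ring
    omega

/-- The memory during a query. -/
structure Image (k : ℕ) (h : ℕ → ℕ → ℕ → ℕ) (n g d w T : ℕ) (mem : ℕ → ℕ) : Prop where
  stored : Stored k h n g d w T mem
  finish : mem (adr k h n g T) = 0
  last : mem (adr k h n g T + 1) = 1 + base k h n T
  small : ∀ a, mem a < 2 ^ w

theorem Built.small {σ : State} {T : ℕ} (hk : 1 ≤ k) (hb : ∀ j s m, h j s m ≤ m)
    (hB : Built k h n T σ) : ∀ a < σ.reg 0, σ.mem a < 2 ^ (n + k).size := by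
  intro a ha
  have h1 : n + k < 2 ^ (n + k).size := Nat.lt_size_self _
  have h2 := base_le (n := n) hk hb T
  rw [hB.len] at ha
  obtain ⟨P, hP⟩ : ∃ P, P = adr k h n ((n + k).size / (2 * k).size) T := ⟨_, rfl⟩
  rcases Nat.lt_or_ge a P with hlt | hge
  · exact hB.stored.small a (hP ▸ hlt)
  · rcases Nat.eq_or_lt_of_le hge with he | hlt
    · rw [← he, hP, hB.finish]; positivity
    · rw [show a = P + 1 by omega, hP, hB.last]
      have h3 := card_alive_add (n := n) hk hb T
      have h4 : base k h n T ≤ k * base k h n T := Nat.le_mul_of_pos_left _ hk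
      omega

/-- Everything that a query relies on lies within the transmitted cells; the other cells read as 0,
so every cell holds a proper word. -/
theorem Built.image {σ : State} {T : ℕ} (hk : 1 ≤ k) (hkn : k ≤ n) (hb : ∀ j s m, h j s m ≤ m)
    (hB : Built k h n T σ) :
    Image k h n ((n + k).size / (2 * k).size) (2 * k).size (n + k).size T (queryInit σ).mem := by
  have hs := hB.small hk hb
  obtain ⟨hd, hg, -⟩ := params hk hkn
  have hl := hB.len
  obtain ⟨g, hgdef⟩ : ∃ g, g = (n + k).size / (2 * k).size := ⟨_, rfl⟩
  have hS := hB.stored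
  have hB2 := hB.finish
  have hB3 := hB.last
  rw [← hgdef] at hl hS hB2 hB3 ⊢
  have hm : ∀ a, a < adr k h n g T + 2 → (queryInit σ).mem a = σ.mem a := fun a ha => by
    simp only [queryInit]; rw [if_pos (by omega)]
  have h0 : 4 + 2 ^ g ≤ adr k h n g T := adr_mono (Nat.zero_le T)
  have hpos : 0 < 2 ^ g := by positivity
  refine ⟨⟨(hm 0 (by omega)).trans hS.m0, (hm 1 (by omega)).trans hS.m1,
    (hm 2 (by omega)).trans hS.m2, (hm 3 (by omega)).trans hS.m3,
    fun y hy => (hm _ (by omega)).trans (hS.table y hy), fun i hi => ?_, fun a ha => ?_⟩, ?_, ?_, ?_⟩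
  · refine Record.congr (by rw [hgdef]; exact hg) (hS.recs i hi) fun a _ ha => ?_
    have : adr k h n g (i + 1) ≤ adr k h n g T := adr_mono hi
    exact hm a (by omega)
  · rw [hm a (by omega)]; exact hS.small a ha
  · rw [hm _ (by omega), hB2]
  · rw [hm _ (by omega), hB3]
  · intro a
    simp only [queryInit]
    split_ifs with ha
    · exact hs a ha
    · positivity

/-- The state before looking at round `l`. -/
structure QueryInv (k : ℕ) (h : ℕ → ℕ → ℕ → ℕ) (n g d l : ℕ) (mem : ℕ → ℕ) (σ : State) :
    Prop where
  r0 : σ.reg 0 = mem (adr k h n g l + 1)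
  r1 : σ.reg 1 = k
  r3 : σ.reg 3 = d
  r4 : σ.reg 4 = g
  r5 : σ.reg 5 = adr k h n g l
  r7 : σ.reg 7 = mem (adr k h n g l)
  r9 : σ.reg 9 = l
  mem_eq : σ.mem = mem

theorem locB_exec {H : ℕ → ℕ → ℕ → ℕ} {s : State} :
    let s' := locB.exec H s
    let c := H 0 (s.reg 9) (2 * s.reg 1 * s.reg 7 - 1)
    let q := s.reg 5 + 1 + 3 * (c / (2 * s.reg 1) / s.reg 4)
    (∀ r, r < 11 → s'.reg r = s.reg r) ∧ s'.reg 11 = c ∧ s'.reg 13 = q ∧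
    s'.reg 14 = c / (2 * s.reg 1) % s.reg 4 ∧
    s'.reg 15 = s.mem (q + 2) / 2 ^ (s.reg 3 * (c / (2 * s.reg 1) % s.reg 4)) % 2 ^ s.reg 3 ∧
    s'.mem = s.mem := by
  intro s' c q
  refine ⟨fun r a1 => ?_, ?_, ?_, ?_, ?_, ?_⟩
  · have b1 : r ≠ 11 := by omega
    have b2 : r ≠ 12 := by omega
    have b3 : r ≠ 13 := by omega
    have b4 : r ≠ 14 := by omega
    have b5 : r ≠ 15 := by omega
    simp [s', locB, Blk.exec, State.setReg, Function.update_apply, *]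
  all_goals simp [s', c, q, locB, Blk.exec, State.setReg, Function.update_apply]

/-- The stored number of blocks gives the range of the hash function, so the query recomputes the
cell that the key had in round l. Comparing with the decoded threshold decides whether the key left
in this round. -/
theorem step_run {g d w l T j : ℕ} {mem : ℕ → ℕ} {σ : State} (hk : 1 ≤ k) (hkn : k ≤ n)
    (hb : ∀ j s m, h j s m ≤ m) (hg : 1 ≤ g) (hd : 2 * k < 2 ^ d) (hdw : d * g ≤ w)
    (hM : ∀ s m, M.hv 0 s m = h j s m) (hI : Image k h n g d w T mem) (hl : l < T)
    (hact : k ≤ (alive k h n l).card) (hj : j ∈ alive k h n l)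
    (hσ : QueryInv k h n g d l mem σ) (hV : adr k h n g l + 20 * n + d + w + l + 100 ≤ V)
    (hwV : 2 ^ w + 20 ≤ V) :
    ∃ σ', RunT M stepP σ σ' (200 * unit M V) ∧
      (j ∉ alive k h n (l + 1) → σ'.reg 7 = 0 ∧ σ'.reg 0 = bucket k h n j) ∧
      (j ∈ alive k h n (l + 1) → QueryInv k h n g d (l + 1) mem σ') := by
  obtain ⟨c, hc⟩ : ∃ c, c = pos k h n l j := ⟨_, rfl⟩
  obtain ⟨B, hB⟩ : ∃ B, B = nblocks k h n l := ⟨_, rfl⟩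
  obtain ⟨u, hu⟩ : ∃ u, u = c / (2 * k) := ⟨_, rfl⟩
  have hR := hI.stored.recs l hl
  have hmB : mem (adr k h n g l) = B := by rw [hB]; exact hR.1
  have hcell : c < 2 * k * B := by rw [hc, hB]; exact cell_lt hk hb _ _ _
  have huB : u < B := by rw [hu]; exact Nat.div_lt_of_lt_mul hcell
  have hhash : M.hv 0 l (2 * k * B - 1) = c := by rw [hM, hc, hB]; rfl
  obtain ⟨rd1, rd2⟩ := Record.read hg hd hR (hB ▸ huB)
  have hcn := cells_le (n := n) hk hkn hb l
  have hBn := nblocks_le (n := n) hk hb l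
  rw [← hB] at hcn hBn
  have hd1 : 1 ≤ d := by
    by_contra hcon
    have : d = 0 := by omega
    subst this; simp at hd; omega
  have hdd : d ≤ d * g := Nat.le_mul_of_pos_right _ hg
  have hgd : g ≤ d * g := Nat.le_mul_of_pos_left _ hd1
  have h2d : 2 ^ d ≤ 2 ^ w := Nat.pow_le_pow_right (by norm_num) (hdd.trans hdw)
  have h2g : 2 ^ g ≤ 2 ^ w := Nat.pow_le_pow_right (by norm_num) (hgd.trans hdw)
  obtain ⟨z, hz⟩ : ∃ z, z = u % g := ⟨_, rfl⟩
  have hzg : z < g := by rw [hz]; exact Nat.mod_lt _ hg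
  have hdz : d * z ≤ w := (Nat.mul_le_mul_left d hzg.le).trans hdw
  have h2z : 2 ^ z ≤ 2 ^ w := Nat.pow_le_pow_right (by norm_num) (by omega)
  obtain ⟨y, hy⟩ : ∃ y, y = u / g := ⟨_, rfl⟩
  have hyu : y ≤ u := by rw [hy]; exact Nat.div_le_self _ _
  obtain ⟨q, hq⟩ : ∃ q, q = adr k h n g l + 1 + 3 * y := ⟨_, rfl⟩
  rw [← hy, ← hq, ← hz] at rd1 rd2
  have sq0 := hI.small q
  have sq1 := hI.small (q + 1)
  have sq2 := hI.small (q + 2)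
  have hm := hσ.mem_eq
  have r7 : σ.reg 7 = B := hσ.r7.trans hmB
  have ok1 : locB.ok M.hv V σ := by
    simp [locB, Blk.ok, Blk.exec, State.setReg, Function.update_apply, hσ.r1, hσ.r3, hσ.r4, hσ.r5,
      r7, hσ.r9, hhash, ← hu, ← hy, ← hz, hm]
    rw [← hq]
    omega
  obtain ⟨lr, l11, l13, l14, l15, lm⟩ := locB_exec (H := M.hv) (s := σ)
  rw [hσ.r9, hσ.r1, r7, hhash] at l11
  rw [hσ.r9, hσ.r1, r7, hhash, hσ.r5, hσ.r4, ← hu, ← hy, ← hq] at l13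
  rw [hσ.r9, hσ.r1, r7, hhash, hσ.r4, ← hu, ← hz] at l14
  rw [hσ.r9, hσ.r1, r7, hhash, hσ.r5, hσ.r4, ← hu, ← hy, ← hq, ← hz, hσ.r3, hm, rd2] at l15
  have run1 := Blk.run M V _ _ ok1
  obtain ⟨s1, hs1⟩ : ∃ s1, s1 = locB.exec M.hv σ := ⟨_, rfl⟩
  rw [← hs1] at run1 lr l11 l13 l14 l15 lm
  have e1 : s1.reg 1 = k := (lr 1 (by decide)).trans hσ.r1
  have e4 : s1.reg 4 = g := (lr 4 (by decide)).trans hσ.r4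
  have e5 : s1.reg 5 = adr k h n g l := (lr 5 (by decide)).trans hσ.r5
  have e7 : s1.reg 7 = B := (lr 7 (by decide)).trans r7
  have e9 : s1.reg 9 = l := (lr 9 (by decide)).trans hσ.r9
  have em : s1.mem = mem := lm.trans hm
  have hthr := thrAt_lt (h := h) (n := n) hd l u
  have okE : hitE.ok V s1 := by
    simp [hitE, l11, l15, e1]
    split_ifs <;> omega
  have hval : hitE.eval s1 = if c % (2 * k) < thrAt k h n l u then 1 else 0 := by
    simp [hitE, l11, l15, e1]
  have htk := taken_iff (k := k) (h := h) (n := n) (l := l) (j := j)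
  have cost1 : locB.cost ≤ 50 := by decide
  have cost2 : hitE.cost + 1 ≤ 20 := by decide
  have cost3 : takeB.cost ≤ 50 := by decide
  have cost4 : nextB.cost ≤ 50 := by decide
  have hlastc : c % (2 * k) < thrAt k h n l u ↔ j ∉ alive k h n (l + 1) := by
    rw [← hc, ← hu] at htk
    constructor
    · intro hlt; exact (htk.2 ⟨hact, hj, hlt⟩).2
    · intro hnot; exact (htk.1 ⟨hj, hnot⟩).2.2
  by_cases hlt : c % (2 * k) < thrAt k h n l u
  · have hy2 : mem (q + 1) % 2 ^ z < 2 ^ z := Nat.mod_lt _ (by positivity)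
    have h2zg : 2 ^ z ≤ 2 ^ g := Nat.pow_le_pow_right (by norm_num) hzg.le
    have tb := hI.stored.table _ (hy2.trans_le h2zg)
    have pl := popc_le (mem (q + 1) % 2 ^ z)
    have ful := fullsAt_le (k := k) (h := h) (n := n) (l := l) (u := u)
    have hbl := base_le (n := n) hk hb l
    have ok2 : takeB.ok M.hv V s1 := by
      simp [takeB, Blk.ok, Blk.exec, State.setReg, Function.update_apply, l13, l14, em, tb, rd1]
      omega
    refine ⟨_, (run1.seq (RunT.cnd_true okE (by rw [hval, if_pos hlt]; simp)
      (Blk.run M V takeB s1 ok2))).mono ?_, fun _ => ⟨?_, ?_⟩, fun hin => absurd hin (hlastc.1 hlt)⟩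
    · calc _ = (locB.cost + (hitE.cost + 1) + takeB.cost) * unit M V := by ring
        _ ≤ _ := Nat.mul_le_mul_right _ (by omega)
    · simp [takeB, Blk.exec, State.setReg, Function.update_apply]
    · rw [bucket_of_taken (htk.2 (by rw [← hc, ← hu]; exact ⟨hact, hj, hlt⟩))]
      simp [takeB, Blk.exec, State.setReg, Function.update_apply, l13, l14, em, tb, rd1]
      rw [lab, ← hc, ← hu]; rfl
  · obtain ⟨x, hx⟩ : ∃ x, x = (B - 1) / g := ⟨_, rfl⟩
    have hxB : x ≤ B - 1 := by rw [hx]; exact Nat.div_le_self _ _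
    have hadr : adr k h n g (l + 1) = adr k h n g l + 1 + 3 * (x + 1) := by
      rw [adr, ← hB, ← hx]
    have s3 := hI.small (adr k h n g (l + 1))
    have s4 := hI.small (adr k h n g (l + 1) + 1)
    have ok2 : nextB.ok M.hv V s1 := by
      simp [nextB, Blk.ok, Blk.exec, State.setReg, Function.update_apply, e4, e5, e7, e9, em, ← hx,
        ← hadr]
      omega
    refine ⟨_, (run1.seq (RunT.cnd_false okE (by rw [hval, if_neg hlt])
      (Blk.run M V nextB s1 ok2))).mono ?_, fun hnot => absurd (hlastc.2 hnot) hlt, fun _ =>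
      ⟨?_, ?_, ?_, ?_, ?_, ?_, ?_, ?_⟩⟩
    · calc _ = (locB.cost + (hitE.cost + 1) + nextB.cost) * unit M V := by ring
        _ ≤ _ := Nat.mul_le_mul_right _ (by omega)
    · simp [nextB, Blk.exec, State.setReg, Function.update_apply, e4, e5, e7, e9, em, ← hx, ← hadr]
    · simp [nextB, Blk.exec, State.setReg, Function.update_apply, e1]
    · simp [nextB, Blk.exec, State.setReg, Function.update_apply, lr 3 (by decide), hσ.r3]
    · simp [nextB, Blk.exec, State.setReg, Function.update_apply, e4]
    · simp [nextB, Blk.exec, State.setReg, Function.update_apply, e4, e5, e7, e9, em, ← hx, ← hadr]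
    · simp [nextB, Blk.exec, State.setReg, Function.update_apply, e4, e5, e7, e9, em, ← hx, ← hadr]
    · simp [nextB, Blk.exec, State.setReg, Function.update_apply, e9]
    · exact em

/-- The term (l + 1)² pays for the next test and step, and the summand (i + 2)² of round i pays for
what follows that round, be it another step or the test that ends the loop. -/
theorem steps_run {g d w T j : ℕ} {mem : ℕ → ℕ} (hk : 1 ≤ k) (hkn : k ≤ n)
    (hb : ∀ j s m, h j s m ≤ m) (hg : 1 ≤ g) (hd : 2 * k < 2 ^ d) (hdw : d * g ≤ w)
    (hw2 : 2 ^ w ≤ 4 * n) (hw : M.w = (n + k).size)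
    (hM : ∀ s m, M.hv 0 s m = h j s m) (hI : Image k h n g d w T mem)
    (hT : (alive k h n T).card < k) (hlt : ∀ i < T, k ≤ (alive k h n i).card) :
    ∀ i l σ, l + i = T → j ∈ alive k h n l → QueryInv k h n g d l mem σ →
      ∃ σ', RunT M (whl (v 7) stepP) σ σ' ((∑ i ∈ Finset.Ico l T,
          220 * 1089 * (if j ∈ alive k h n i then (i + 2) ^ 2 else 0)) +
            220 * 1089 * (l + 1) ^ 2) ∧ σ'.reg 0 = bucket k h n j := by
  have hn := hk.trans hkn
  have hww : w < 2 ^ w := Nat.lt_two_pow_self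
  have hgw : 2 ^ g ≤ 2 ^ w := by
    refine Nat.pow_le_pow_right (by norm_num) (le_trans ?_ hdw)
    refine Nat.le_mul_of_pos_left _ (Nat.pos_of_ne_zero ?_)
    rintro rfl
    simp at hd; omega
  have hVl : ∀ l, adr k h n g l + 20 * n + d + w + l + 100 ≤ 256 * n * (l + 1) := by
    intro l
    have h1 := adr_le (n := n) (g := g) hk hb l
    have h2 : d ≤ w := (Nat.le_mul_of_pos_right _ hg).trans hdw
    have e1 : 256 * n * (l + 1) = 256 * (l * n) + 256 * n := by ring
    have e2 : l * (3 * n + 4) = 3 * (l * n) + 4 * l := by ring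
    have e3 : l ≤ l * n := Nat.le_mul_of_pos_right _ (by omega)
    omega
  have h256 : ∀ l, 256 * n ≤ 256 * n * (l + 1) := fun l => Nat.le_mul_of_pos_right _ (by omega)
  have hok : ∀ l σ, σ.reg 7 < 2 ^ w → (v 7).ok (256 * n * (l + 1)) σ := by
    intro l σ hσ
    have := h256 l
    simp; omega
  intro i
  induction i with
  | zero =>
    rintro l σ rfl hj hσ
    simp only [add_zero] at *
    refine ⟨σ, (RunT.whl_false (hok l σ (hσ.r7 ▸ hI.small _)) ?_).mono ?_, ?_⟩
    · simp [hσ.r7, hI.finish]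
    · have := unit_le (l := l) hw hn
      calc _ ≤ 220 * (1089 * (l + 1) ^ 2) := Nat.mul_le_mul (by decide) this
        _ ≤ _ := by simp; ring_nf; rfl
    -- Register 0 always holds the word after the beginning of the record. At the end marker this is
    -- 1 + n / k, the last bucket.
    · rw [hσ.r0, hI.last, bucket_of_alive hT hj, (base_eq hk hb hT).1, add_comm]
  | succ i ih =>
    intro l σ hl hj hσ
    have hlT : l < T := by omega
    obtain ⟨σ₁, run1, hout, hin⟩ := step_run (V := 256 * n * (l + 1)) hk hkn hb hg hd hdw hM hI hlT
      (hlt l hlT) hj hσ (hVl l) (by have := h256 l; omega)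
    have hu := unit_le (l := l) hw hn
    have hne : (v 7).eval σ ≠ 0 := by
      have := (hI.stored.recs l hlT).1
      have := nblocks_pos (k := k) (h := h) (n := n) l
      simp [hσ.r7]; omega
    have hsum := Finset.sum_eq_sum_Ico_succ_bot hlT
      (fun i => 220 * 1089 * (if j ∈ alive k h n i then (i + 2) ^ 2 else 0))
    rw [hsum, if_pos hj]
    have hokl := hok l σ (hσ.r7 ▸ hI.small _)
    have hc : (v 7).cost + 1 ≤ 10 := by decide
    have hc' := Nat.mul_le_mul_right (unit M (256 * n * (l + 1))) hc
    by_cases hj' : j ∈ alive k h n (l + 1)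
    · obtain ⟨σ', run, h'⟩ := ih (l + 1) σ₁ (by omega) hj' (hin hj')
      refine ⟨σ', (RunT.whl_true hokl hne run1 run).mono ?_, h'⟩
      rw [show l + 1 + 1 = l + 2 from rfl]
      omega
    · obtain ⟨h7, h0⟩ := hout hj'
      refine ⟨σ₁, (RunT.whl_true hokl hne run1
        (RunT.whl_false (hok l σ₁ (by rw [h7]; positivity)) h7)).mono ?_, h0⟩
      have : 0 ≤ 220 * 1089 * (l + 2) ^ 2 := Nat.zero_le _
      omega

theorem query_run {T j : ℕ} {σ : State} (hk : 1 ≤ k) (hkn : k ≤ n)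
    (hb : ∀ j s m, h j s m ≤ m) (hw : M.w = (n + k).size)
    (hM : ∀ s m, M.hv 0 s m = h j s m) (hB : Built k h n T σ) (hj : j < n)
    (hT : (alive k h n T).card < k) (hlt : ∀ i < T, k ≤ (alive k h n i).card) :
    ∃ σ' t, Exec M queryP (queryInit σ) σ' t ∧ σ'.reg 0 = bucket k h n j ∧
      t ≤ 10 ^ 6 + 10 ^ 6 * ∑ i ∈ Finset.range T, if j ∈ alive k h n i then (i + 2) ^ 2 else 0 := by
  have hn := hk.trans hkn
  obtain ⟨hd, hg, hgw, hdw, hd2, hw2, hdg, hwn, hwle⟩ := params hk hkn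
  have hI := hB.image hk hkn hb
  obtain ⟨g, hgdef⟩ : ∃ g, g = (n + k).size / (2 * k).size := ⟨_, rfl⟩
  rw [← hgdef] at hg hgw hdg hI
  obtain ⟨V, hV⟩ : ∃ V, V = 256 * n * (0 + 1) := ⟨_, rfl⟩
  obtain ⟨mem, hmem⟩ : ∃ mem, mem = (queryInit σ).mem := ⟨_, rfl⟩
  rw [← hmem] at hI
  have h2g : 2 ^ g ≤ 2 ^ (n + k).size := Nat.pow_le_pow_right (by norm_num) hgw.le
  obtain ⟨w, hwdef⟩ : ∃ w, w = (n + k).size := ⟨_, rfl⟩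
  have ok1 : (Blk.set 1 (ld (.c 0))).ok M.hv V (queryInit σ) := by
    simp [Blk.ok, ← hmem, hI.stored.m0]; omega
  obtain ⟨s1, hs1⟩ : ∃ s1, s1 = (Blk.set 1 (ld (.c 0))).exec M.hv (queryInit σ) := ⟨_, rfl⟩
  have e1 : s1.reg 1 = k := by simp [hs1, Blk.exec, State.setReg, ← hmem, hI.stored.m0]
  have em : s1.mem = mem := by rw [hs1, hmem]; rfl
  have hadr : adr k h n g 0 = 4 + 2 ^ g := rfl
  have sm0 := hI.small (4 + 2 ^ g)
  have sm1 := hI.small (4 + 2 ^ g + 1)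
  have ok2 : openB.ok M.hv V s1 := by
    simp [openB, Blk.ok, Blk.exec, State.setReg, Function.update_apply, em, hI.stored.m1,
      hI.stored.m2, hI.stored.m3]
    omega
  have hQ : QueryInv k h n g (2 * k).size 0 mem (openB.exec M.hv s1) := by
    refine ⟨?_, ?_, ?_, ?_, ?_, ?_, ?_, em⟩ <;>
    simp [openB, Blk.ok, Blk.exec, State.setReg, Function.update_apply, em, hI.stored.m1,
      hI.stored.m2, hI.stored.m3, e1, hadr]
  obtain ⟨s3, run3, h3⟩ := steps_run hk hkn hb hg hd2 hdg (by omega) hw hM hI hT hlt T 0 _ (by simp)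
    (by rw [alive]; exact Finset.mem_range.2 hj) hQ
  have run1 := Blk.run M V _ _ ok1
  rw [← hs1] at run1
  have okc : (v 1).ok V s1 := by simp [e1]; omega
  have run := run1.seq (RunT.cnd_true (q := (Blk.set 0 (.c 1)).comp) okc (by simp [e1]; omega)
    ((Blk.run M V _ _ ok2).seq run3))
  obtain ⟨σ', t, hex, hag, ht⟩ := run _ (Agree.refl _)
  refine ⟨σ', t, hex, (hag.1 0 (by decide)).trans h3, ht.trans ?_⟩
  have hu0 := unit_le (l := 0) hw hn
  rw [← hV] at hu0
  have hc1 : (Blk.set 1 (ld (.c 0))).cost ≤ 10 := by decide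
  have hc2 : (v 1).cost + 1 ≤ 10 := by decide
  have hc3 : openB.cost ≤ 40 := by decide
  have p1 := Nat.mul_le_mul hc1 hu0
  have p2 := Nat.mul_le_mul hc2 hu0
  have p3 := Nat.mul_le_mul hc3 hu0
  rw [← Finset.mul_sum, ← Finset.range_eq_Ico]
  simp only [zero_add, one_pow, mul_one] at p1 p2 p3 ⊢
  omega

/-- In an empty data structure cell 0 reads as 0. A nonempty one has k ≥ 1 there, so the query can
tell the two cases apart. -/
theorem query_run_small {σ : State} (hk : 1 ≤ k) (hw : M.w = (n + k).size) (hσ : σ.reg 0 = 0) :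
    ∃ σ' t, Exec M queryP (queryInit σ) σ' t ∧ σ'.reg 0 = 1 ∧ t ≤ 1000 := by
  have ok1 : (Blk.set 1 (ld (.c 0))).ok M.hv (n + k) (queryInit σ) := by
    simp [Blk.ok, queryInit, hσ]
  have e1 : ((Blk.set 1 (ld (.c 0))).exec M.hv (queryInit σ)).reg 1 = 0 := by
    simp [Blk.exec, State.setReg, queryInit, hσ]
  have okc : (v 1).ok (n + k) ((Blk.set 1 (ld (.c 0))).exec M.hv (queryInit σ)) := by
    simp [e1]
  have ok2 : (Blk.set 0 (.c 1)).ok M.hv (n + k)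
      ((Blk.set 1 (ld (.c 0))).exec M.hv (queryInit σ)) := by
    simp [Blk.ok]; omega
  have run := (Blk.run M _ _ _ ok1).seq (RunT.cnd_false (p := .seq openB.comp (whl (v 7) stepP)) okc
    e1 (Blk.run M _ _ _ ok2))
  obtain ⟨σ', t, hex, hag, ht⟩ := run _ (Agree.refl _)
  refine ⟨σ', t, hex, (hag.1 0 (by decide)).trans (by simp [Blk.exec, State.setReg]), ht.trans ?_⟩
  have h1 : unit M (n + k) = 36 := by
    rw [unit, Env.words, hw, Nat.div_self (Nat.size_pos.2 (by omega))]; rfl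
  rw [h1]; decide

end RAM


/-! ## Correctness, time and space for given hash functions -/


theorem Nat.ceil_div_of_not_dvd {n k : ℕ} (hk : 1 ≤ k) (h : ¬ k ∣ n) :
    ⌈(n : ℚ) / k⌉₊ = n / k + 1 := by
  have hk' : (0 : ℚ) < k := by exact_mod_cast hk
  have hdm := Nat.div_add_mod n k
  have hlt := Nat.mod_lt n (show k > 0 from hk)
  have hpos : 0 < n % k := Nat.pos_of_ne_zero fun h0 => h (Nat.dvd_of_mod_eq_zero h0)
  rw [Nat.ceil_eq_iff (Nat.add_one_ne_zero _), Nat.add_sub_cancel, lt_div_iff₀ hk', div_le_iff₀ hk']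
  constructor
  · have : n / k * k < n := by rw [mul_comm]; linarith
    exact_mod_cast this
  · have : n ≤ (n / k + 1) * k := by rw [add_mul, mul_comm (n / k)]; linarith
    exact_mod_cast this

theorem Nat.ceil_div_of_dvd {n k : ℕ} (hk : 1 ≤ k) (h : k ∣ n) :
    ⌈(n : ℚ) / k⌉₊ = n / k := by
  obtain ⟨c, rfl⟩ := h
  have hk' : (k : ℚ) ≠ 0 := by exact_mod_cast (show k ≠ 0 by omega)
  rw [Nat.mul_div_cancel_left _ hk]
  push_cast
  rw [mul_div_cancel_left₀ _ hk', Nat.ceil_natCast]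

/-! ### From indices of keys to keys -/

section
variable {U : Type*} {S : Finset U} {keys : List U}

theorem nodup_of_coe_eq (hS : (keys : Multiset U) = S.val) : keys.Nodup :=
  Multiset.coe_nodup.1 (hS ▸ S.nodup)

theorem length_eq_card (hS : (keys : Multiset U) = S.val) : keys.length = S.card := by
  rw [Finset.card_def, ← hS, Multiset.coe_card]

theorem mem_iff_getElem (hS : (keys : Multiset U) = S.val) (x : U) :
    x ∈ S ↔ ∃ (j : ℕ) (hj : j < keys.length), keys[j] = x := by
  rw [← Finset.mem_val, ← hS, Multiset.mem_coe, List.mem_iff_getElem]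

theorem card_filter_keys (hS : (keys : Multiset U) = S.val) {f : ℕ → ℕ} {F : U → ℕ}
    (hF : ∀ (j : ℕ) (hj : j < keys.length), F keys[j] = f j) (i : ℕ) :
    (S.filter fun x => F x = i).card =
      ((Finset.range keys.length).filter fun j => f j = i).card := by
  symm
  refine Finset.card_bij
    (fun j hj => keys[j]'(Finset.mem_range.1 (Finset.mem_filter.1 hj).1)) ?_ ?_ ?_
  · intro j hj
    have hj' := Finset.mem_range.1 (Finset.mem_filter.1 hj).1
    exact Finset.mem_filter.2 ⟨(mem_iff_getElem hS _).2 ⟨j, hj', rfl⟩,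
      (hF j hj').trans (Finset.mem_filter.1 hj).2⟩
  · intro a ha b hb hab
    exact (List.Nodup.getElem_inj_iff (nodup_of_coe_eq hS)).1 hab
  · intro x hx
    obtain ⟨j, hj, rfl⟩ := (mem_iff_getElem hS x).1 (Finset.mem_filter.1 hx).1
    exact ⟨j, Finset.mem_filter.2 ⟨Finset.mem_range.2 hj, (hF j hj).symm.trans
      (Finset.mem_filter.1 hx).2⟩, rfl⟩

theorem exists_fun_keys (hS : (keys : Multiset U) = S.val) (f : ℕ → ℕ) :
    ∃ F : U → ℕ, ∀ (j : ℕ) (hj : j < keys.length), F keys[j] = f j := by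
  classical
  exact ⟨fun x => f (keys.idxOf x), fun j hj => by
    simp only [List.Nodup.idxOf_getElem (nodup_of_coe_eq hS)]⟩

theorem IsMinimalKPerfect.of_keys {k : ℕ} (hS : (keys : Multiset U) = S.val) (hk : 1 ≤ k)
    {f : ℕ → ℕ} {F : U → ℕ} (hF : ∀ (j : ℕ) (hj : j < keys.length), F keys[j] = f j)
    (hr : ∀ j < keys.length, 1 ≤ f j ∧ f j ≤ keys.length / k + 1)
    (hfull : ∀ i, 1 ≤ i → i ≤ keys.length / k →
      ((Finset.range keys.length).filter fun j => f j = i).card = k)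
    (hlast : ((Finset.range keys.length).filter fun j => f j = keys.length / k + 1).card =
      keys.length % k) : IsMinimalKPerfect k S F := by
  have hn := length_eq_card hS
  refine ⟨fun x hx => ?_, fun i h1 h2 => ?_, fun hd => ?_⟩
  · obtain ⟨j, hj, rfl⟩ := (mem_iff_getElem hS x).1 hx
    rw [hF j hj, ← hn]
    refine ⟨(hr j hj).1, ?_⟩
    -- If k divides n, then n % k = 0, so by `hlast` no key has the label n / k + 1.
    by_cases hd : k ∣ keys.length
    · rw [Nat.ceil_div_of_dvd hk hd]
      rw [Nat.mod_eq_zero_of_dvd hd, Finset.card_eq_zero] at hlast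
      have : f j ≠ keys.length / k + 1 := fun he => by
        have : j ∈ ((Finset.range keys.length).filter fun j => f j = keys.length / k + 1) :=
          Finset.mem_filter.2 ⟨Finset.mem_range.2 hj, he⟩
        rw [hlast] at this
        exact absurd this (Finset.notMem_empty _)
      have := (hr j hj).2
      omega
    · rw [Nat.ceil_div_of_not_dvd hk hd]; exact (hr j hj).2
  · rw [← hn, Nat.floor_div_eq_div] at h2
    rw [card_filter_keys hS hF]
    exact hfull i h1 h2
  · rw [← hn] at hd ⊢
    rw [Nat.ceil_div_of_not_dvd hk hd, card_filter_keys hS hF, hlast]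
    have hpos : 0 < keys.length % k :=
      Nat.pos_of_ne_zero fun h0 => hd (Nat.dvd_of_mod_eq_zero h0)
    have := Nat.mod_lt keys.length (show k > 0 from hk)
    omega

end

namespace RAM

open Rounds

section
variable {U : Type*} {S : Finset U} {keys : List U} {k : ℕ}
  {hash : ℕ → (m : ℕ) → U → Fin (m + 1)}

/-- Hash values of the listed keys. -/
def keyHash (keys : List U) (hash : ℕ → (m : ℕ) → U → Fin (m + 1)) : ℕ → ℕ → ℕ → ℕ :=
  (buildEnv 0 keys hash).hashAt

theorem keyHash_eq {j : ℕ} (hj : j < keys.length) (s m : ℕ) :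
    keyHash keys hash j s m = hash s m keys[j] := by
  simp [keyHash, Env.hashAt, buildEnv, List.getElem?_eq_getElem hj]

theorem keyHash_le (j s m : ℕ) : keyHash keys hash j s m ≤ m := by
  by_cases hj : j < keys.length
  · rw [keyHash_eq hj]; omega
  · simp [keyHash, Env.hashAt, buildEnv, List.getElem?_eq_none (not_lt.1 hj)]

/-- The construction for given hash functions, if the number of keys is at least `k`. -/
theorem correct_of_le (hS : (keys : Multiset U) = S.val) (hk : 1 ≤ k) (hkn : k ≤ keys.length)
    (hex : ∃ l, (alive k (keyHash keys hash) keys.length l).card < k) :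
    ∃ T, (∀ i < T, k ≤ (alive k (keyHash keys hash) keys.length i).card) ∧
      Correct buildP queryP k S keys hash ∧
      buildTime buildP k keys hash ≤ ((10 ^ 6 * keys.length + 10 ^ 7 * ∑ i ∈ Finset.range T,
        (i + 1) ^ 2 * (alive k (keyHash keys hash) keys.length i).card : ℕ) : ℝ≥0∞) ∧
      spaceBits buildP k keys hash ≤ (((adr k (keyHash keys hash) keys.length
        ((keys.length + k).size / (2 * k).size) T + 2) * (keys.length + k).size : ℕ) : ℝ≥0∞) ∧
      ∀ (j : ℕ) (hj : j < keys.length), queryTime buildP queryP k keys keys[j] hash ≤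
        ((10 ^ 6 + 10 ^ 6 * ∑ i ∈ Finset.range T,
          if j ∈ alive k (keyHash keys hash) keys.length i then (i + 2) ^ 2 else 0 : ℕ) : ℝ≥0∞) := by
  classical
  set h := keyHash keys hash with hh
  set n := keys.length with hn
  have hb : ∀ j s m, h j s m ≤ m := keyHash_le
  set T := Nat.find hex with hTdef
  have hT : (alive k h n T).card < k := Nat.find_spec hex
  have hlt : ∀ i < T, k ≤ (alive k h n i).card := fun i hi => not_lt.1 (Nat.find_min hex hi)
  obtain ⟨σ, t, hrun, hB, ht⟩ := build_run (M := buildEnv k keys hash) hk hkn hb rfl rfl hT hlt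
  have hq := fun (j : ℕ) (hj : j < n) => query_run (M := queryEnv n k keys[j] hash) hk hkn hb rfl
    (fun s m => (keyHash_eq hj s m).symm) hB hj hT hlt
  refine ⟨T, hlt, ⟨σ, t, hrun, hB.small hk hb, ?_⟩, ?_, ?_, ?_⟩
  · obtain ⟨F, hF⟩ := exists_fun_keys hS (bucket k h n)
    refine ⟨F, IsMinimalKPerfect.of_keys hS hk hF (fun j hj => ?_)
      (fun i => card_full hk hb hT) (card_last hk hb hT), fun x hx => ?_⟩
    · obtain ⟨h1, h2, h3⟩ := bucket_le hk hb hT (Finset.mem_range.2 hj)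
      refine ⟨h1, ?_⟩
      by_cases hm : j ∈ alive k h n T
      · exact (h3 hm).le
      · exact (h2 hm).trans (Nat.le_succ _)
    · obtain ⟨j, hj, rfl⟩ := (mem_iff_getElem hS x).1 hx
      obtain ⟨e, t', h1, h2, -⟩ := hq j hj
      exact ⟨e, t', h1, h2.trans (hF j hj).symm⟩
  · exact (iInf_le_of_le σ <| iInf_le_of_le t <| iInf_le_of_le hrun le_rfl).trans
      (by exact_mod_cast ht)
  · refine (iInf_le_of_le σ <| iInf_le_of_le t <| iInf_le_of_le hrun le_rfl).trans ?_
    rw [hB.len]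
  · intro j hj
    obtain ⟨e, t', h1, -, h3⟩ := hq j hj
    exact (iInf_le_of_le σ <| iInf_le_of_le t <| iInf_le_of_le hrun <| iInf_le_of_le e <|
      iInf_le_of_le t' <| iInf_le_of_le h1 le_rfl).trans (by exact_mod_cast h3)

/-- The construction for given hash functions, if the number of keys is less than `k`. -/
theorem correct_of_lt (hS : (keys : Multiset U) = S.val) (hn : 1 ≤ keys.length)
    (hkn : keys.length < k) :
    Correct buildP queryP k S keys hash ∧ buildTime buildP k keys hash ≤ 1000 ∧
      spaceBits buildP k keys hash = 0 ∧
      ∀ x, queryTime buildP queryP k keys x hash ≤ 1000 := by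
  have hk : 1 ≤ k := by omega
  obtain ⟨σ, t, hrun, h0, ht⟩ := build_run_small (M := buildEnv k keys hash) hkn rfl
  have hq := fun x : U => query_run_small (M := queryEnv keys.length k x hash) hk rfl h0
  have hdiv : keys.length / k = 0 := Nat.div_eq_of_lt hkn
  refine ⟨⟨σ, t, hrun, by simp [h0], ?_⟩, ?_, ?_, fun x => ?_⟩
  · refine ⟨fun _ => 1, IsMinimalKPerfect.of_keys hS hk (f := fun _ => 1) (fun _ _ => rfl)
      (fun j hj => by simp) (fun i h1 h2 => by omega) ?_, fun x _ => ?_⟩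
    · rw [hdiv, Nat.mod_eq_of_lt hkn]; simp
    · obtain ⟨e, t', h1, h2, -⟩ := hq x
      exact ⟨e, t', h1, h2⟩
  · exact (iInf_le_of_le σ <| iInf_le_of_le t <| iInf_le_of_le hrun le_rfl).trans
      (by exact_mod_cast ht)
  · refine le_antisymm ((iInf_le_of_le σ <| iInf_le_of_le t <| iInf_le_of_le hrun le_rfl).trans ?_)
      (zero_le)
    simp [h0]
  · obtain ⟨e, t', h1, -, h3⟩ := hq x
    exact (iInf_le_of_le σ <| iInf_le_of_le t <| iInf_le_of_le hrun <| iInf_le_of_le e <|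
      iInf_le_of_le t' <| iInf_le_of_le h1 le_rfl).trans (by exact_mod_cast h3)

end

/-- The listed keys are distinct, so passing from keys to indices is a reindexing along an
injection, which preserves independence. Indices beyond the list have the constant hash value 0. -/
theorem uniformHash {U Ω : Type*} [MeasurableSpace Ω] {μ : Measure Ω}
    {H : ℕ → (m : ℕ) → U → Ω → Fin (m + 1)} (hH : SimpleUniformHashing μ H) {keys : List U}
    (hd : keys.Nodup) :
    UniformHash μ (fun j s m ω => keyHash keys (fun s m x => H s m x ω) j s m) keys.length := by
  refine ⟨fun j s m => ?_, fun j s m ω => keyHash_le j s m, fun j hj s m v hv => ?_, ?_⟩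
  · by_cases hj : j < keys.length
    · simp only [keyHash_eq hj]
      exact (measurable_of_countable (fun x : Fin (m + 1) => (x : ℕ))).comp (hH.measurable s m _)
    · have : (fun ω => keyHash keys (fun s m x => H s m x ω) j s m) = fun _ => 0 := by
        ext ω
        simp [keyHash, Env.hashAt, buildEnv, List.getElem?_eq_none (not_lt.1 hj)]
      rw [this]
      exact measurable_const
  · simp only [keyHash_eq hj]
    rw [← hH.uniform s m keys[j] ⟨v, by omega⟩]
    congr 1
    ext ω
    simp [Fin.ext_iff]
  · have h1 := hH.indep.precomp (g := fun i : ℕ × ℕ × Fin keys.length =>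
      (i.1, i.2.1, keys[i.2.2])) (by
        rintro ⟨a, b, c⟩ ⟨a', b', c'⟩ h
        simp only [Prod.mk.injEq] at h ⊢
        refine ⟨h.1, h.2.1, Fin.ext ((List.Nodup.getElem_inj_iff hd).1 h.2.2)⟩)
    have h2 := h1.comp (fun i (x : Fin (i.2.1 + 1)) => (x : ℕ))
      (fun i => measurable_of_countable _)
    convert h2 using 2 with i
    ext ω
    exact keyHash_eq i.2.2.2 _ _

end RAM


/-! ## Expectations -/

namespace RAM

open Rounds

/-- A record has 4 + 3⌊x/g⌋ words with x = ⌊N/(8k)⌋ ≤ N/k, and ⌊x/g⌋ words take at most 2dx bits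
because w ≤ 2gd. So a block costs O(d) bits, apart from O(w) bits per round. -/
theorem adr_mul_le {k n g d w : ℕ} {h : ℕ → ℕ → ℕ → ℕ} (hk : 1 ≤ k)
    (hw : w ≤ 2 * (g * d)) (T : ℕ) :
    (adr k h n g T + 2) * w ≤ (6 + 2 ^ g) * w +
      ∑ i ∈ Finset.range T, (4 * w + 6 * d * ((alive k h n i).card / k)) := by
  induction T with
  | zero => simp only [adr, Finset.range_zero, Finset.sum_empty]; nlinarith
  | succ T ih =>
    rw [Finset.sum_range_succ, adr]
    obtain ⟨x, hx⟩ : ∃ x, x = nblocks k h n T - 1 := ⟨_, rfl⟩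
    have hxk : x ≤ (alive k h n T).card / k := by
      have : x = (alive k h n T).card / (8 * k) := by rw [hx]; exact Nat.add_sub_cancel ..
      rw [this]; exact Nat.div_le_div_left (by omega) (by omega)
    rw [← hx]
    have h1 : x / g * g ≤ x := Nat.div_mul_le_self _ _
    obtain ⟨y, hy⟩ : ∃ y, y = x / g := ⟨_, rfl⟩
    rw [← hy] at h1 ⊢
    have h2 : y * w ≤ 2 * d * ((alive k h n T).card / k) :=
      calc y * w ≤ y * (2 * (g * d)) := Nat.mul_le_mul_left _ hw
        _ = 2 * d * (y * g) := by ring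
        _ ≤ _ := Nat.mul_le_mul_left _ (h1.trans hxk)
    have h3 : (adr k h n g T + 1 + 3 * (y + 1) + 2) * w = (adr k h n g T + 2) * w + 4 * w +
      3 * (y * w) := by ring
    rw [h3]
    nlinarith

/-! ### The parameters in terms of n/k and log k -/

section reals
variable {k n : ℕ}

theorem natSize_two_mul_le (hk : 1 ≤ k) :
    ((2 * k).size : ℝ) ≤ 3 * max 1 (Real.logb 2 k) := by
  have hk' : (0 : ℝ) < k := by exact_mod_cast hk
  have h0 : 0 < (2 * k).size := Nat.size_pos.2 (by omega)
  have h1 : 2 ^ ((2 * k).size - 1) ≤ 2 * k := Nat.lt_size.1 (by omega)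
  have h2 : (((2 * k).size - 1 : ℕ) : ℝ) ≤ Real.logb 2 (2 * k) := by
    rw [Real.le_logb_iff_rpow_le (by norm_num) (by positivity), Real.rpow_natCast]
    exact_mod_cast h1
  rw [Real.logb_mul (by norm_num) hk'.ne', Real.logb_self_eq_one (by norm_num),
    Nat.cast_sub h0] at h2
  have h3 := le_max_left 1 (Real.logb 2 k)
  have h4 := le_max_right 1 (Real.logb 2 k)
  push_cast at h2
  linarith

theorem logb_two_le_sqrt {q : ℝ} (hq : 1 ≤ q) : Real.logb 2 q ≤ 3 * √q := by
  have hs : 0 < √q := Real.sqrt_pos.2 (by linarith)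
  have h1 : Real.log q ≤ 2 * √q := by
    have := Real.log_le_sub_one_of_pos hs
    rw [Real.log_sqrt (by linarith)] at this
    linarith
  have h2 : 0.69 < Real.log 2 := lt_trans (by norm_num) Real.log_two_gt_d9
  rw [Real.logb, div_le_iff₀ (by linarith)]
  nlinarith

/-- With q = n/k and L = max(1, log₂ k), w ≤ log₂(4kq) ≤ 3L + 3√q. Hence √q words, needed for the
table and for the overhead of the rounds, fit into the space bound. -/
theorem natSize_mul_sqrt_le (hk : 1 ≤ k) (hkn : k ≤ n) :
    ((n + k).size : ℝ) * √((n : ℝ) / k) ≤ 6 * ((n : ℝ) / k * max 1 (Real.logb 2 k)) := by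
  have hk' : (0 : ℝ) < k := by exact_mod_cast hk
  have hq1 : (1 : ℝ) ≤ (n : ℝ) / k := by rw [le_div_iff₀ hk', one_mul]; exact_mod_cast hkn
  obtain ⟨-, -, -, -, -, -, -, hwn, -⟩ := params hk hkn
  set q := (n : ℝ) / k with hq
  set L := max 1 (Real.logb 2 k)
  have h3 : 1 ≤ L := le_max_left 1 (Real.logb 2 k)
  have h4 : Real.logb 2 k ≤ L := le_max_right 1 (Real.logb 2 k)
  have hn : (n : ℝ) = k * q := by rw [hq]; field_simp
  have h1 : ((n + k).size : ℝ) ≤ Real.logb 2 (2 ^ 2 * (k * q)) := by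
    rw [Real.le_logb_iff_rpow_le (by norm_num) (by positivity), Real.rpow_natCast, ← hn]
    have : 2 ^ (n + k).size ≤ 2 ^ 2 * n := by omega
    exact_mod_cast this
  rw [Real.logb_mul (by norm_num) (by positivity), Real.logb_mul hk'.ne' (by positivity),
    Real.logb_pow, Real.logb_self_eq_one (by norm_num)] at h1
  have h2 := logb_two_le_sqrt hq1
  have hs1 : 1 ≤ √q := Real.one_le_sqrt.2 hq1
  have hss : √q * √q = q := Real.mul_self_sqrt (by linarith)
  push_cast at h1
  have h5 : ((n + k).size : ℝ) ≤ 3 * L + 3 * √q := by linarith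
  calc _ ≤ (3 * L + 3 * √q) * √q := by gcongr
    _ = 3 * (L * √q) + 3 * (√q * √q) := by ring
    _ ≤ 3 * (L * q) + 3 * (q * L) := by
      rw [hss]
      have : √q ≤ q := by nlinarith
      gcongr
      nlinarith
    _ = _ := by ring

/-- From dg ≤ w one gets 2 ^ (dg) ≤ 4n. One of the g factors 2 ^ d exceeds 2k, and each of the other
g - 1 is at least 2², so 4 ^ (g - 1) ≤ 2n/k. -/
theorem two_pow_div_le (hk : 1 ≤ k) (hkn : k ≤ n) :
    (2 : ℝ) ^ ((n + k).size / (2 * k).size) ≤ 4 * √((n : ℝ) / k) := by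
  have hk' : (0 : ℝ) < k := by exact_mod_cast hk
  obtain ⟨hd, hg, -, -, hd2, -, hdg, hwn, -⟩ := params hk hkn
  set d := (2 * k).size
  obtain ⟨g, hgd⟩ : ∃ g, g = (n + k).size / d := ⟨_, rfl⟩
  rw [← hgd] at hg hdg ⊢
  obtain ⟨e, rfl⟩ : ∃ e, g = e + 1 := ⟨g - 1, by omega⟩
  have h1 : (2 ^ e) ^ d * 2 ^ d ≤ 4 * n := by
    calc (2 ^ e) ^ d * 2 ^ d = 2 ^ (d * (e + 1)) := by
          rw [← pow_mul, ← pow_add]; congr 1; ring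
      _ ≤ 2 ^ (n + k).size := Nat.pow_le_pow_right (by norm_num) hdg
      _ ≤ _ := by omega
  have h2 : (2 ^ e) ^ 2 * (2 * k) ≤ 4 * n :=
    (Nat.mul_le_mul (Nat.pow_le_pow_right (by positivity) hd) hd2.le).trans h1
  have h3 : ((2 : ℝ) ^ e) ^ 2 ≤ 2 * ((n : ℝ) / k) := by
    rw [← mul_div_assoc, le_div_iff₀ hk']
    have : ((2 ^ e) ^ 2 * (2 * k) : ℝ) ≤ 4 * n := by exact_mod_cast h2
    linarith
  have hq : (0 : ℝ) ≤ (n : ℝ) / k := by positivity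
  have h4 : (2 : ℝ) ^ e ≤ 2 * √((n : ℝ) / k) := by
    refine abs_le_of_sq_le_sq' ?_ (by positivity) |>.2
    rw [mul_pow, Real.sq_sqrt hq]
    linarith
  rw [pow_succ]
  linarith

end reals

/-- Constants for the time. -/
noncomputable def timeSum : ℝ := ∑' l : ℕ, ((l : ℝ) + 2) ^ 2 * stay ^ l

theorem summable_time : Summable fun l : ℕ => ((l : ℝ) + 2) ^ 2 * stay ^ l := by
  have hs : ‖stay‖ < 1 := by rw [Real.norm_of_nonneg stay_nonneg]; exact stay_lt_one
  have h2 := summable_pow_mul_geometric_of_norm_lt_one 2 hs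
  have h1 := summable_pow_mul_geometric_of_norm_lt_one 1 hs
  have h0 := summable_pow_mul_geometric_of_norm_lt_one 0 hs
  exact ((h2.add (h1.mul_left 4)).add (h0.mul_left 4)).congr fun l => by ring

theorem timeSum_nonneg : 0 ≤ timeSum :=
  tsum_nonneg fun l => mul_nonneg (by positivity) (pow_nonneg stay_nonneg l)

theorem tsum_time : ∑' l : ℕ, (((l + 2) ^ 2 : ℕ) : ℝ≥0∞) * ENNReal.ofReal stay ^ l =
    ENNReal.ofReal timeSum := by
  rw [timeSum, ENNReal.ofReal_tsum_of_nonneg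
    (fun l => mul_nonneg (by positivity) (pow_nonneg stay_nonneg l)) summable_time]
  refine tsum_congr fun l => ?_
  rw [ENNReal.ofReal_mul (by positivity), ENNReal.ofReal_pow stay_nonneg]
  congr 1
  rw [show ((l : ℝ) + 2) ^ 2 = (((l + 2) ^ 2 : ℕ) : ℝ) by push_cast; ring, ENNReal.ofReal_natCast]

theorem measurableSet_le_card {Ω : Type*} [MeasurableSpace Ω] {μ : Measure Ω}
    {Y : ℕ → ℕ → ℕ → Ω → ℕ} {k n : ℕ} (hY : UniformHash μ Y n) (hk : 1 ≤ k) (l : ℕ) :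
    MeasurableSet {ω | k ≤ (alive k (at' Y ω) n l).card} := by
  have : {ω | k ≤ (alive k (at' Y ω) n l).card} =
      {ω | (k : ℝ≥0∞) ≤ (active k (at' Y ω) n l).card} := by
    ext ω
    simp only [Set.mem_ofPred_eq, Nat.cast_le, active]
    split_ifs with h
    · simp; omega
    · rfl
  rw [this]
  exact measurableSet_le measurable_const (measurable_card_active hY k l)

/-! ### Expected time and space -/

section
variable {Ω : Type*} [MeasurableSpace Ω] {μ : Measure Ω} [IsProbabilityMeasure μ]
  {Y : ℕ → ℕ → ℕ → Ω → ℕ} {k n : ℕ}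

theorem active_of_le {h : ℕ → ℕ → ℕ → ℕ} {l : ℕ} (hl : k ≤ (alive k h n l).card) :
    active k h n l = alive k h n l := if_neg (not_lt.2 hl)

theorem lintegral_build_le (hY : UniformHash μ Y n) (hk : 1 ≤ k) :
    ∫⁻ ω, ((10 ^ 6 * n : ℕ) : ℝ≥0∞) + 10 ^ 7 * ∑' l : ℕ, (((l + 2) ^ 2 : ℕ) : ℝ≥0∞) *
      ((active k (at' Y ω) n l).card : ℝ≥0∞) ∂μ ≤
      ENNReal.ofReal (10 ^ 7 * (1 + timeSum) * n) := by
  rw [lintegral_add_left measurable_const, lintegral_const, measure_univ, mul_one,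
    lintegral_const_mul _ (Measurable.tsum fun l => (measurable_card_active hY k l).const_mul _),
    lintegral_tsum fun l => ((measurable_card_active hY k l).const_mul _).aemeasurable]
  have h1 : ∑' l : ℕ, ∫⁻ ω, (((l + 2) ^ 2 : ℕ) : ℝ≥0∞) *
      ((active k (at' Y ω) n l).card : ℝ≥0∞) ∂μ ≤ n * ENNReal.ofReal timeSum := by
    rw [← tsum_time, ← ENNReal.tsum_mul_left]
    refine ENNReal.tsum_le_tsum fun l => ?_
    rw [lintegral_const_mul _ (measurable_card_active hY k l), mul_left_comm]
    gcongr
    exact lintegral_card_active_le hY hk l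
  calc _ ≤ ((10 ^ 6 * n : ℕ) : ℝ≥0∞) + 10 ^ 7 * (n * ENNReal.ofReal timeSum) := by gcongr
    _ = ENNReal.ofReal (10 ^ 6 * n + 10 ^ 7 * (n * timeSum)) := by
      have := timeSum_nonneg
      rw [ENNReal.ofReal_add (by positivity) (by positivity), ENNReal.ofReal_mul (by positivity),
        ENNReal.ofReal_mul (by positivity), ENNReal.ofReal_mul (by positivity)]
      simp [ENNReal.ofReal_pow]
      norm_num
    _ ≤ _ := by
      apply ENNReal.ofReal_le_ofReal
      have : (0 : ℝ) ≤ n := by positivity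
      nlinarith

theorem lintegral_query_le (hY : UniformHash μ Y n) (hk : 1 ≤ k) (j : ℕ) :
    ∫⁻ ω, 10 ^ 6 + 10 ^ 6 * ∑' l : ℕ, (((l + 2) ^ 2 : ℕ) : ℝ≥0∞) *
      {ω | j ∈ active k (at' Y ω) n l}.indicator 1 ω ∂μ ≤
      ENNReal.ofReal (10 ^ 7 * (1 + timeSum)) := by
  have hm : ∀ l : ℕ, Measurable fun ω => (((l + 2) ^ 2 : ℕ) : ℝ≥0∞) *
      {ω | j ∈ active k (at' Y ω) n l}.indicator (1 : Ω → ℝ≥0∞) ω := fun l =>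
    (measurable_one.indicator (measurableSet_mem_active hY k l j)).const_mul _
  rw [lintegral_add_left measurable_const, lintegral_const, measure_univ, mul_one,
    lintegral_const_mul _ (Measurable.tsum hm), lintegral_tsum fun l => (hm l).aemeasurable]
  have h1 : ∑' l : ℕ, ∫⁻ ω, (((l + 2) ^ 2 : ℕ) : ℝ≥0∞) *
      {ω | j ∈ active k (at' Y ω) n l}.indicator (1 : Ω → ℝ≥0∞) ω ∂μ ≤
      ENNReal.ofReal timeSum := by
    rw [← tsum_time]
    refine ENNReal.tsum_le_tsum fun l => ?_
    rw [lintegral_const_mul _ (measurable_one.indicator (measurableSet_mem_active hY k l j)),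
      lintegral_indicator_one (measurableSet_mem_active hY k l j)]
    gcongr
    exact measure_mem_active_le hY hk l j
  calc _ ≤ 10 ^ 6 + 10 ^ 6 * ENNReal.ofReal timeSum := by gcongr
    _ = ENNReal.ofReal (10 ^ 6 + 10 ^ 6 * timeSum) := by
      have := timeSum_nonneg
      rw [ENNReal.ofReal_add (by positivity) (by positivity), ENNReal.ofReal_mul (by positivity)]
      simp [ENNReal.ofReal_pow]
    _ ≤ _ := by
      apply ENNReal.ofReal_le_ofReal
      have := timeSum_nonneg
      nlinarith

/-- Constant for the space. -/
noncomputable def spaceConst : ℝ := 60 + 24 * (1 - √stay)⁻¹ + 18 * (1 - stay)⁻¹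

/-- A number p ≤ min(1, x) satisfies p² ≤ x. The square root matters: each round costs O(w) bits,
and the bound (n/k) `stay` ^ l alone would give (n/k) log n bits in total. -/
theorem measure_le_card_le (hY : UniformHash μ Y n) (hk : 1 ≤ k) (l : ℕ) :
    μ {ω | k ≤ (alive k (at' Y ω) n l).card} ≤
      ENNReal.ofReal (√((n : ℝ) / k) * √stay ^ l) := by
  have hk' : (0 : ℝ) < k := by exact_mod_cast hk
  have h1 := mul_measure_le_card_alive hY hk l
  set p := μ {ω | k ≤ (alive k (at' Y ω) n l).card} with hp
  have hp1 : p ≤ 1 := prob_le_one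
  have hptop : p ≠ ⊤ := (hp1.trans_lt ENNReal.one_lt_top).ne
  rw [← ENNReal.ofReal_toReal hptop] at h1 ⊢
  set a := p.toReal with ha
  have ha0 : 0 ≤ a := ENNReal.toReal_nonneg
  have ha1 : a ≤ 1 := by
    rw [ha]; exact ENNReal.toReal_le_of_le_ofReal zero_le_one (by simpa using hp1)
  rw [← ENNReal.ofReal_pow stay_nonneg, ← ENNReal.ofReal_natCast, ← ENNReal.ofReal_natCast,
    ← ENNReal.ofReal_mul (by positivity), ← ENNReal.ofReal_mul (by positivity),
    ENNReal.ofReal_le_ofReal_iff (mul_nonneg (by positivity) (pow_nonneg stay_nonneg l))] at h1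
  apply ENNReal.ofReal_le_ofReal
  have h2 : a ≤ (n : ℝ) / k * stay ^ l := by
    rw [div_mul_eq_mul_div, le_div_iff₀ hk']; linarith
  refine abs_le_of_sq_le_sq' ?_ (by positivity) |>.2
  rw [mul_pow, Real.sq_sqrt (by positivity), ← pow_mul, mul_comm l 2, pow_mul,
    Real.sq_sqrt stay_nonneg]
  nlinarith

theorem lintegral_space_le (hY : UniformHash μ Y n) (hk : 1 ≤ k) (hkn : k ≤ n) :
    ∫⁻ ω, (((6 + 2 ^ ((n + k).size / (2 * k).size)) * (n + k).size : ℕ) : ℝ≥0∞) +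
      ∑' l : ℕ, (((4 * (n + k).size : ℕ) : ℝ≥0∞) *
          {ω | k ≤ (alive k (at' Y ω) n l).card}.indicator 1 ω +
        ((6 * (2 * k).size : ℕ) : ℝ≥0∞) / k * ((active k (at' Y ω) n l).card : ℝ≥0∞)) ∂μ ≤
      ENNReal.ofReal (spaceConst * ((n : ℝ) / k * max 1 (Real.logb 2 k))) := by
  have hk' : (0 : ℝ) < k := by exact_mod_cast hk
  have hw := natSize_mul_sqrt_le hk hkn
  have hd := natSize_two_mul_le hk
  have hg := two_pow_div_le hk hkn
  have hq1 : (1 : ℝ) ≤ (n : ℝ) / k := by rw [le_div_iff₀ hk', one_mul]; exact_mod_cast hkn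
  set w := (n + k).size
  set d := (2 * k).size
  set g := w / d
  set q := (n : ℝ) / k with hq
  set L := max 1 (Real.logb 2 k)
  have hL : 1 ≤ L := le_max_left _ _
  have hs := stay_nonneg
  have hs1 := stay_lt_one
  have hr : √stay < 1 := by rw [Real.sqrt_lt' one_pos]; simpa using hs1
  have m1 : ∀ l : ℕ, Measurable fun ω => ((4 * w : ℕ) : ℝ≥0∞) *
      {ω | k ≤ (alive k (at' Y ω) n l).card}.indicator (1 : Ω → ℝ≥0∞) ω := fun l =>
    (measurable_one.indicator (measurableSet_le_card hY hk l)).const_mul _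
  have m2 : ∀ l : ℕ, Measurable fun ω => ((6 * d : ℕ) : ℝ≥0∞) / k *
      ((active k (at' Y ω) n l).card : ℝ≥0∞) := fun l =>
    (measurable_card_active hY k l).const_mul _
  rw [lintegral_add_left measurable_const, lintegral_const, measure_univ, mul_one,
    lintegral_tsum (f := fun (l : ℕ) ω => ((4 * w : ℕ) : ℝ≥0∞) *
        {ω | k ≤ (alive k (at' Y ω) n l).card}.indicator (1 : Ω → ℝ≥0∞) ω +
      ((6 * d : ℕ) : ℝ≥0∞) / k * ((active k (at' Y ω) n l).card : ℝ≥0∞))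
      fun l => ((m1 l).add (m2 l)).aemeasurable]
  have h1 : ∀ l : ℕ, ∫⁻ ω, (((4 * w : ℕ) : ℝ≥0∞) *
      {ω | k ≤ (alive k (at' Y ω) n l).card}.indicator (1 : Ω → ℝ≥0∞) ω + ((6 * d : ℕ) : ℝ≥0∞) / k *
      ((active k (at' Y ω) n l).card : ℝ≥0∞)) ∂μ ≤
      ENNReal.ofReal (4 * w * √q * √stay ^ l + 6 * d * q * stay ^ l) := by
    intro l
    rw [lintegral_add_left (m1 l), lintegral_const_mul _
      (measurable_one.indicator (measurableSet_le_card hY hk l)),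
      lintegral_indicator_one (measurableSet_le_card hY hk l),
      lintegral_const_mul _ (measurable_card_active hY k l),
      ENNReal.ofReal_add (by positivity) (by positivity)]
    refine add_le_add ?_ ?_
    · calc _ ≤ ((4 * w : ℕ) : ℝ≥0∞) * ENNReal.ofReal (√q * √stay ^ l) := by
            gcongr; exact measure_le_card_le hY hk l
        _ = _ := by
            rw [← ENNReal.ofReal_natCast, ← ENNReal.ofReal_mul (by positivity)]
            push_cast; congr 1; ring
    · calc _ ≤ ((6 * d : ℕ) : ℝ≥0∞) / k * (n * ENNReal.ofReal stay ^ l) := by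
            gcongr; exact lintegral_card_active_le hY hk l
        _ = _ := by
            rw [← ENNReal.ofReal_natCast, ← ENNReal.ofReal_natCast, ← ENNReal.ofReal_natCast,
              ← ENNReal.ofReal_div_of_pos hk', ← ENNReal.ofReal_pow stay_nonneg,
              ← ENNReal.ofReal_mul (by positivity), ← ENNReal.ofReal_mul (by positivity)]
            push_cast; congr 1; rw [hq]; ring
  have s1 := (hasSum_geometric_of_lt_one (Real.sqrt_nonneg stay) hr).mul_left (4 * w * √q)
  have s2 := (hasSum_geometric_of_lt_one hs hs1).mul_left (6 * d * q)
  have s3 := s1.add s2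
  have hi1 : 0 ≤ (1 - √stay)⁻¹ := inv_nonneg.2 (by linarith)
  have hi2 : 0 ≤ (1 - stay)⁻¹ := inv_nonneg.2 (by linarith)
  calc _ ≤ (((6 + 2 ^ g) * w : ℕ) : ℝ≥0∞) + ∑' l : ℕ,
        ENNReal.ofReal (4 * w * √q * √stay ^ l + 6 * d * q * stay ^ l) := by
        gcongr with l; exact h1 l
    _ = ENNReal.ofReal ((6 + 2 ^ g) * w + (4 * w * √q * (1 - √stay)⁻¹ +
          6 * d * q * (1 - stay)⁻¹)) := by
      rw [← ENNReal.ofReal_tsum_of_nonneg (fun l => by positivity) s3.summable, s3.tsum_eq,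
        ← ENNReal.ofReal_natCast, ← ENNReal.ofReal_add (by positivity) (by positivity)]
      push_cast; rfl
    _ ≤ _ := by
      apply ENNReal.ofReal_le_ofReal
      have hsq : 1 ≤ √q := Real.one_le_sqrt.2 hq1
      -- The header and the digit-sum table; `hw` turns the factor 10 into the 60 of `spaceConst`,
      -- and likewise 4 into 24 for the rounds.
      have e1 : (6 + (2 : ℝ) ^ g) * w ≤ 10 * (w * √q) := by
        have : 6 + (2 : ℝ) ^ g ≤ 10 * √q := by linarith
        calc _ ≤ 10 * √q * w := by gcongr
          _ = _ := by ring
      have e2 : 4 * w * √q * (1 - √stay)⁻¹ ≤ 24 * (1 - √stay)⁻¹ * (q * L) := by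
        have := mul_le_mul_of_nonneg_right hw hi1
        linarith
      have e3 : 6 * d * q * (1 - stay)⁻¹ ≤ 18 * (1 - stay)⁻¹ * (q * L) := by
        have : d * q ≤ 3 * L * q := by gcongr
        have := mul_le_mul_of_nonneg_right this hi2
        linarith
      rw [spaceConst]
      linarith

end

end RAM


/-! ### The main theorem -/

open RAM Rounds

theorem mainTheorem9 :
    ∃ (build query : RAM.Prog) (C : ℝ),
      ∀ (k : ℕ), 1 ≤ k →
      ∀ (U : Type*) (S : Finset U), S.Nonempty →
      ∀ (keys : List U), (keys : Multiset U) = S.val →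
      ∀ (Ω : Type*) [MeasurableSpace Ω] (μ : Measure Ω) [IsProbabilityMeasure μ]
        (H : ℕ → (m : ℕ) → U → Ω → Fin (m + 1)), SimpleUniformHashing μ H →
        (∀ᵐ ω ∂μ, RAM.Correct build query k S keys (fun s m x => H s m x ω)) ∧
        (∀ x ∈ S, ∫⁻ ω, RAM.queryTime build query k keys x (fun s m x => H s m x ω) ∂μ
          ≤ ENNReal.ofReal C) ∧
        ∫⁻ ω, RAM.spaceBits build k keys (fun s m x => H s m x ω) ∂μ
          ≤ ENNReal.ofReal (C * ((S.card : ℝ) / k * max 1 (Real.logb 2 k))) ∧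
        ∫⁻ ω, RAM.buildTime build k keys (fun s m x => H s m x ω) ∂μ
          ≤ ENNReal.ofReal (C * S.card) := by
  refine ⟨buildP, queryP, max (10 ^ 7 * (1 + timeSum)) spaceConst, ?_⟩
  intro k hk U S hne keys hS Ω _ μ _ H hH
  have hn := length_eq_card hS
  have hn1 : 1 ≤ keys.length := hn ▸ hne.card_pos
  have ht := timeSum_nonneg
  have hC1 : 10 ^ 7 * (1 + timeSum) ≤ max (10 ^ 7 * (1 + timeSum)) spaceConst := le_max_left _ _
  have hC2 : spaceConst ≤ max (10 ^ 7 * (1 + timeSum)) spaceConst := le_max_right _ _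
  set C := max (10 ^ 7 * (1 + timeSum)) spaceConst
  rw [← hn]
  -- For n < k there is only one bucket, and the bounds hold for every outcome of the hash
  -- functions.
  rcases Nat.lt_or_ge keys.length k with hkn | hkn
  · have h := fun ω => correct_of_lt (hash := fun s m x => H s m x ω) hS hn1 hkn
    have hb : (1000 : ℝ≥0∞) = ENNReal.ofReal 1000 := by simp
    refine ⟨.of_forall fun ω => (h ω).1, fun x _ => ?_, ?_, ?_⟩
    · refine (lintegral_mono fun ω => (h ω).2.2.2 x).trans ?_
      rw [lintegral_const, measure_univ, mul_one, hb]
      exact ENNReal.ofReal_le_ofReal (by linarith)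
    · simp [(h _).2.2.1]
    · refine (lintegral_mono fun ω => (h ω).2.1).trans ?_
      rw [lintegral_const, measure_univ, mul_one, hb]
      have : (1 : ℝ) ≤ keys.length := by exact_mod_cast hn1
      exact ENNReal.ofReal_le_ofReal (by nlinarith)
  · have hY := uniformHash hH (nodup_of_coe_eq hS)
    have hae : ∀ᵐ ω ∂μ, ∃ l, (alive k (keyHash keys fun s m x => H s m x ω) keys.length l).card <
      k := ae_exists_card_alive_lt hY hk
    have key := hae.mono fun ω hω => correct_of_le hS hk hkn hω
    refine ⟨key.mono fun ω ⟨T, h⟩ => h.2.1, fun x hx => ?_, ?_, ?_⟩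
    · obtain ⟨j, hj, rfl⟩ := (mem_iff_getElem hS x).1 hx
      refine le_trans (lintegral_mono_ae (key.mono fun ω ⟨T, hlt, _, _, _, h⟩ =>
        (h j hj).trans ?_)) ((lintegral_query_le hY hk j).trans (ENNReal.ofReal_le_ofReal hC1))
      push_cast
      refine add_le_add (by norm_num) (mul_le_mul' (by norm_num) ?_)
      -- The number T of rounds is random. In rounds before T the active keys are the remaining
      -- ones, so the sum is dominated by a series over all rounds that no longer mentions T.
      refine le_trans (Finset.sum_le_sum fun l hl => ?_) (ENNReal.sum_le_tsum (Finset.range T))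
      rw [← active_of_le (hlt l (Finset.mem_range.1 hl))]
      split_ifs with hm
      · refine le_trans ?_ (mul_le_mul' le_rfl (Set.indicator_of_mem hm 1).ge)
        simp
      · simp
    · refine le_trans (lintegral_mono_ae (key.mono fun ω ⟨T, hlt, _, _, h, _⟩ => h.trans ?_))
        ((lintegral_space_le hY hk hkn).trans (ENNReal.ofReal_le_ofReal (by gcongr)))
      obtain ⟨hd, hg, -⟩ := params hk hkn
      -- w < gd + d ≤ 2gd, because g ≥ 1.
      have hw : (keys.length + k).size ≤
          2 * ((keys.length + k).size / (2 * k).size * (2 * k).size) := by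
        have h1 := Nat.lt_div_mul_add (a := (keys.length + k).size)
          (show 0 < (2 * k).size by omega)
        have h2 := Nat.mul_le_mul_right (2 * k).size hg
        omega
      refine (Nat.cast_le.2 (adr_mul_le hk hw T)).trans ?_
      rw [Nat.cast_add, Nat.cast_sum]
      gcongr
      refine le_trans (Finset.sum_le_sum fun l hl => ?_) (ENNReal.sum_le_tsum (Finset.range T))
      have hl' := hlt l (Finset.mem_range.1 hl)
      refine le_trans ?_ (add_le_add (mul_le_mul' le_rfl (Set.indicator_of_mem hl' 1).ge) le_rfl)
      rw [← active_of_le hl', Nat.cast_add, Nat.cast_mul (6 * _)]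
      simp only [Pi.one_apply, mul_one]
      rw [div_eq_mul_inv _ (k : ℝ≥0∞), mul_assoc, mul_comm (k : ℝ≥0∞)⁻¹, ← div_eq_mul_inv]
      gcongr
      rw [ENNReal.le_div_iff_mul_le (by left; simp; omega) (by left; simp)]
      exact_mod_cast Nat.div_mul_le_self _ _
    · refine le_trans (lintegral_mono_ae (key.mono fun ω ⟨T, hlt, _, h, _, _⟩ => h.trans ?_))
        ((lintegral_build_le hY hk).trans (ENNReal.ofReal_le_ofReal (by gcongr)))
      rw [Nat.cast_add, Nat.cast_mul (10 ^ 7), Nat.cast_sum]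
      push_cast
      refine add_le_add (by norm_num) (mul_le_mul' (by norm_num) ?_)
      refine le_trans (Finset.sum_le_sum fun l hl => ?_) (ENNReal.sum_le_tsum (Finset.range T))
      rw [← active_of_le (hlt l (Finset.mem_range.1 hl))]
      gcongr
      norm_num
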